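/- Let $(M,\omega)$ be a closed (compact, without boundary) symplectic manifold of dimension $2n$. For $H\in C^\infty([0,1]\times M)$ let $X_H$ be the time-dependent vector field given by $\omega(X_{H},\cdot)=-dH_t$, let $\varphi_H^t$ be its flow, let $\mathrm{Ham}(M,\omega)=\{\varphi_H^1\}$ be the group of Hamiltonian diffeomorphisms with the $C^\infty$ topology, and put $(H\#G)(t,x)=H(t,x)+G(t,(\varphi_H^t)^{-1}(x))$ and $H^m=H\#\cdots\#H$ ($m$ factors). Let $\mathrm{Spec}(H)$ be the set of the numbers $\int_0^1H(t,x(t))\,dt-\int_v\omega$, where $x:[0,1]\to M$ is an orbit of $X_H$ with $x(0)=x(1)$ and $v:\Sigma\to M$ is a (piecewise smooth) map from a compact oriented surface $\Sigma$ with one boundary component such that $v|_{\partial\Sigma}=x$. For $k\ge1$ let $\mathrm{Spec}_k(H)=\bigcup\big(\mathrm{Spec}(H^{k_1})+\dots+\mathrm{Spec}(H^{k_l})\big)$, the union over all tuples of positive integers with $k_1+\dots+k_l=k$. A function $c:C^\infty([0,1]\times M)\to\mathbb R$ is called *spectral* if it is continuous in the $C^\infty$ topology and $c(H)\in\bigcup_{k\ge1}\mathrm{Spec}_k(H)$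 for all $H$. It is *sub-additive* if $c(H\#G)\le c(H)+c(G)$ for all $H,G$; the *homogenization* of a sub-additive spectral function $c$ is $\zeta(H)=\lim_{m\to\infty}c(H^m)/m$. A sequence of functions $f_k:C^\infty([0,1]\times M)\to\mathbb R$ ($k\ge 1$) *satisfies the Weyl law* if, for all $H$, $$\lim_{k\to\infty}\frac1k f_k(H)=\frac1{\mathrm{Vol}(M)}\int_0^1\!\int_M H_t\,\omega^n\,dt,\qquad \mathrm{Vol}(M)=\int_M\omega^n .$$ **Lemma 2.1.** Suppose that there is a sequence $(c_k)_{k\ge1}$ of spectral functions that satisfies the Weyl law, or a sequence $(c_k)_{k\ge1}$ of sub-additive spectral functions whose homogenizations $(\zeta_k)_{k\ge1}$ satisfy the Weyl law. Then the $C^\infty$ closing lemma holds for Hamiltonian diffeomorphisms of $(M,\omega)$: for every $\varphi\in\mathrm{Ham}(M,\omega)$, every nonempty open set $U\subset M$ and every $C^\infty$-open neighbourhood $V\subset\mathrm{Ham}(M,\omega)$ of $\varphi$, there is a $\varphi'\in V$ that has a periodic point in $U$. -/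

import Mathlib

open Set MeasureTheory Filter
open scoped Manifold Topology ContDiff

namespace SymplecticClosing

noncomputable section

/-! ### The smooth topology on spaces of smooth maps -/

section SmoothTopology

variable {E : Type*} [NormedAddCommGroup E] [NormedSpace ℝ E]
  {B : Type*} [TopologicalSpace B] (I : ModelWithCorners ℝ E B)
  {X : Type*} [TopologicalSpace X] [ChartedSpace B X]
  {E' : Type*} [NormedAddCommGroup E'] [NormedSpace ℝ E']
  {B' : Type*} [TopologicalSpace B'] (I' : ModelWithCorners ℝ E' B')
  {Y : Type*} [TopologicalSpace Y] [ChartedSpace B' Y]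

/-- The subbasic neighbourhood `N^r(f; K, ε)` of `f`, for a set `K` in the domain of the chart of
`X` around `x₀` that `f` maps into the domain of the chart of `Y` around `y₀`: all smooth `g` with
`g(K)` inside the same chart domain and with all derivatives of order at most `r` of the chart
representatives of `f` and `g` less than `ε` apart at the points of `K`. -/
def smoothNhd (f : C^∞⟮I, X; I', Y⟯) (x₀ : X) (y₀ : Y) (K : Set X) (r : ℕ) (ε : ℝ) :
    Set C^∞⟮I, X; I', Y⟯ :=
  {g | MapsTo g K (chartAt B' y₀).source ∧
    ∀ x ∈ K, ∀ j ≤ r,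
      ‖iteratedFDerivWithin ℝ j (extChartAt I' y₀ ∘ f ∘ (extChartAt I x₀).symm)
          (extChartAt I x₀).target (extChartAt I x₀ x) -
        iteratedFDerivWithin ℝ j (extChartAt I' y₀ ∘ g ∘ (extChartAt I x₀).symm)
          (extChartAt I x₀).target (extChartAt I x₀ x)‖ < ε}

/-- The `C^∞` topology (uniform convergence of all derivatives on compact sets, in charts) on
the space of smooth maps from `X` to `Y`. -/
abbrev smoothTopology : TopologicalSpace C^∞⟮I, X; I', Y⟯ :=
  TopologicalSpace.generateFrom
    {S | ∃ (f : C^∞⟮I, X; I', Y⟯) (x₀ : X) (y₀ : Y) (K : Set X) (r : ℕ) (ε : ℝ),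
      IsCompact K ∧ K ⊆ (chartAt B x₀).source ∧ MapsTo f K (chartAt B' y₀).source ∧ 0 < ε ∧
      S = smoothNhd I I' f x₀ y₀ K r ε}

end SmoothTopology

/-! ### Symplectic manifolds -/

section Symplectic

variable (n : ℕ) (M : Type*) [TopologicalSpace M]
  [ChartedSpace (EuclideanSpace ℝ (Fin (2 * n))) M]

/-- The representative of a 2-form in the chart around `x₀`, that is, its pullback under the
inverse of the chart (to be used on the target of the chart). -/
def formInChart {n : ℕ} {M : Type*} [TopologicalSpace M]
    [ChartedSpace (EuclideanSpace ℝ (Fin (2 * n))) M]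
    (α : ∀ x : M, TangentSpace (𝓡 (2 * n)) x [⋀^Fin 2]→L[ℝ] ℝ) (x₀ : M)
    (y : EuclideanSpace ℝ (Fin (2 * n))) :
    EuclideanSpace ℝ (Fin (2 * n)) [⋀^Fin 2]→L[ℝ] ℝ :=
  (α ((extChartAt (𝓡 (2 * n)) x₀).symm y)).compContinuousLinearMap
    (mfderiv 𝓘(ℝ, EuclideanSpace ℝ (Fin (2 * n))) (𝓡 (2 * n))
      (extChartAt (𝓡 (2 * n)) x₀).symm y)

/-- A symplectic form on a manifold of dimension `2 * n`: a smooth closed nondegenerate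
differential 2-form. -/
structure SymplecticForm where
  /-- The underlying field of alternating bilinear forms. -/
  form : ∀ x : M, TangentSpace (𝓡 (2 * n)) x [⋀^Fin 2]→L[ℝ] ℝ
  smooth : ∀ x₀ : M, ContDiffOn ℝ ∞ (formInChart form x₀) (extChartAt (𝓡 (2 * n)) x₀).target
  closed : ∀ x₀ : M, ∀ y ∈ (extChartAt (𝓡 (2 * n)) x₀).target,
    extDeriv (formInChart form x₀) y = 0
  nondegenerate : ∀ (x : M) (v : TangentSpace (𝓡 (2 * n)) x),
    (∀ w : TangentSpace (𝓡 (2 * n)) x, form x ![v, w] = 0) → v = 0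

/-- Time-dependent Hamiltonians: the space `C^∞([0, 1] × M)`. -/
abbrev Hamiltonian : Type _ :=
  C^∞⟮(𝓡∂ 1).prod (𝓡 (2 * n)), unitInterval × M; 𝓘(ℝ, ℝ), ℝ⟯

/-- The `C^∞` topology on the space of Hamiltonians. -/
abbrev hamiltonianTopology : TopologicalSpace (Hamiltonian n M) :=
  smoothTopology ((𝓡∂ 1).prod (𝓡 (2 * n))) 𝓘(ℝ, ℝ)

/-- The `C^∞` topology on the group of diffeomorphisms of `M`. -/
abbrev diffeoTopology : TopologicalSpace (M ≃ₘ⟮𝓡 (2 * n), 𝓡 (2 * n)⟯ M) :=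
  TopologicalSpace.induced Diffeomorph.toContMDiffMap
    (smoothTopology (𝓡 (2 * n)) (𝓡 (2 * n)))

variable {n M}

/-- On a symplectic vector space every linear functional is `ω(v, ·)` for some `v`. -/
theorem exists_form_eq (Ω : SymplecticForm n M) (x : M)
    (l : TangentSpace (𝓡 (2 * n)) x →L[ℝ] ℝ) :
    ∃ v : TangentSpace (𝓡 (2 * n)) x, ∀ w : TangentSpace (𝓡 (2 * n)) x,
      Ω.form x ![v, w] = l w := by
  have : FiniteDimensional ℝ (TangentSpace (𝓡 (2 * n)) x) :=
    inferInstanceAs (FiniteDimensional ℝ (EuclideanSpace ℝ (Fin (2 * n))))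
  have hu (v u : TangentSpace (𝓡 (2 * n)) x) : Function.update ![v, 0] 1 u = ![v, u] := by
    ext i
    fin_cases i <;> rfl
  let f : TangentSpace (𝓡 (2 * n)) x →ₗ[ℝ] Module.Dual ℝ (TangentSpace (𝓡 (2 * n)) x) :=
    LinearMap.mk₂ ℝ (fun v w => Ω.form x ![v, w])
      (fun v v' w => by simpa using (Ω.form x).toMultilinearMap.cons_add ![w] v v')
      (fun c v w => by simpa using (Ω.form x).toMultilinearMap.cons_smul ![w] c v)
      (fun v w w' => by
        have := (Ω.form x).toMultilinearMap.map_update_add ![v, 0] 1 w w'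
        simp only [hu] at this
        exact this)
      (fun c v w => by
        have := (Ω.form x).toMultilinearMap.map_update_smul ![v, 0] 1 c w
        simp only [hu] at this
        exact this)
  have hf : Function.Injective f := by
    rw [injective_iff_map_eq_zero]
    intro v hv
    exact Ω.nondegenerate x v fun w => by
      have := congrArg (fun g => g w) hv
      simpa [f] using this
  have hs : Function.Surjective f :=
    (LinearMap.injective_iff_surjective_of_finrank_eq_finrank
      (Subspace.dual_finrank_eq).symm).1 hf
  obtain ⟨v, hv⟩ := hs l.toLinearMap
  exact ⟨v, fun w => by
    have := congrArg (fun g => g w) hv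
    simpa [f] using this⟩

/-- The vector `X_H(t, x)` of the Hamiltonian vector field of `H`. -/
def hamVec (Ω : SymplecticForm n M) (H : Hamiltonian n M) (t : unitInterval) (x : M) :
    TangentSpace (𝓡 (2 * n)) x :=
  (exists_form_eq Ω x
    (-(mfderiv (𝓡 (2 * n)) 𝓘(ℝ, ℝ) (fun z : M => H (t, z)) x :
      TangentSpace (𝓡 (2 * n)) x →L[ℝ] ℝ))).choose

/-- The identity `ω(X_H, ·) = -dH` that defines the Hamiltonian vector field. -/
theorem form_hamVec (Ω : SymplecticForm n M) (H : Hamiltonian n M) (t : unitInterval) (x : M)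
    (w : TangentSpace (𝓡 (2 * n)) x) :
    Ω.form x ![hamVec Ω H t x, w] =
      -(mfderiv (𝓡 (2 * n)) 𝓘(ℝ, ℝ) (fun z : M => H (t, z)) x w : ℝ) :=
  (exists_form_eq Ω x
    (-(mfderiv (𝓡 (2 * n)) 𝓘(ℝ, ℝ) (fun z : M => H (t, z)) x :
      TangentSpace (𝓡 (2 * n)) x →L[ℝ] ℝ))).choose_spec w

/-- The curve `γ` (of which only the restriction to `[0, 1]` matters) satisfies
`γ'(t) = X_H(t, γ(t))` for all `t` in `[0, 1]`, one-sidedly at the end points. -/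
def IsHamOrbit (Ω : SymplecticForm n M) (H : Hamiltonian n M) (γ : ℝ → M) : Prop :=
  ∀ t : unitInterval, HasMFDerivWithinAt 𝓘(ℝ, ℝ) (𝓡 (2 * n)) γ (Icc 0 1) (t : ℝ)
    (ContinuousLinearMap.toSpanSingleton ℝ (hamVec Ω H t (γ t)))

/-- The isotopy `φ` is the Hamiltonian flow of `H` over the time interval `[0, 1]`. -/
def IsHamFlow (Ω : SymplecticForm n M) (H : Hamiltonian n M)
    (φ : unitInterval → (M ≃ₘ⟮𝓡 (2 * n), 𝓡 (2 * n)⟯ M)) : Prop :=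
  (∀ x, φ 0 x = x) ∧ ∀ x, IsHamOrbit Ω H fun s => φ (projIcc 0 1 zero_le_one s) x

/-- The group of Hamiltonian diffeomorphisms: the time-one maps of Hamiltonian flows. -/
def Ham (Ω : SymplecticForm n M) : Set (M ≃ₘ⟮𝓡 (2 * n), 𝓡 (2 * n)⟯ M) :=
  {ψ | ∃ H φ, IsHamFlow Ω H φ ∧ φ 1 = ψ}

/-- `K` is the composition `H # G`, given by `(H # G)(t, x) = H(t, x) + G(t, (φ_H^t)⁻¹(x))`. -/
def IsComposition (Ω : SymplecticForm n M) (H G K : Hamiltonian n M) : Prop :=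
  ∃ φ, IsHamFlow Ω H φ ∧ ∀ (t : unitInterval) (x : M), K (t, x) = H (t, x) + G (t, (φ t).symm x)

/-- `K` is the `m`-fold composition `H^m = H # ⋯ # H` (with `H^0 = 0`). -/
def IsPower (Ω : SymplecticForm n M) (H : Hamiltonian n M) : ℕ → Hamiltonian n M → Prop
  | 0, K => K = 0
  | m + 1, K => ∃ L, IsPower Ω H m L ∧ IsComposition Ω H L K

/-! ### Cappings and action spectra -/

/-- The standard triangle, with vertices `(0, 0)`, `(1, 0)`, `(0, 1)`. -/
def stdTriangle : Set (ℝ × ℝ) := {p | 0 ≤ p.1 ∧ 0 ≤ p.2 ∧ p.1 + p.2 ≤ 1}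

/-- The three sides of the standard triangle, parametrized over `[0, 1]` in the direction of the
boundary orientation. -/
def side (j : Fin 3) (t : ℝ) : ℝ × ℝ := ![(t, 0), (1 - t, t), (0, 1 - t)] j

/-- A capping of the loop `x : [0, 1] → M`, `x 0 = x 1`: a map `v : Σ → M`, smooth on the closed
triangles of a triangulation, from a compact oriented surface `Σ` with one boundary component, such
that `v` restricted to `∂Σ` is `x`.

The surface is obtained from finitely many copies of the standard triangle by gluing all sides
except one in pairs, reversing the orientation of the sides. Such a gluing always is a compact
oriented surface whose boundary is a single circle, made of the one free side; each compact oriented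
surface with one boundary component arises in this way. -/
structure Capping (x : ℝ → M) where
  /-- The number of triangles. -/
  size : ℕ
  /-- The pairing of the sides; the side `j` of the triangle `i` is the pair `(i, j)`. -/
  pair : Fin size × Fin 3 → Fin size × Fin 3
  /-- The free side, which forms the boundary of the surface. -/
  free : Fin size × Fin 3
  pair_pair : ∀ d, pair (pair d) = d
  pair_eq_self_iff : ∀ d, pair d = d ↔ d = free
  /-- The map on each triangle. -/
  map : Fin size → ℝ × ℝ → M
  smooth : ∀ i, ContMDiffOn 𝓘(ℝ, ℝ × ℝ) (𝓡 (2 * n)) ∞ (map i) stdTriangle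
  map_pair : ∀ d, d ≠ free → ∀ t ∈ Icc (0 : ℝ) 1,
    map (pair d).1 (side (pair d).2 (1 - t)) = map d.1 (side d.2 t)
  map_free : ∀ t ∈ Icc (0 : ℝ) 1, map free.1 (side free.2 t) = x t

/-- The symplectic area `∫_v ω` of a capping `v`. -/
def Capping.area (Ω : SymplecticForm n M) {x : ℝ → M} (v : Capping (n := n) x) : ℝ :=
  ∑ i, ∫ p in stdTriangle, Ω.form (v.map i p)
    ![mfderivWithin 𝓘(ℝ, ℝ × ℝ) (𝓡 (2 * n)) (v.map i) stdTriangle p ((1, 0) : ℝ × ℝ),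
      mfderivWithin 𝓘(ℝ, ℝ × ℝ) (𝓡 (2 * n)) (v.map i) stdTriangle p ((0, 1) : ℝ × ℝ)]

/-- The action `∫_0^1 H(t, x(t)) dt - ∫_v ω` of a capped loop. -/
def action (Ω : SymplecticForm n M) (H : Hamiltonian n M) (x : ℝ → M)
    (v : Capping (n := n) x) : ℝ :=
  (∫ t : unitInterval, H (t, x t)) - v.area Ω

/-- The action spectrum `Spec(H)`: the actions of the capped one-periodic orbits of `X_H`. -/
def Spec (Ω : SymplecticForm n M) (H : Hamiltonian n M) : Set ℝ :=
  {a | ∃ (x : ℝ → M) (v : Capping (n := n) x), IsHamOrbit Ω H x ∧ x 0 = x 1 ∧ a = action Ω H x v}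

/-- The set `Spec_k(H)`, the union of the sets `Spec(H^{k₁}) + ⋯ + Spec(H^{kₗ})` over all tuples
of positive integers with `k₁ + ⋯ + kₗ = k`. -/
def SpecK (Ω : SymplecticForm n M) (k : ℕ) (H : Hamiltonian n M) : Set ℝ :=
  {a | ∃ (κ : Composition k) (K : Fin κ.length → Hamiltonian n M) (b : Fin κ.length → ℝ),
    (∀ i, IsPower Ω H (κ.blocksFun i) (K i) ∧ b i ∈ Spec Ω (K i)) ∧ a = ∑ i, b i}

/-! ### Spectral functions -/

/-- A spectral function: continuous in the `C^∞` topology, with `c(H) ∈ ⋃_{k ≥ 1} Spec_k(H)`. -/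
def IsSpectral (Ω : SymplecticForm n M) (c : Hamiltonian n M → ℝ) : Prop :=
  Continuous[hamiltonianTopology n M, inferInstance] c ∧
    ∀ H, ∃ k : ℕ, 1 ≤ k ∧ c H ∈ SpecK Ω k H

/-- Sub-additivity, `c(H # G) ≤ c(H) + c(G)`. -/
def IsSubadditive (Ω : SymplecticForm n M) (c : Hamiltonian n M → ℝ) : Prop :=
  ∀ H G K, IsComposition Ω H G K → c K ≤ c H + c G

/-- `ζ` is the homogenization of `c`, that is, `ζ(H) = lim_m c(H^m) / m`. -/
def IsHomogenization (Ω : SymplecticForm n M) (c ζ : Hamiltonian n M → ℝ) : Prop :=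
  ∀ (H : Hamiltonian n M) (P : ℕ → Hamiltonian n M), (∀ m, IsPower Ω H m (P m)) →
    Tendsto (fun m : ℕ => c (P m) / m) atTop (𝓝 (ζ H))

/-! ### The Weyl law and the closing lemma -/

/-- The value of the top exterior power `α^n = α ∧ ⋯ ∧ α` of a 2-form on the standard basis of
`ℝ^{2n}`. -/
def topPower {n : ℕ} (α : EuclideanSpace ℝ (Fin (2 * n)) [⋀^Fin 2]→L[ℝ] ℝ) : ℝ :=
  (1 / 2 ^ n) * ∑ σ : Equiv.Perm (Fin (2 * n)), ((Equiv.Perm.sign σ : ℤ) : ℝ) *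
    ∏ i : Fin n, α ![EuclideanSpace.single (σ ⟨2 * i, by omega⟩) 1,
      EuclideanSpace.single (σ ⟨2 * i + 1, by omega⟩) 1]

/-- The measure on `M` given by the volume form `ω^n`. In a chart it has the density
`|ω^n(∂₁, …, ∂₂ₙ)|`; the measures so obtained on the chart domains agree on the overlaps, and
their supremum is the measure on `M` that they glue to. -/
def SymplecticForm.volume [MeasurableSpace M] (Ω : SymplecticForm n M) : Measure M :=
  ⨆ x₀ : M, (((MeasureTheory.volume : Measure (EuclideanSpace ℝ (Fin (2 * n)))).restrict
      (extChartAt (𝓡 (2 * n)) x₀).target).withDensity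
        fun y => ENNReal.ofReal |topPower (formInChart Ω.form x₀ y)|).map
    (extChartAt (𝓡 (2 * n)) x₀).symm

/-- The average `(1 / Vol(M)) ∫_0^1 ∫_M H_t ω^n dt` of `H`, where `Vol(M) = ∫_M ω^n`. -/
def average [MeasurableSpace M] (Ω : SymplecticForm n M) (H : Hamiltonian n M) : ℝ :=
  1 / Ω.volume.real univ * ∫ t : unitInterval, ∫ x : M, H (t, x) ∂Ω.volume

/-- The Weyl law for a sequence of functions on the space of Hamiltonians: for each `H`, the
sequence `c_k(H) / k` converges to the average of `H`. -/
def SatisfiesWeylLaw [MeasurableSpace M] (Ω : SymplecticForm n M)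
    (c : ℕ → Hamiltonian n M → ℝ) : Prop :=
  ∀ H, Tendsto (fun k : ℕ => 1 / (k : ℝ) * c k H) atTop (𝓝 (average Ω H))

/-- The `C^∞` closing lemma for Hamiltonian diffeomorphisms of `(M, ω)`: each neighbourhood of each
Hamiltonian diffeomorphism, in the subspace topology of `Ham Ω`, contains a Hamiltonian
diffeomorphism with a periodic point in a given nonempty open set `U`. -/
def ClosingLemmaHolds (Ω : SymplecticForm n M) : Prop :=
  ∀ φ ∈ Ham Ω, ∀ U : Set M, IsOpen U → U.Nonempty →
    ∀ V : Set (M ≃ₘ⟮𝓡 (2 * n), 𝓡 (2 * n)⟯ M), IsOpen[diffeoTopology n M] V → φ ∈ V →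
      ∃ φ' ∈ Ham Ω ∩ V, ∃ x ∈ U, x ∈ Function.periodicPts φ'

end Symplectic

end

end SymplecticClosing

open SymplecticClosing

/-! Suppose that no Hamiltonian diffeomorphism in `V` has a periodic point in `U`. Reparametrize `H`
so that its isotopy runs during `[0, 1/3]`, choose a bump function `G ≥ 0` supported in `U`, and let
`G` act with strength `c` during `[2/3, 1]`. The time-one map becomes `Φ_c ∘ φ`, where `Φ` is the
flow of `G`; for small `c` it lies in `V`. The orbit of each of its periodic points then avoids `U`,
and outside `U` the map `Φ_c` is the identity and `G` vanishes. So such an orbit is already a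
periodic orbit of `φ`, and with any capping it has the same action for both Hamiltonians. Hence the
action spectra of all iterates of the perturbed Hamiltonian are contained in those of the
unperturbed one (`spec_hamPow_pert_subset`), and a spectral function evaluated along the
perturbations takes values in one fixed set of finite sums of actions. That set has measure zero
(`IsSmoothFlow.volume_finiteSums_spec`) and the function is continuous in `c`, so it is constant.
The same holds for its values on the `m`-th powers, hence for the homogenization. By the Weyl law
the average of the Hamiltonian does not depend on `c` either; but it grows by `c` times the average
of `G`, which is positive.

The substance is the null set. Cappings have arbitrary topology, but two cappings with the same
gluing pattern and uniformly close maps differ in area by the area of the linear homotopy between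
their boundary loops: this is Stokes' theorem on prisms, in which glued sides cancel
(`sum_triangleArea_sub`). The space of cappings is second countable, so countably many reference
cappings suffice. Near a reference capping the action is a function of the starting point of the
orbit. It extends to a smooth function on an open set of a vector space: flow lines from arbitrary
points are closed up to loops by a correction during `[2/3, 1]`, when the Hamiltonian vanishes.
Fixed points of the time-one map are critical points of this function
(`IsSmoothFlow.fderiv_localAction`). Sard's theorem shows that the actions form a null set; a finite
sum of actions is a critical value of a sum of such functions on a power of the vector space.

The calculus takes place in a vector space `V` of which `M` is a smooth neighbourhood retract
(`exists_smoothRetract`). There the symplectic form pulls back to a closed form, Hamiltonian fields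
extend to compactly supported ones, and flows come from the implicit function theorem on a space of
curves. The identity `IsClosedForm.cyclic_sum_fderiv_pullbackForm`, that pullbacks of closed forms
are closed, gives the symplecticity of flows, Stokes' theorem, and the first variation of area. -/

namespace SymplecticClosing

/-! ### The smooth inverse function theorem and Sard's theorem for functions -/

section Sard

/-- A local inverse provided by the inverse function theorem, smooth on its whole domain. -/
theorem exists_openPartialHomeomorph_contDiffOn {E F : Type*}
    [NormedAddCommGroup E] [NormedSpace ℝ E] [CompleteSpace E]
    [NormedAddCommGroup F] [NormedSpace ℝ F]
    {f : E → F} {U : Set E} (hU : IsOpen U) (hf : ContDiffOn ℝ ∞ f U) {x : E} (hx : x ∈ U)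
    (e : E ≃L[ℝ] F) (he : fderiv ℝ f x = e) :
    ∃ Φ : OpenPartialHomeomorph E F, x ∈ Φ.source ∧ Φ.source ⊆ U ∧ (∀ y, Φ y = f y) ∧
      ContDiffOn ℝ ∞ Φ.symm Φ.target := by
  have hfx : ContDiffAt ℝ ∞ f x := hf.contDiffAt (hU.mem_nhds hx)
  have hd : HasFDerivAt f (e : E →L[ℝ] F) x := by
    rw [← he]
    exact (hfx.differentiableAt (by simp)).hasFDerivAt
  have hn : (∞ : WithTop ℕ∞) ≠ 0 := by simp
  have hc : ContinuousAt (fderiv ℝ f) x :=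
    (hfx.fderiv_right (m := 0) (by simp)).continuousAt
  -- Invertible operators form an open set. Restricting to a neighbourhood on which the derivative
  -- stays invertible makes the inverse smooth at every point of the target, not only at `f x`.
  have h1 : ∀ᶠ y in 𝓝 x, fderiv ℝ f y ∈ range ((↑) : (E ≃L[ℝ] F) → (E →L[ℝ] F)) :=
    hc (he ▸ e.nhds)
  obtain ⟨W, hW, hWo, hxW⟩ := eventually_nhds_iff.1 (h1.and (hU.mem_nhds hx))
  let Φ₀ := hfx.toOpenPartialHomeomorph f hd hn
  have hΦ₀ : ∀ y, Φ₀ y = f y := fun y => rfl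
  refine ⟨Φ₀.restrOpen W hWo, ?_, ?_, fun y => rfl, ?_⟩
  · exact ⟨hfx.mem_toOpenPartialHomeomorph_source hd hn, hxW⟩
  · rintro y ⟨-, hy⟩
    exact (hW y hy).2
  · intro a ha
    have hs := (Φ₀.restrOpen W hWo).map_target ha
    have hsW : (Φ₀.restrOpen W hWo).symm a ∈ W := hs.2
    obtain ⟨⟨e', he'⟩, hyU⟩ := hW _ hsW
    have hca := hf.contDiffAt (hU.mem_nhds hyU)
    refine ((Φ₀.restrOpen W hWo).contDiffAt_symm (f₀' := e') ha ?_ hca).contDiffWithinAt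
    rw [he']
    exact (hca.differentiableAt (by simp)).hasFDerivAt

/-- Taylor's estimate, uniformly near `x₀`, at the points at which the derivatives of order
`1, …, k` vanish. -/
theorem exists_norm_sub_le_pow {E : Type} [NormedAddCommGroup E] [NormedSpace ℝ E] {U : Set E}
    (hU : IsOpen U) {x₀ : E} (hx₀ : x₀ ∈ U) (k : ℕ) :
    ∀ {F : Type} [NormedAddCommGroup F] [NormedSpace ℝ F] (g : E → F), ContDiffOn ℝ ∞ g U →
      ∃ C : ℝ, 0 ≤ C ∧ ∃ ρ > 0, ∀ x ∈ Metric.ball x₀ ρ,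
        (∀ j, 1 ≤ j → j ≤ k → iteratedFDeriv ℝ j g x = 0) →
          ∀ y ∈ Metric.ball x₀ ρ, ‖g y - g x‖ ≤ C * ‖y - x‖ ^ (k + 1) := by
  induction k with
  | zero =>
    intro F _ _ g hg
    have hc : ContinuousAt (fderiv ℝ g) x₀ :=
      ((hg.contDiffAt (hU.mem_nhds hx₀)).fderiv_right (m := 0) (by simp)).continuousAt
    have hb : ∀ᶠ y in 𝓝 x₀, ‖fderiv ℝ g y‖ < ‖fderiv ℝ g x₀‖ + 1 :=
      hc.norm.eventually_lt continuousAt_const (by simp)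
    obtain ⟨ρ, hρ, h⟩ := Metric.eventually_nhds_iff_ball.1 (hb.and (hU.mem_nhds hx₀))
    refine ⟨‖fderiv ℝ g x₀‖ + 1, by positivity, ρ, hρ, fun x hx _ y hy => ?_⟩
    simpa using (convex_ball x₀ ρ).norm_image_sub_le_of_norm_hasFDerivWithin_le (𝕜 := ℝ)
      (f := g) (f' := fderiv ℝ g) (C := ‖fderiv ℝ g x₀‖ + 1)
      (fun z hz => ((hg.contDiffAt (hU.mem_nhds (h z hz).2)).differentiableAt
        (by simp)).hasFDerivAt.hasFDerivWithinAt) (fun z hz => (h z hz).1.le) hx hy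
  | succ k ih =>
    intro F _ _ g hg
    have hg' : ContDiffOn ℝ ∞ (fderiv ℝ g) U := hg.fderiv_of_isOpen hU (by simp)
    -- The induction hypothesis bounds the derivative, which vanishes at `x`, along the segment from
    -- `x` to `y`; the mean value inequality then gains one power of the distance. Passing to the
    -- derivative changes the target space, so the statement is for all `F`.
    obtain ⟨C, hC, ρ, hρ, h⟩ := ih (fderiv ℝ g) hg'
    obtain ⟨ρ', hρ', h'⟩ := Metric.isOpen_iff.1 hU x₀ hx₀
    refine ⟨C, hC, min ρ ρ', lt_min hρ hρ', fun x hx hz y hy => ?_⟩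
    have hxρ := Metric.ball_subset_ball (min_le_left ρ ρ') hx
    have hfx : fderiv ℝ g x = 0 := by
      have := hz 1 le_rfl (by omega)
      rw [← norm_eq_zero, ← norm_iteratedFDeriv_one (𝕜 := ℝ), this, norm_zero]
    have hzero : ∀ j, 1 ≤ j → j ≤ k → iteratedFDeriv ℝ j (fderiv ℝ g) x = 0 := by
      intro j hj hjk
      rw [← norm_eq_zero, norm_iteratedFDeriv_fderiv, hz (j + 1) (by omega) (by omega), norm_zero]
    have hseg : segment ℝ x y ⊆ Metric.ball x₀ (min ρ ρ') :=
      (convex_ball x₀ _).segment_subset hx hy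
    have key := (convex_segment x y).norm_image_sub_le_of_norm_hasFDerivWithin_le (𝕜 := ℝ)
      (f := g) (f' := fderiv ℝ g) (C := C * ‖y - x‖ ^ (k + 1))
      (fun z hz => ((hg.contDiffAt (hU.mem_nhds (h'
        (Metric.ball_subset_ball (min_le_right ρ ρ') (hseg hz))))).differentiableAt
        (by simp)).hasFDerivAt.hasFDerivWithinAt) (fun z hz => ?_) (left_mem_segment ℝ x y)
        (right_mem_segment ℝ x y)
    · calc ‖g y - g x‖ ≤ C * ‖y - x‖ ^ (k + 1) * ‖y - x‖ := key
        _ = _ := by ring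
    · have h1 := h x hxρ hzero z (Metric.ball_subset_ball (min_le_left ρ ρ') (hseg hz))
      rw [hfx, sub_zero] at h1
      refine h1.trans ?_
      gcongr
      have := norm_sub_le_of_mem_segment hz
      simpa [norm_sub_rev] using this

/-- Second countability: countably many of the given neighbourhoods cover `A`. -/
theorem volume_image_eq_zero_of_locally {E : Type*} [TopologicalSpace E]
    [SecondCountableTopology E] (f : E → ℝ) (A : Set E)
    (h : ∀ x ∈ A, ∃ N ∈ 𝓝 x, volume (f '' (A ∩ N)) = 0) : volume (f '' A) = 0 := by
  choose! N hN hv using h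
  obtain ⟨t, htA, htc, hcov⟩ := TopologicalSpace.countable_cover_nhdsWithin
    (f := N) (s := A) (fun x hx => mem_nhdsWithin_of_mem_nhds (hN x hx))
  refine measure_mono_null (t := ⋃ x ∈ t, f '' (A ∩ N x)) ?_
    ((measure_biUnion_null_iff htc).2 fun x hx => hv x (htA hx))
  rintro _ ⟨x, hx, rfl⟩
  obtain ⟨y, hy, hxy⟩ := mem_iUnion₂.1 (hcov hx)
  exact mem_iUnion₂.2 ⟨y, hy, x, ⟨hx, hxy⟩, rfl⟩

/-- By Taylor's estimate `f` is locally Hölder of exponent `dim E + 1` on this set. Thus the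
one-dimensional Hausdorff measure of the image, which is Lebesgue measure, is bounded by a multiple
of the Hausdorff measure of dimension `dim E + 1` of a subset of `E`, and that is zero. -/
theorem volume_image_eq_zero_of_flat {E : Type} [NormedAddCommGroup E] [NormedSpace ℝ E]
    [FiniteDimensional ℝ E] {U : Set E} (hU : IsOpen U) {f : E → ℝ} (hf : ContDiffOn ℝ ∞ f U) :
    volume (f '' {x ∈ U | ∀ j, 1 ≤ j → j ≤ Module.finrank ℝ E → iteratedFDeriv ℝ j f x = 0}) =
      0 := by
  have : ProperSpace E := FiniteDimensional.proper ℝ E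
  refine volume_image_eq_zero_of_locally f _ fun x₀ hx₀ => ?_
  obtain ⟨C, hC, ρ, hρ, h⟩ := exists_norm_sub_le_pow hU hx₀.1 (Module.finrank ℝ E) f hf
  refine ⟨_, Metric.ball_mem_nhds x₀ hρ, ?_⟩
  borelize E
  have hH : HolderOnWith C.toNNReal ((Module.finrank ℝ E + 1 : ℕ) : NNReal) f
      ({x ∈ U | ∀ j, 1 ≤ j → j ≤ Module.finrank ℝ E → iteratedFDeriv ℝ j f x = 0} ∩
        Metric.ball x₀ ρ) := by
    intro x hx y hy
    have := h x hx.2 hx.1.2 y hy.2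
    rw [edist_comm (f x), edist_comm x, edist_dist, edist_dist, dist_eq_norm, dist_eq_norm,
      NNReal.coe_natCast, ENNReal.rpow_natCast, ← ENNReal.ofReal_pow (norm_nonneg _),
      ← ENNReal.ofReal, ← ENNReal.ofReal_mul hC]
    exact ENNReal.ofReal_le_ofReal this
  have hm := hH.hausdorffMeasure_image_le (by positivity) zero_le_one
  rw [hausdorffMeasure_real, mul_one] at hm
  refine le_antisymm (hm.trans ?_) zero_le
  rw [hausdorffMeasure_of_dimH_lt, mul_zero]
  calc dimH _ ≤ dimH (univ : Set E) := dimH_mono (subset_univ _)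
    _ = (Module.finrank ℝ E : ENNReal) := Real.dimH_univ_eq_finrank E
    _ < _ := by
      rw [ENNReal.coe_natCast]
      exact_mod_cast Nat.lt_succ_self _

/-- **Sard's theorem** for real-valued functions: the set of critical values of a smooth function
on an open subset of a finite-dimensional space has measure zero. -/
theorem volume_criticalValues_eq_zero (m : ℕ) :
    ∀ {E : Type} [NormedAddCommGroup E] [NormedSpace ℝ E] [FiniteDimensional ℝ E],
      Module.finrank ℝ E = m → ∀ {U : Set E}, IsOpen U → ∀ {f : E → ℝ}, ContDiffOn ℝ ∞ f U →
        volume (f '' {x ∈ U | fderiv ℝ f x = 0}) = 0 := by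
  induction m with
  | zero =>
    intro E _ _ _ hE U _ f _
    have : Subsingleton E := Module.finrank_zero_iff.1 hE
    exact (subsingleton_of_subsingleton.image f).measure_zero _
  | succ m ih =>
    intro E _ _ _ hE U hU f hf
    have : ProperSpace E := FiniteDimensional.proper ℝ E
    -- The critical points that are not flat are sorted by the order at which the derivatives first
    -- fail to vanish. Near a point of `D k` a component `h` of the `k`-th derivative has nonzero
    -- differential, so `D k` lies locally in the smooth hypersurface `h = 0`.
    let D : ℕ → Set E := fun k => {x ∈ U | fderiv ℝ f x = 0 ∧ iteratedFDeriv ℝ k f x = 0 ∧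
      iteratedFDeriv ℝ (k + 1) f x ≠ 0}
    have hD : ∀ k, volume (f '' D k) = 0 := by
      intro k
      refine volume_image_eq_zero_of_locally f _ fun x hx => ?_
      obtain ⟨hxU, -, hxk, hxk'⟩ := hx
      obtain ⟨w, hw⟩ : ∃ w, iteratedFDeriv ℝ (k + 1) f x w ≠ 0 := by
        by_contra! hcon
        exact hxk' (ContinuousMultilinearMap.ext fun w => hcon w)
      let h : E → ℝ := fun z => iteratedFDeriv ℝ k f z (Fin.tail w)
      have hkf : ContDiffOn ℝ ∞ (iteratedFDeriv ℝ k f) U := fun z hz =>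
        ((hf.contDiffAt (hU.mem_nhds hz)).iteratedFDeriv_right (m := ∞)
          (by exact_mod_cast le_top)).contDiffWithinAt
      have hh : ContDiffOn ℝ ∞ h U :=
        (ContinuousMultilinearMap.apply ℝ (fun _ : Fin k => E) ℝ (Fin.tail w)).contDiff.comp_contDiffOn
          hkf
      have hkx : DifferentiableAt ℝ (iteratedFDeriv ℝ k f) x :=
        (hkf.contDiffAt (hU.mem_nhds hxU)).differentiableAt (by simp)
      have hhx : HasFDerivAt h (fderiv ℝ h x) x :=
        ((hh.contDiffAt (hU.mem_nhds hxU)).differentiableAt (by simp)).hasFDerivAt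
      have hℓ : fderiv ℝ h x (w 0) ≠ 0 := by
        have : HasFDerivAt h ((ContinuousMultilinearMap.apply ℝ (fun _ : Fin k => E) ℝ
            (Fin.tail w)).comp (fderiv ℝ (iteratedFDeriv ℝ k f) x)) x :=
          (ContinuousMultilinearMap.apply ℝ (fun _ : Fin k => E) ℝ
            (Fin.tail w)).hasFDerivAt.comp x hkx.hasFDerivAt
        rw [this.fderiv]
        rwa [iteratedFDeriv_succ_apply_left] at hw
      set ℓ := fderiv ℝ h x with hℓdef
      let u : E := (ℓ (w 0))⁻¹ • w 0
      have hu : ℓ u = 1 := by simp [u, hℓ]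
      -- Since `ℓ u = 1`, this map satisfies `ℓ ∘ Ψ = h`, so it straightens the level set `h = 0` to
      -- the hyperplane `ker ℓ`; its derivative at `x` is the identity.
      let Ψ : E → E := fun z => z + (h z - ℓ z) • u
      have hΨ : ContDiffOn ℝ ∞ Ψ U :=
        contDiffOn_id.add ((hh.sub ℓ.contDiff.contDiffOn).smul contDiffOn_const)
      have hΨx : fderiv ℝ Ψ x = (ContinuousLinearEquiv.refl ℝ E : E →L[ℝ] E) := by
        have h1 : HasFDerivAt Ψ (ContinuousLinearMap.id ℝ E + (ℓ - ℓ).smulRight u) x :=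
          (hasFDerivAt_id x).add ((hhx.sub ℓ.hasFDerivAt).smul_const u)
        rw [h1.fderiv]
        ext z
        simp
      obtain ⟨Φ, hxΦ, hΦU, hΦ, hΦs⟩ := exists_openPartialHomeomorph_contDiffOn hU hΨ hxU _ hΨx
      have hℓΦ : ∀ z, ℓ (Φ z) = h z := by
        intro z
        simp [hΦ, Ψ, hu]
      -- In the straightened coordinates the points of `D k` lie in `ker ℓ`, of dimension `m`, and
      -- they remain critical for the restriction of `f`; the induction hypothesis applies there.
      let K := LinearMap.ker (ℓ : E →ₗ[ℝ] ℝ)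
      let i : K →L[ℝ] E := K.subtypeL
      have hK : Module.finrank ℝ K = m := by
        have hr : LinearMap.range (ℓ : E →ₗ[ℝ] ℝ) = ⊤ := by
          rw [LinearMap.range_eq_top]
          intro a
          exact ⟨a • u, by simp [hu]⟩
        have := LinearMap.finrank_range_add_finrank_ker (ℓ : E →ₗ[ℝ] ℝ)
        rw [hr, finrank_top, Module.finrank_self] at this
        change Module.finrank ℝ (LinearMap.ker (ℓ : E →ₗ[ℝ] ℝ)) = m
        omega
      let W : Set K := i ⁻¹' Φ.target
      have hW : IsOpen W := Φ.open_target.preimage i.continuous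
      have hg : ContDiffOn ℝ ∞ (fun y => f (Φ.symm (i y))) W :=
        hf.comp (hΦs.comp i.contDiff.contDiffOn fun y hy => hy)
          fun y hy => hΦU (Φ.map_target hy)
      refine ⟨Φ.source, Φ.open_source.mem_nhds hxΦ, measure_mono_null ?_ (ih hK hW hg)⟩
      rintro _ ⟨z, ⟨⟨hzU, hz1, hz2, -⟩, hzΦ⟩, rfl⟩
      have hzK : Φ z ∈ K := by
        rw [LinearMap.mem_ker]
        change ℓ (Φ z) = 0
        rw [hℓΦ]
        simp [h, hz2]
      refine ⟨⟨Φ z, hzK⟩, ⟨Φ.map_source hzΦ, ?_⟩, by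
        change f (Φ.symm (Φ z)) = f z
        rw [Φ.left_inv hzΦ]⟩
      have h1 : HasFDerivAt (fun y : K => Φ.symm (i y))
          (fderiv ℝ (fun y : K => Φ.symm (i y)) ⟨Φ z, hzK⟩) ⟨Φ z, hzK⟩ := by
        refine DifferentiableAt.hasFDerivAt ?_
        refine DifferentiableAt.comp (g := Φ.symm) (f := i) (⟨Φ z, hzK⟩ : K) ?_ i.differentiableAt
        exact (hΦs.contDiffAt (Φ.open_target.mem_nhds (Φ.map_source hzΦ))).differentiableAt (by simp)
      have h2 : HasFDerivAt f (0 : E →L[ℝ] ℝ) (Φ.symm (i ⟨Φ z, hzK⟩)) := by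
        have : Φ.symm (i ⟨Φ z, hzK⟩) = z := Φ.left_inv hzΦ
        rw [this, ← hz1]
        exact ((hf.contDiffAt (hU.mem_nhds hzU)).differentiableAt (by simp)).hasFDerivAt
      have h3 := h2.comp (⟨Φ z, hzK⟩ : K) h1
      rw [ContinuousLinearMap.zero_comp] at h3
      exact h3.fderiv
    have hcov : f '' {x ∈ U | fderiv ℝ f x = 0} ⊆ (⋃ k, f '' D k) ∪
        f '' {x ∈ U | ∀ j, 1 ≤ j → j ≤ Module.finrank ℝ E → iteratedFDeriv ℝ j f x = 0} := by
      rintro _ ⟨x, ⟨hxU, hx⟩, rfl⟩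
      by_cases hflat : ∀ j, 1 ≤ j → j ≤ Module.finrank ℝ E → iteratedFDeriv ℝ j f x = 0
      · exact Or.inr ⟨x, ⟨hxU, hflat⟩, rfl⟩
      · left
        -- The smallest such `k` is positive because the first derivative vanishes, so minimality
        -- says that the derivative of order `k` itself is zero.
        have hex : ∃ k, iteratedFDeriv ℝ (k + 1) f x ≠ 0 := by
          push Not at hflat
          obtain ⟨j, hj, -, hne⟩ := hflat
          exact ⟨j - 1, by rwa [Nat.sub_add_cancel hj]⟩
        classical
        have hk := Nat.find_spec hex
        have hmin : ∀ l < Nat.find hex, iteratedFDeriv ℝ (l + 1) f x = 0 := fun l hl => by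
          simpa using Nat.find_min hex hl
        have hpos : Nat.find hex ≠ 0 := by
          intro h0
          rw [h0] at hk
          apply hk
          rw [← norm_eq_zero, zero_add, norm_iteratedFDeriv_one, hx, norm_zero]
        refine mem_iUnion.2 ⟨Nat.find hex, x, ⟨hxU, hx, ?_, hk⟩, rfl⟩
        have := hmin (Nat.find hex - 1) (by omega)
        rwa [Nat.sub_add_cancel (Nat.one_le_iff_ne_zero.2 hpos)] at this
    exact measure_mono_null hcov (measure_union_null (measure_iUnion_null hD)
      (volume_image_eq_zero_of_flat hU hf))

end Sard

end SymplecticClosing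

namespace SymplecticClosing

/-! ### Smooth dependence of solutions of differential equations on initial values -/

section Flow

/-- Pointwise application of a continuous family of operators to a continuous function. -/
noncomputable def pointwiseApply (K V F : Type*) [TopologicalSpace K] [CompactSpace K]
    [NormedAddCommGroup V] [NormedSpace ℝ V] [NormedAddCommGroup F] [NormedSpace ℝ F] :
    C(K, V →L[ℝ] F) →L[ℝ] C(K, V) →L[ℝ] C(K, F) :=
  LinearMap.mkContinuous₂
    (LinearMap.mk₂ ℝ (fun (A : C(K, V →L[ℝ] F)) (h : C(K, V)) =>
      (⟨fun t => A t (h t), A.continuous.clm_apply h.continuous⟩ : C(K, F)))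
      (fun _ _ _ => by ext; simp) (fun _ _ _ => by ext; simp)
      (fun _ _ _ => by ext; simp) (fun _ _ _ => by ext; simp)) 1 (fun A h => by
        rw [ContinuousMap.norm_le _ (by positivity)]
        intro t
        rw [one_mul]
        exact (A t).le_of_opNorm_le_of_le (A.norm_coe_le_norm t) (h.norm_coe_le_norm t))

@[simp]
theorem pointwiseApply_apply {K V F : Type*} [TopologicalSpace K] [CompactSpace K]
    [NormedAddCommGroup V] [NormedSpace ℝ V] [NormedAddCommGroup F] [NormedSpace ℝ F]
    (A : C(K, V →L[ℝ] F)) (h : C(K, V)) (t : K) : pointwiseApply K V F A h t = A t (h t) := rfl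

/-- The remainder is estimated at each `t` by the mean value inequality on the segment from `γ t` to
`γ t + k t`. The estimate is uniform in `t` because `γ ↦ g' ∘ γ` is continuous for the supremum
norm. -/
theorem hasFDerivAt_postcomp {K V F : Type*} [TopologicalSpace K] [CompactSpace K]
    [NormedAddCommGroup V] [NormedSpace ℝ V] [NormedAddCommGroup F] [NormedSpace ℝ F]
    (g : C(V, F)) (g' : C(V, V →L[ℝ] F)) (h : ∀ x, HasFDerivAt g (g' x) x) (γ : C(K, V)) :
    HasFDerivAt (fun γ : C(K, V) => g.comp γ) (pointwiseApply K V F (g'.comp γ)) γ := by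
  rw [hasFDerivAt_iff_isLittleO_nhds_zero, Asymptotics.isLittleO_iff]
  intro ε hε
  have hc : Continuous fun γ : C(K, V) => g'.comp γ := ContinuousMap.continuous_postcomp g'
  obtain ⟨δ, hδ, hd⟩ :=
    (Metric.continuous_iff (f := fun γ : C(K, V) => g'.comp γ)).1 hc γ ε hε
  filter_upwards [Metric.ball_mem_nhds (0 : C(K, V)) hδ] with k hk
  rw [mem_ball_zero_iff] at hk
  rw [ContinuousMap.norm_le _ (by positivity)]
  intro t
  have key := (convex_segment (γ t) (γ t + k t)).norm_image_sub_le_of_norm_hasFDerivWithin_le'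
    (𝕜 := ℝ) (f := g) (f' := g') (φ := g' (γ t)) (C := ε)
    (fun z _ => (h z).hasFDerivWithinAt) (fun z hz => ?_) (left_mem_segment ℝ _ _)
    (right_mem_segment ℝ _ _)
  · simp only [add_sub_cancel_left] at key
    refine key.trans ?_
    gcongr
    exact k.norm_coe_le_norm t
  · rw [segment_eq_image'] at hz
    obtain ⟨s, hs, rfl⟩ := hz
    have h1 : dist (γ + s • k) γ < δ := by
      rw [dist_eq_norm, add_sub_cancel_left, norm_smul, Real.norm_of_nonneg hs.1]
      exact (mul_le_of_le_one_left (norm_nonneg _) hs.2).trans_lt hk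
    have h2 := (ContinuousMap.dist_lt_iff hε).1 (hd _ h1) t
    rw [dist_eq_norm] at h2
    simpa using h2.le

/-- The derivative is again postcomposition, with `fderiv ℝ g`, followed by a bounded linear map. So
the order of differentiability goes up by induction, over all target spaces. -/
theorem contDiff_postcomp_nat {K V : Type} [TopologicalSpace K] [CompactSpace K]
    [NormedAddCommGroup V] [NormedSpace ℝ V] (k : ℕ) :
    ∀ {F : Type} [NormedAddCommGroup F] [NormedSpace ℝ F] (g : C(V, F)), ContDiff ℝ ∞ g →
      ContDiff ℝ k fun γ : C(K, V) => g.comp γ := by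
  induction k with
  | zero =>
    intro F _ _ g _
    rw [Nat.cast_zero, contDiff_zero]
    exact ContinuousMap.continuous_postcomp g
  | succ k ih =>
    intro F _ _ g hg
    have hg' := (contDiff_infty_iff_fderiv.1 hg).2
    let g' : C(V, V →L[ℝ] F) := ⟨fderiv ℝ g, hg'.continuous⟩
    rw [Nat.cast_add, Nat.cast_one, contDiff_succ_iff_hasFDerivAt]
    have h1 : ContDiff ℝ k (pointwiseApply K V F) := by
      apply ContinuousLinearMap.contDiff
    exact ⟨fun γ => pointwiseApply K V F (g'.comp γ), h1.comp (ih g' hg'), fun γ =>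
        hasFDerivAt_postcomp g g' (fun x => (hg.differentiable (by simp) x).hasFDerivAt) γ⟩

/-- Composition with a smooth map is a smooth operation on spaces of continuous functions. -/
theorem contDiff_postcomp {K V F : Type} [TopologicalSpace K] [CompactSpace K]
    [NormedAddCommGroup V] [NormedSpace ℝ V] [NormedAddCommGroup F] [NormedSpace ℝ F]
    (g : C(V, F)) (hg : ContDiff ℝ ∞ g) : ContDiff ℝ ∞ fun γ : C(K, V) => g.comp γ :=
  contDiff_infty.2 fun k => contDiff_postcomp_nat k g hg

/-- The primitive of a continuous function on the unit interval, as a linear map. -/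
noncomputable def volterraLinear (V : Type*) [NormedAddCommGroup V] [NormedSpace ℝ V] :
    C(unitInterval, V) →ₗ[ℝ] C(unitInterval, V) :=
  have hc (γ : C(unitInterval, V)) : Continuous fun s => γ (projIcc 0 1 zero_le_one s) :=
    γ.continuous.comp continuous_projIcc
  { toFun := fun γ => ⟨fun τ => ∫ s in (0 : ℝ)..τ, γ (projIcc 0 1 zero_le_one s),
      (intervalIntegral.continuous_primitive (fun a b => (hc γ).intervalIntegrable a b) 0).comp
        continuous_subtype_val⟩
    map_add' := fun γ γ' => by
      ext τ
      exact intervalIntegral.integral_add ((hc γ).intervalIntegrable _ _)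
        ((hc γ').intervalIntegrable _ _)
    map_smul' := fun c γ => by
      ext τ
      exact intervalIntegral.integral_smul c _ }

theorem norm_volterraLinear_le {V : Type*} [NormedAddCommGroup V] [NormedSpace ℝ V]
    (γ : C(unitInterval, V)) : ‖volterraLinear V γ‖ ≤ 1 * ‖γ‖ := by
  rw [ContinuousMap.norm_le _ (by positivity)]
  intro τ
  have := intervalIntegral.norm_integral_le_of_norm_le_const (a := (0 : ℝ)) (b := τ)
    (f := fun s => γ (projIcc 0 1 zero_le_one s)) (C := ‖γ‖)
    (fun s _ => γ.norm_coe_le_norm _)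
  refine this.trans ?_
  rw [sub_zero, abs_of_nonneg τ.2.1, one_mul]
  exact mul_le_of_le_one_right (norm_nonneg _) τ.2.2

/-- The primitive of a continuous function on the unit interval. -/
noncomputable def volterra (V : Type*) [NormedAddCommGroup V] [NormedSpace ℝ V] :
    C(unitInterval, V) →L[ℝ] C(unitInterval, V) :=
  (volterraLinear V).mkContinuous 1 norm_volterraLinear_le

theorem norm_volterra_le (V : Type*) [NormedAddCommGroup V] [NormedSpace ℝ V] :
    ‖volterra V‖ ≤ 1 :=
  LinearMap.mkContinuous_norm_le _ zero_le_one _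

variable {V : Type} [NormedAddCommGroup V] [NormedSpace ℝ V] [CompleteSpace V]

/-- The integral equation `γ = x + t ∫ v(γ)`, rewritten as the vanishing of a function. -/
noncomputable def integralEquation (v : C(V, V)) (p : (ℝ × V) × C(unitInterval, V)) :
    C(unitInterval, V) :=
  p.2 - ContinuousLinearMap.const ℝ unitInterval p.1.2 - p.1.1 • volterra V (v.comp p.2)

theorem contDiff_integralEquation {V : Type} [NormedAddCommGroup V] [NormedSpace ℝ V]
    (v : C(V, V)) (hv : ContDiff ℝ ∞ v) :
    ContDiff ℝ ∞ (integralEquation v) := by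
  unfold integralEquation
  have h1 : ContDiff ℝ ∞ fun p : (ℝ × V) × C(unitInterval, V) => v.comp p.2 :=
    (contDiff_postcomp v hv).comp contDiff_snd
  have h2 : ContDiff ℝ ∞ fun p : (ℝ × V) × C(unitInterval, V) => volterra V (v.comp p.2) :=
    (volterra V).contDiff.comp h1
  have h3 : ContDiff ℝ ∞ fun p : (ℝ × V) × C(unitInterval, V) =>
      ContinuousLinearMap.const ℝ unitInterval p.1.2 := by
    have h4 : ContDiff ℝ ∞ (ContinuousLinearMap.const ℝ unitInterval : V →L[ℝ] _) :=
      ContinuousLinearMap.contDiff _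
    exact h4.comp contDiff_fst.snd
  exact (contDiff_snd.sub h3).sub (contDiff_fst.fst.smul h2)

theorem lipschitzWith_postcomp {V : Type*} [NormedAddCommGroup V] (v : C(V, V)) {L : NNReal} (hL : LipschitzWith L v) :
    LipschitzWith L fun γ : C(unitInterval, V) => v.comp γ := by
  refine LipschitzWith.of_dist_le_mul fun γ γ' => ?_
  rw [ContinuousMap.dist_le (by positivity)]
  intro t
  exact (hL.dist_le_mul _ _).trans (by gcongr; exact ContinuousMap.dist_apply_le_dist t)

/-- The integral operator is a contraction with constant `|t| L`. -/
theorem existsUnique_integralEquation (v : C(V, V)) {L : NNReal} (hL : LipschitzWith L v)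
    {t : ℝ} (ht : |t| * L < 1) (x : V) :
    ∃! γ, integralEquation v ((t, x), γ) = 0 := by
  let T : C(unitInterval, V) → C(unitInterval, V) := fun γ =>
    ContinuousLinearMap.const ℝ unitInterval x + t • volterra V (v.comp γ)
  have hT : ContractingWith (‖t‖₊ * L) T := by
    refine ⟨by rw [← NNReal.coe_lt_coe]; simpa using ht, LipschitzWith.of_dist_le_mul fun γ γ' => ?_⟩
    simp only [T, dist_add_left]
    rw [dist_eq_norm, ← smul_sub, ← map_sub, norm_smul, NNReal.coe_mul, mul_assoc, coe_nnnorm]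
    gcongr
    refine ((volterra V).le_of_opNorm_le (norm_volterra_le V) _).trans ?_
    rw [one_mul, ← dist_eq_norm]
    exact (lipschitzWith_postcomp v hL).dist_le_mul γ γ'
  have hiff : ∀ γ, integralEquation v ((t, x), γ) = 0 ↔ Function.IsFixedPt T γ := by
    intro γ
    rw [Function.IsFixedPt, eq_comm (b := γ), integralEquation, sub_sub, sub_eq_zero]
  refine ⟨hT.fixedPoint T, (hiff _).2 hT.fixedPoint_isFixedPt, fun γ hγ => ?_⟩
  exact hT.fixedPoint_unique ((hiff γ).1 hγ)

/-- The partial derivative in the curve is the identity minus an operator of norm at most `|t| L <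
1`, invertible by the Neumann series. This is the hypothesis of the implicit function theorem. -/
theorem isInvertible_fderiv_integralEquation (v : C(V, V)) (hv : ContDiff ℝ ∞ v) {L : NNReal}
    (hL : LipschitzWith L v) {t : ℝ} (ht : |t| * L < 1) (x : V) (γ : C(unitInterval, V)) :
    (fderiv ℝ (integralEquation v) ((t, x), γ) ∘L
      .inr ℝ (ℝ × V) C(unitInterval, V)).IsInvertible := by
  let N : C(unitInterval, V) → C(unitInterval, V) := fun γ => v.comp γ
  have hN : HasFDerivAt N (fderiv ℝ N γ) γ :=
    ((contDiff_postcomp v hv).differentiable (by simp) γ).hasFDerivAt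
  let A : C(unitInterval, V) →L[ℝ] C(unitInterval, V) := t • (volterra V).comp (fderiv ℝ N γ)
  have hA : ‖A‖ < 1 := by
    refine (ContinuousLinearMap.opNorm_le_bound _ (by positivity) fun h => ?_).trans_lt ht
    change ‖t • volterra V (fderiv ℝ N γ h)‖ ≤ |t| * L * ‖h‖
    rw [norm_smul, Real.norm_eq_abs, mul_assoc]
    gcongr
    refine ((volterra V).le_of_opNorm_le (norm_volterra_le V) _).trans ?_
    rw [one_mul]
    exact (fderiv ℝ N γ).le_of_opNorm_le
      (norm_fderiv_le_of_lipschitz ℝ (lipschitzWith_postcomp v hL)) h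
  have h1 : HasFDerivAt (fun γ => integralEquation v ((t, x), γ))
      (ContinuousLinearMap.id ℝ _ - A) γ := by
    have h3 := ((volterra V).hasFDerivAt.comp γ hN).const_smul t
    exact ((hasFDerivAt_id γ).sub_const (ContinuousLinearMap.const ℝ unitInterval x)).sub h3
  have h2 : HasFDerivAt (fun γ => integralEquation v ((t, x), γ))
      (fderiv ℝ (integralEquation v) ((t, x), γ) ∘L .inr ℝ (ℝ × V) C(unitInterval, V)) γ :=
    (((contDiff_integralEquation v hv).differentiable (by simp) ((t, x), γ)).hasFDerivAt).comp γ
      (hasFDerivAt_prodMk_right (t, x) γ)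
  rw [h2.unique h1]
  exact ⟨ContinuousLinearEquiv.unitsEquiv ℝ _ (Units.oneSub A hA), rfl⟩

/-- The flow of a smooth globally Lipschitz vector field exists for a uniform time, and it is
smooth. -/
theorem exists_contDiffOn_flow {v : V → V} (hv : ContDiff ℝ ∞ v) {L : NNReal}
    (hL : LipschitzWith L v) :
    ∃ δ > 0, ∃ Ψ : ℝ → V → V,
      ContDiffOn ℝ ∞ (fun p : ℝ × V => Ψ p.1 p.2) (Ioo (-δ) δ ×ˢ univ) ∧ (∀ x, Ψ 0 x = x) ∧
        ∀ t ∈ Ioo (-δ) δ, ∀ x, HasDerivAt (fun s => Ψ s x) (v (Ψ t x)) t := by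
  let w : C(V, V) := ⟨v, hv.continuous⟩
  have hw : ContDiff ℝ ∞ w := hv
  have hwL : LipschitzWith L w := hL
  -- This choice gives `|t| L < 1` for `|t| < δ`. The curve sought is `τ ↦ x(tτ)` on the fixed
  -- interval `[0, 1]`, so time becomes a parameter of the equation and smoothness in time comes
  -- along with smoothness in the initial value.
  let δ : ℝ := ((L : ℝ) + 1)⁻¹
  have hδ : 0 < δ := by positivity
  have hsmall : ∀ t ∈ Ioo (-δ) δ, |t| * L < 1 := by
    intro t ht
    have h1 : |t| < δ := abs_lt.2 ht
    have h2 : δ * ((L : ℝ) + 1) = 1 := inv_mul_cancel₀ (by positivity)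
    have h3 : (0 : ℝ) ≤ L := L.2
    nlinarith [abs_nonneg t]
  have hex : ∀ p : ℝ × V, ∃ γ, p.1 ∈ Ioo (-δ) δ → integralEquation w (p, γ) = 0 := by
    rintro ⟨t, x⟩
    by_cases ht : t ∈ Ioo (-δ) δ
    · obtain ⟨γ, hγ, -⟩ := existsUnique_integralEquation w hwL (hsmall t ht) x
      exact ⟨γ, fun _ => hγ⟩
    · exact ⟨0, fun h => (ht h).elim⟩
  choose sol hsol using hex
  have huniq : ∀ p : ℝ × V, p.1 ∈ Ioo (-δ) δ → ∀ γ, integralEquation w (p, γ) = 0 → γ = sol p :=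
    fun p hp γ hγ => (existsUnique_integralEquation w hwL (hsmall p.1 hp) p.2).unique hγ (hsol p hp)
  -- The implicit function theorem gives a smooth local solution, and uniqueness identifies it with
  -- `sol`.
  have hsmooth : ∀ p : ℝ × V, p.1 ∈ Ioo (-δ) δ → ContDiffAt ℝ ∞ sol p := by
    intro p hp
    have hc : ContDiffAt ℝ ∞ (integralEquation w) (p, sol p) :=
      (contDiff_integralEquation w hw).contDiffAt
    have hi := isInvertible_fderiv_integralEquation w hw hwL (hsmall p.1 hp) p.2 (sol p)
    have hn : (∞ : WithTop ℕ∞) ≠ 0 := by simp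
    refine (hc.contDiffAt_implicitFunction hn hi).congr_of_eventuallyEq ?_
    have h1 := hc.eventually_apply_implicitFunction hn hi
    have h2 : ∀ᶠ q : ℝ × V in 𝓝 p, q.1 ∈ Ioo (-δ) δ :=
      continuousAt_fst.eventually (isOpen_Ioo.mem_nhds hp)
    filter_upwards [h1, h2] with q hq1 hq2
    exact (huniq q hq2 _ (hq1.trans (hsol p hp))).symm
  have hval : ∀ p : ℝ × V, p.1 ∈ Ioo (-δ) δ → ∀ τ : unitInterval,
      sol p τ = p.2 + p.1 • ∫ s in (0 : ℝ)..τ, v (sol p (projIcc 0 1 zero_le_one s)) := by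
    intro p hp τ
    have h1 := hsol p hp
    rw [integralEquation, sub_sub, sub_eq_zero] at h1
    have h2 := congrArg (fun f : C(unitInterval, V) => f τ) h1
    exact h2
  -- The solution for time `c t` is the solution for time `t`, slowed down by the factor `c`. Hence
  -- the endpoints of the solutions for varying time trace one solution curve.
  have hscale : ∀ t ∈ Ioo (-δ) δ, ∀ x, ∀ c : unitInterval, sol (c * t, x) 1 = sol (t, x) c := by
    intro t ht x c
    have hct : (c : ℝ) * t ∈ Ioo (-δ) δ := by
      rw [mem_Ioo, ← abs_lt, abs_mul, abs_of_nonneg c.2.1]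
      exact (mul_le_of_le_one_left (abs_nonneg t) c.2.2).trans_lt (abs_lt.2 ht)
    let γ : C(unitInterval, V) := (sol (t, x)).comp ⟨fun τ => c * τ, by fun_prop⟩
    have hγ : integralEquation w ((c * t, x), γ) = 0 := by
      rw [integralEquation, sub_sub, sub_eq_zero]
      ext τ
      have h1 := hval (t, x) ht (c * τ)
      change sol (t, x) (c * τ) = x + ((c : ℝ) * t) •
        ∫ s in (0 : ℝ)..τ, v (sol (t, x) (c * projIcc 0 1 zero_le_one s))
      rw [h1, mul_comm (c : ℝ) t, mul_smul]
      simp only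
      congr 2
      have h2 := intervalIntegral.smul_integral_comp_mul_left (a := 0) (b := (τ : ℝ))
        (fun s => v (sol (t, x) (projIcc 0 1 zero_le_one s))) (c : ℝ)
      rw [mul_zero] at h2
      rw [show ((c * τ : unitInterval) : ℝ) = c * τ from rfl, ← h2]
      congr 1
      refine intervalIntegral.integral_congr fun s hs => ?_
      rw [uIcc_of_le τ.2.1] at hs
      have hs' : s ∈ Icc (0 : ℝ) 1 := ⟨hs.1, hs.2.trans τ.2.2⟩
      have hcs : (c : ℝ) * s ∈ Icc (0 : ℝ) 1 := unitInterval.mul_mem c.2 hs'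
      rw [projIcc_of_mem _ hs', projIcc_of_mem _ hcs]
      rfl
    have := huniq (c * t, x) hct γ hγ
    rw [← this]
    change sol (t, x) (c * 1) = _
    rw [mul_one]
  have hΨ : ∀ p : ℝ × V, p.1 ∈ Ioo (-δ) δ → ContDiffAt ℝ ∞ (fun p => sol p 1) p := by
    intro p hp
    have h1 : ContDiff ℝ ∞ (ContinuousMap.evalCLM ℝ (1 : unitInterval) : C(unitInterval, V) →L[ℝ] V) :=
      ContinuousLinearMap.contDiff _
    exact h1.contDiffAt.comp p (hsmooth p hp)
  refine ⟨δ, hδ, fun t x => sol (t, x) 1, fun p hp => (hΨ p hp.1).contDiffWithinAt, fun x => ?_,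
    fun t₀ ht₀ x => ?_⟩
  · have := hval (0, x) (by simpa using hδ) 1
    simpa using this
  · have hdiff : DifferentiableAt ℝ (fun s => sol (s, x) 1) t₀ :=
      ((hΨ (t₀, x) ht₀).differentiableAt (by simp)).comp t₀
        (f := fun s : ℝ => (s, x)) (by fun_prop)
    -- The time `t₀` is written as `c t` with `t ≠ 0` farther from the origin, so that the
    -- derivative at `t₀` can be read off from the curve for the fixed time `t` at the parameter `c`
    -- and the factor `t` cancelled. This covers `t₀ = 0`.
    obtain ⟨t, ht, ht0, c, hc1, hct⟩ : ∃ t ∈ Ioo (-δ) δ, t ≠ 0 ∧ ∃ c : unitInterval,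
        (c : ℝ) < 1 ∧ (c : ℝ) * t = t₀ := by
      rcases le_or_gt 0 t₀ with h0 | h0
      · obtain ⟨t, h1, h2⟩ := exists_between ht₀.2
        have ht : 0 < t := h0.trans_lt h1
        exact ⟨t, ⟨by linarith, h2⟩, ht.ne', ⟨t₀ / t, div_nonneg h0 ht.le,
          (div_le_one ht).2 h1.le⟩, (div_lt_one ht).2 h1, div_mul_cancel₀ _ ht.ne'⟩
      · obtain ⟨t, h1, h2⟩ := exists_between ht₀.1
        have ht : t < 0 := h2.trans h0
        exact ⟨t, ⟨h1, by linarith⟩, ht.ne, ⟨t₀ / t, div_nonneg_of_nonpos h0.le ht.le,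
          (div_le_one_of_neg ht).2 h2.le⟩, (div_lt_one_of_neg ht).2 h2,
          div_mul_cancel₀ _ ht.ne⟩
    let e : ℝ → V := fun s => v (sol (t, x) (projIcc 0 1 zero_le_one s))
    have he : Continuous e :=
      hv.continuous.comp ((sol (t, x)).continuous.comp continuous_projIcc)
    have h1 : HasDerivAt (fun s : ℝ => x + t • ∫ u in (0 : ℝ)..s, e u) (t • e c) (c : ℝ) :=
      ((intervalIntegral.integral_hasDerivAt_right (he.intervalIntegrable _ _)
        (he.stronglyMeasurableAtFilter _ _) he.continuousAt).const_smul t).const_add x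
    have h2 : HasDerivAt (fun s : ℝ => sol (s * t, x) 1)
        (t • deriv (fun s => sol (s, x) 1) t₀) (c : ℝ) := by
      have h3 : HasDerivAt (fun s => sol (s, x) 1) (deriv (fun s => sol (s, x) 1) t₀)
          ((c : ℝ) * t) := by
        rw [hct]
        exact hdiff.hasDerivAt
      exact h3.scomp (c : ℝ) (hasDerivAt_mul_const t)
    have h4 : HasDerivWithinAt (fun s : ℝ => sol (s * t, x) 1) (t • e c) (Icc 0 1) (c : ℝ) := by
      refine h1.hasDerivWithinAt.congr (fun s hs => ?_) ?_
      · rw [hscale t ht x ⟨s, hs⟩, hval (t, x) ht]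
      · rw [hscale t ht x c, hval (t, x) ht]
    have h5 := (uniqueDiffOn_Icc zero_lt_one (c : ℝ) c.2).eq_deriv _ h2.hasDerivWithinAt h4
    have h6 : deriv (fun s => sol (s, x) 1) t₀ = e c := smul_right_injective V ht0 h5
    have h7 : e c = v (sol (t₀, x) 1) := by
      rw [← hct, hscale t ht x c]
      simp [e]
    rw [← h7, ← h6]
    exact hdiff.hasDerivAt

end Flow

end SymplecticClosing

namespace SymplecticClosing

/-! ### Compact manifolds are smooth neighbourhood retracts -/

section Retract

theorem exists_continuousLinearEquiv_of_injective {X : Type*} [NormedAddCommGroup X]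
    [NormedSpace ℝ X] [FiniteDimensional ℝ X] (A : X →L[ℝ] X) (hA : Function.Injective A) :
    ∃ e : X ≃L[ℝ] X, (e : X →L[ℝ] X) = A :=
  ⟨(LinearEquiv.ofInjectiveEndo (A : X →ₗ[ℝ] X) hA).toContinuousLinearEquiv, by
    ext x
    rfl⟩

/-- A presentation of a manifold as a smooth retract of an open subset of a vector space. -/
structure SmoothRetract (d : ℕ) (M : Type*) [TopologicalSpace M]
    [ChartedSpace (EuclideanSpace ℝ (Fin d)) M] (V : Type*) [NormedAddCommGroup V]
    [NormedSpace ℝ V] where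
  /-- The inclusion. -/
  incl : M → V
  /-- The retraction. -/
  retr : V → M
  /-- The domain of the retraction. -/
  dom : Set V
  isOpen_dom : IsOpen dom
  incl_mem : ∀ x, incl x ∈ dom
  retr_incl : ∀ x, retr (incl x) = x
  contMDiff_incl : ContMDiff (𝓡 d) 𝓘(ℝ, V) ∞ incl
  contMDiffOn_retr : ContMDiffOn 𝓘(ℝ, V) (𝓡 d) ∞ retr dom

variable {d : ℕ} {M : Type*} [TopologicalSpace M] [ChartedSpace (EuclideanSpace ℝ (Fin d)) M]
  [IsManifold (𝓡 d) ∞ M]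

/-- The nearest point map of an embedded compact manifold is smooth near the manifold. -/
theorem exists_contMDiffOn_nearestPoint {N : ℕ} {e : M → EuclideanSpace ℝ (Fin N)}
    (he : ContMDiff (𝓡 d) 𝓘(ℝ, EuclideanSpace ℝ (Fin N)) ∞ e)
    (hemb : Topology.IsClosedEmbedding e)
    {r : EuclideanSpace ℝ (Fin N) → M} (hr : ∀ y x, ‖y - e (r y)‖ ≤ ‖y - e x‖) (x₀ : M)
    (hinj : Function.Injective (mfderiv (𝓡 d) 𝓘(ℝ, EuclideanSpace ℝ (Fin N)) e x₀)) :
    ∃ O, IsOpen O ∧ e x₀ ∈ O ∧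
      ContMDiffOn 𝓘(ℝ, EuclideanSpace ℝ (Fin N)) (𝓡 d) ∞ r O := by
  let V := EuclideanSpace ℝ (Fin N)
  let E := EuclideanSpace ℝ (Fin d)
  let φ := extChartAt (𝓡 d) x₀
  have hφ : φ = extChartAt (𝓡 d) x₀ := rfl
  let T : Set E := φ.target
  have hT : IsOpen T := isOpen_extChartAt_target x₀
  let f : E → V := fun u => e (φ.symm u)
  have hf : ContDiffOn ℝ ∞ f T := by
    rw [← contMDiffOn_iff_contDiffOn]
    exact he.comp_contMDiffOn (contMDiffOn_extChartAt_symm x₀)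
  let u₀ : E := φ x₀
  have hx₀ : x₀ ∈ φ.source := mem_extChartAt_source x₀
  have hu₀ : u₀ ∈ T := φ.map_source hx₀
  have hfu₀ : f u₀ = e x₀ := by
    change e (φ.symm (φ x₀)) = _
    rw [φ.left_inv hx₀]
  have hfd : ∀ u ∈ T, HasFDerivAt f (fderiv ℝ f u) u := fun u hu =>
    ((hf.contDiffAt (hT.mem_nhds hu)).differentiableAt (by simp)).hasFDerivAt
  have hdf : Function.Injective (fderiv ℝ f u₀) := by
    rw [injective_iff_map_eq_zero]
    intro w hw
    have hinv : (mfderiv (𝓡 d) 𝓘(ℝ, E) φ x₀).IsInvertible := isInvertible_mfderiv_extChartAt hx₀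
    obtain ⟨A, hA⟩ := hinv
    have h1 : MDifferentiableAt 𝓘(ℝ, E) 𝓘(ℝ, V) f (φ x₀) :=
      (hfd u₀ hu₀).differentiableAt.mdifferentiableAt
    have h2 : MDifferentiableAt (𝓡 d) 𝓘(ℝ, E) φ x₀ := mdifferentiableAt_extChartAt (by
      rwa [hφ, extChartAt_source] at hx₀)
    have h3 : mfderiv (𝓡 d) 𝓘(ℝ, V) e x₀ =
        (mfderiv 𝓘(ℝ, E) 𝓘(ℝ, V) f (φ x₀)).comp (mfderiv (𝓡 d) 𝓘(ℝ, E) φ x₀) := by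
      rw [← mfderiv_comp x₀ h1 h2]
      refine Filter.EventuallyEq.mfderiv_eq ?_
      filter_upwards [(isOpen_extChartAt_source (I := 𝓡 d) x₀).mem_nhds hx₀] with z hz
      change e z = e (φ.symm (φ z))
      rw [φ.left_inv hz]
    rw [mfderiv_eq_fderiv] at h3
    obtain ⟨ξ, hξ⟩ : ∃ ξ, A ξ = w := A.surjective w
    have h4 : mfderiv (𝓡 d) 𝓘(ℝ, V) e x₀ ξ = 0 := by
      rw [h3, ← hA]
      exact (congrArg (fderiv ℝ f u₀) hξ).trans hw
    have h5 : ξ = 0 := hinj (h4.trans (map_zero _).symm)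
    rw [← hξ, h5]
    exact map_zero A
  let b : Fin d → E := fun i => EuclideanSpace.single i 1
  -- The zeros of `G` are the pairs for which `y - f u` is normal to the image of `f`, the
  -- first-order condition for a nearest point. The map `(y, u) ↦ (y, G (y, u))` will be inverted
  -- locally.
  let G : V × E → E := fun p => WithLp.toLp 2 fun i => inner ℝ (p.1 - f p.2) (fderiv ℝ f p.2 (b i))
  have hUo : IsOpen ((univ : Set V) ×ˢ T) := isOpen_univ.prod hT
  have hf2 : ContDiffOn ℝ ∞ (fun p : V × E => f p.2) (univ ×ˢ T) :=
    hf.comp contDiff_snd.contDiffOn fun p hp => hp.2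
  have hdf2 : ContDiffOn ℝ ∞ (fun p : V × E => fderiv ℝ f p.2) (univ ×ˢ T) :=
    (hf.fderiv_of_isOpen hT (m := ∞) (by simp)).comp contDiff_snd.contDiffOn fun p hp => hp.2
  have hG : ContDiffOn ℝ ∞ G (univ ×ˢ T) := by
    rw [contDiffOn_euclidean]
    intro i
    exact (contDiff_fst.contDiffOn.sub hf2).inner ℝ (hdf2.clm_apply contDiffOn_const)
  let Φ : V × E → V × E := fun p => (p.1, G p)
  have hΦ : ContDiffOn ℝ ∞ Φ (univ ×ˢ T) := contDiff_fst.contDiffOn.prodMk hG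
  have hp₀ : (e x₀, u₀) ∈ (univ : Set V) ×ˢ T := ⟨mem_univ _, hu₀⟩
  have hGd : HasFDerivAt G (fderiv ℝ G (e x₀, u₀)) (e x₀, u₀) :=
    ((hG.contDiffAt (hUo.mem_nhds hp₀)).differentiableAt (by simp)).hasFDerivAt
  -- At the base point `y - f u` is zero, so second derivatives of `f` drop out, and the partial
  -- derivative of `G` in `u` is minus the Gram form of the injective map `df`. This makes the
  -- derivative of `Φ` injective.
  have hGi : ∀ i w, fderiv ℝ G (e x₀, u₀) (0, w) i =
      - inner ℝ (fderiv ℝ f u₀ w) (fderiv ℝ f u₀ (b i)) := by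
    intro i w
    have h1 : HasFDerivAt (fun p : V × E => p.1 - f p.2)
        (ContinuousLinearMap.fst ℝ V E - (fderiv ℝ f u₀).comp (ContinuousLinearMap.snd ℝ V E))
        (e x₀, u₀) :=
      hasFDerivAt_fst.sub (HasFDerivAt.comp (g := f) (f := Prod.snd) (e x₀, u₀) (hfd u₀ hu₀)
        hasFDerivAt_snd)
    have h2 : HasFDerivAt (fun p : V × E => fderiv ℝ f p.2 (b i))
        (fderiv ℝ (fun p : V × E => fderiv ℝ f p.2 (b i)) (e x₀, u₀)) (e x₀, u₀) :=
      (((hdf2.clm_apply contDiffOn_const).contDiffAt (hUo.mem_nhds hp₀)).differentiableAt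
        (by simp)).hasFDerivAt
    have h3 := h1.inner ℝ h2
    have h4 := ((EuclideanSpace.proj i : E →L[ℝ] ℝ).hasFDerivAt.comp (e x₀, u₀) hGd).unique h3
    have h5 := congrArg (fun A => A (0, w)) h4
    simp [fderivInnerCLM_apply, hfu₀, inner_neg_left] at h5
    exact h5
  have hΦd : HasFDerivAt Φ ((ContinuousLinearMap.fst ℝ V E).prod (fderiv ℝ G (e x₀, u₀)))
      (e x₀, u₀) := hasFDerivAt_fst.prodMk hGd
  have hinjΦ : Function.Injective (fderiv ℝ Φ (e x₀, u₀)) := by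
    rw [hΦd.fderiv, injective_iff_map_eq_zero]
    rintro ⟨a, w⟩ h
    have ha : a = 0 := congrArg Prod.fst h
    subst ha
    have hw : fderiv ℝ G (e x₀, u₀) (0, w) = 0 := congrArg Prod.snd h
    have hi : ∀ i, inner ℝ (fderiv ℝ f u₀ w) (fderiv ℝ f u₀ (b i)) = 0 := by
      intro i
      have := hGi i w
      rw [hw] at this
      simpa using this.symm
    have hsum : w = ∑ i, w i • b i := by
      simpa [b] using ((EuclideanSpace.basisFun (Fin d) ℝ).sum_repr w).symm
    have hz : inner ℝ (fderiv ℝ f u₀ w) (fderiv ℝ f u₀ w) = 0 := by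
      nth_rewrite 2 [hsum]
      rw [map_sum, inner_sum]
      refine Finset.sum_eq_zero fun i _ => ?_
      rw [map_smul, inner_smul_right, hi, mul_zero]
    have hw0 : w = 0 := hdf ((inner_self_eq_zero.1 hz).trans (map_zero _).symm)
    rw [hw0]
    rfl
  obtain ⟨A, hA⟩ := exists_continuousLinearEquiv_of_injective _ hinjΦ
  obtain ⟨Ψ, hpΨ, hΨU, hΨ, hΨs⟩ :=
    exists_openPartialHomeomorph_contDiffOn hUo hΦ hp₀ A hA.symm
  -- The smooth solution `u` of `G (y, u) = 0` near the base point. Nearest points solve the same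
  -- equation, so `r` agrees with it near `e x₀`.
  let g : V → E := fun y => (Ψ.symm (y, 0)).2
  let O₀ : Set V := (fun y => (y, (0 : E))) ⁻¹' Ψ.target
  have hO₀ : IsOpen O₀ := Ψ.open_target.preimage (by fun_prop)
  have hg : ContDiffOn ℝ ∞ g O₀ :=
    contDiff_snd.comp_contDiffOn (hΨs.comp (by fun_prop) fun y hy => hy)
  have hre : r (e x₀) = x₀ := by
    have := hr (e x₀) x₀
    rw [sub_self, norm_zero] at this
    exact (hemb.injective (sub_eq_zero.1 (norm_le_zero_iff.1 this))).symm
  -- As `e (r y)` is at least as close to `y` as `e x₀` is, its distance from `e x₀` is at most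
  -- twice that of `y`.
  have hrt : Tendsto r (𝓝 (e x₀)) (𝓝 x₀) := by
    rw [hemb.isInducing.tendsto_nhds_iff, tendsto_iff_norm_sub_tendsto_zero]
    have h0 : Tendsto (fun y => 2 * ‖y - e x₀‖) (𝓝 (e x₀)) (𝓝 0) := by
      have : Continuous fun y => 2 * ‖y - e x₀‖ := by fun_prop
      simpa using this.tendsto (e x₀)
    refine squeeze_zero (fun _ => norm_nonneg _) (fun y => ?_) h0
    have h1 := hr y x₀
    have h2 : ‖e (r y) - e x₀‖ ≤ ‖y - e (r y)‖ + ‖y - e x₀‖ := by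
      rw [norm_sub_rev y (e (r y))]
      exact norm_sub_le_norm_sub_add_norm_sub _ _ _
    change ‖e (r y) - e x₀‖ ≤ _
    linarith
  have hpair : Tendsto (fun y => (y, φ (r y))) (𝓝 (e x₀)) (𝓝 (e x₀, u₀)) :=
    tendsto_id.prodMk_nhds ((continuousAt_extChartAt x₀).tendsto.comp hrt)
  have hev : ∀ᶠ y in 𝓝 (e x₀), y ∈ O₀ ∧ g y ∈ T ∧ r y = φ.symm (g y) := by
    filter_upwards [hpair.eventually (Ψ.open_source.mem_nhds hpΨ),
      hrt.eventually ((isOpen_extChartAt_source (I := 𝓡 d) x₀).mem_nhds hx₀)] with y hy hys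
    have huT : φ (r y) ∈ T := φ.map_source hys
    have hfr : f (φ (r y)) = e (r y) := by
      change e (φ.symm (φ (r y))) = _
      rw [φ.left_inv hys]
    have hcrit : G (y, φ (r y)) = 0 := by
      have hmin : IsLocalMin (fun u => ‖y - f u‖ ^ 2) (φ (r y)) := by
        refine Filter.Eventually.of_forall fun u => ?_
        simp only [hfr]
        gcongr
        exact hr y _
      have hd : HasFDerivAt (fun u => ‖y - f u‖ ^ 2) _ (φ (r y)) :=
        ((hfd _ huT).const_sub y).norm_sq
      have hz := hmin.hasFDerivAt_eq_zero hd
      ext i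
      have h1 := congrArg (fun A => A (b i)) hz
      have h2 : inner ℝ (f (φ (r y))) (fderiv ℝ f (φ (r y)) (b i)) -
          inner ℝ y (fderiv ℝ f (φ (r y)) (b i)) = 0 := by simpa using h1
      change inner ℝ (y - f (φ (r y))) (fderiv ℝ f (φ (r y)) (b i)) = 0
      rw [inner_sub_left]
      linarith
    have hΨy : Ψ (y, φ (r y)) = (y, 0) := by
      rw [hΨ]
      exact Prod.ext rfl hcrit
    have h2 : (y, (0 : E)) ∈ Ψ.target := hΨy ▸ Ψ.map_source hy
    have h3 : g y = φ (r y) := by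
      change (Ψ.symm (y, 0)).2 = _
      rw [← hΨy, Ψ.left_inv hy]
    exact ⟨h2, h3 ▸ huT, by rw [h3, φ.left_inv hys]⟩
  obtain ⟨O, hO, hOo, hxO⟩ := eventually_nhds_iff.1 hev
  refine ⟨O, hOo, hxO, ?_⟩
  have h1 : ContMDiffOn 𝓘(ℝ, V) (𝓡 d) ∞ (fun y => φ.symm (g y)) O :=
    (contMDiffOn_extChartAt_symm x₀).comp
      (contMDiffOn_iff_contDiffOn.2 (hg.mono fun y hy => (hO y hy).1)) fun y hy => (hO y hy).2.1
  exact h1.congr fun y hy => (hO y hy).2.2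

/-- Whitney's embedding and a choice of nearest points. The choice may be arbitrary far from the
manifold; near it the local analysis shows that every choice is smooth. -/
theorem exists_smoothRetract [T2Space M] [CompactSpace M] [Nonempty M] :
    ∃ N : ℕ, Nonempty (SmoothRetract d M (EuclideanSpace ℝ (Fin N))) := by
  obtain ⟨N, e, he, hemb, hinj⟩ := exists_embedding_euclidean_of_compact (I := 𝓡 d) (M := M)
  have hex : ∀ y : EuclideanSpace ℝ (Fin N), ∃ x, ∀ x', ‖y - e x‖ ≤ ‖y - e x'‖ := by
    intro y
    obtain ⟨x, -, hx⟩ := isCompact_univ.exists_isMinOn (s := (univ : Set M)) univ_nonempty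
      (f := fun x => ‖y - e x‖) ((continuous_const.sub hemb.continuous).norm.continuousOn)
    exact ⟨x, fun x' => hx (mem_univ x')⟩
  choose r hr using hex
  have hloc := fun x => exists_contMDiffOn_nearestPoint he hemb hr x (hinj x)
  choose O hO hxO hrO using hloc
  refine ⟨N, ⟨⟨e, r, ⋃ x, O x, isOpen_iUnion hO, fun x => mem_iUnion.2 ⟨x, hxO x⟩, fun x => ?_, he,
    fun y hy => ?_⟩⟩⟩
  · have := hr (e x) x
    rw [sub_self, norm_zero] at this
    exact (hemb.injective (sub_eq_zero.1 (norm_le_zero_iff.1 this))).symm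
  · obtain ⟨x, hx⟩ := mem_iUnion.1 hy
    exact ((hrO x).contMDiffAt ((hO x).mem_nhds hx)).contMDiffWithinAt

end Retract

end SymplecticClosing

namespace SymplecticClosing

/-! ### Closed two-forms on vector spaces and their pullbacks -/

section ClosedForms

/-- An alternating 2-form as a bilinear map. -/
noncomputable def toBilin (E : Type*) [NormedAddCommGroup E] [NormedSpace ℝ E] :
    (E [⋀^Fin 2]→L[ℝ] ℝ) →L[ℝ] E →L[ℝ] E →L[ℝ] ℝ :=
  (ContinuousLinearMap.compL ℝ E (ContinuousMultilinearMap ℝ (fun _ : Fin 1 => E) ℝ) (E →L[ℝ] ℝ)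
    (continuousMultilinearCurryFin1 ℝ E ℝ).toContinuousLinearEquiv.toContinuousLinearMap) ∘L
    (continuousMultilinearCurryLeftEquiv ℝ
      (fun _ : Fin 2 => E) ℝ).toContinuousLinearEquiv.toContinuousLinearMap ∘L
    ContinuousAlternatingMap.toContinuousMultilinearMapCLM ℝ

theorem toBilin_apply {E : Type*} [NormedAddCommGroup E] [NormedSpace ℝ E]
    (α : E [⋀^Fin 2]→L[ℝ] ℝ) (u w : E) : toBilin E α u w = α ![u, w] := by
  change α (Fin.cons u (Fin.snoc 0 w)) = _
  congr 1
  ext i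
  fin_cases i <;> rfl

variable {V P : Type*} [NormedAddCommGroup V] [NormedSpace ℝ V]
  [NormedAddCommGroup P] [NormedSpace ℝ P]

/-- A smooth closed 2-form on an open set. -/
structure IsClosedForm (B : V → V →L[ℝ] V →L[ℝ] ℝ) (O : Set V) : Prop where
  contDiffOn : ContDiffOn ℝ ∞ B O
  skew : ∀ y ∈ O, ∀ a b, B y a b = -B y b a
  closed : ∀ y ∈ O, ∀ a b c,
    fderiv ℝ B y a b c + fderiv ℝ B y b c a + fderiv ℝ B y c a b = 0

/-- The pullback of a bilinear form under a smooth map. -/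
noncomputable def pullbackForm (B : V → V →L[ℝ] V →L[ℝ] ℝ) (Y : P → V) (p : P) :
    P →L[ℝ] P →L[ℝ] ℝ :=
  (B (Y p)).bilinearComp (fderiv ℝ Y p) (fderiv ℝ Y p)

@[simp]
theorem pullbackForm_apply (B : V → V →L[ℝ] V →L[ℝ] ℝ) (Y : P → V) (p a b : P) :
    pullbackForm B Y p a b = B (Y p) (fderiv ℝ Y p a) (fderiv ℝ Y p b) := rfl

/-- The alternating sum in the exterior derivative of a 2-form becomes the cyclic sum after one use
of skew-symmetry. -/
theorem isClosedForm_of_extDeriv {α : V → V [⋀^Fin 2]→L[ℝ] ℝ} {O : Set V} (hO : IsOpen O)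
    (hα : ContDiffOn ℝ ∞ α O) (hc : ∀ y ∈ O, extDeriv α y = 0) :
    IsClosedForm (fun y => toBilin V (α y)) O where
  contDiffOn := by
    have h : ContDiff ℝ ∞ (toBilin V) := by
      apply ContinuousLinearMap.contDiff
    exact h.comp_contDiffOn hα
  skew := by
    intro y _ a b
    rw [toBilin_apply, toBilin_apply]
    refine Eq.trans ?_ ((α y).map_swap ![b, a] (i := 0) (j := 1) (by decide))
    change _ = α y (![b, a] ∘ Equiv.swap 0 1)
    congr 1
    ext i
    fin_cases i <;> rfl
  closed := by
    intro y hy a b c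
    have hd : DifferentiableAt ℝ α y := (hα.contDiffAt (hO.mem_nhds hy)).differentiableAt (by simp)
    have h1 : fderiv ℝ (fun y => toBilin V (α y)) y = (toBilin V).comp (fderiv ℝ α y) := by
      have h : HasFDerivAt (toBilin V) (toBilin V) (α y) := ContinuousLinearMap.hasFDerivAt
        (E := V [⋀^Fin 2]→L[ℝ] ℝ) (F := V →L[ℝ] V →L[ℝ] ℝ) (toBilin V)
      exact (HasFDerivAt.comp (g := toBilin V) (f := α) y h hd.hasFDerivAt).fderiv
    have h2 : ∀ w v, fderiv ℝ (fun x => α x w) y v = fderiv ℝ α y v w := by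
      intro w v
      have : HasFDerivAt (fun x => α x w)
          ((ContinuousAlternatingMap.apply ℝ V ℝ w).comp (fderiv ℝ α y)) y :=
        (ContinuousAlternatingMap.apply ℝ V ℝ w).hasFDerivAt.comp y hd.hasFDerivAt
      rw [this.fderiv]
      rfl
    have h3 := (extDeriv_apply hd ![a, b, c]).trans (Fin.sum_univ_three _)
    rw [hc y hy] at h3
    have r0 : Fin.removeNth 0 ![a, b, c] = ![b, c] := by ext i; fin_cases i <;> rfl
    have r1 : Fin.removeNth 1 ![a, b, c] = ![a, c] := by ext i; fin_cases i <;> rfl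
    have r2 : Fin.removeNth 2 ![a, b, c] = ![a, b] := by ext i; fin_cases i <;> rfl
    have hsk : fderiv ℝ α y b ![c, a] = -fderiv ℝ α y b ![a, c] := by
      refine Eq.trans ?_ ((fderiv ℝ α y b).map_swap ![a, c] (i := 0) (j := 1) (by decide))
      change _ = fderiv ℝ α y b (![a, c] ∘ Equiv.swap 0 1)
      congr 1
      ext i
      fin_cases i <;> rfl
    simp only [h2, r0, r1, r2] at h3
    simp [-Matrix.zero_empty] at h3
    rw [h1]
    change toBilin V (fderiv ℝ α y a) b c + toBilin V (fderiv ℝ α y b) c a +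
      toBilin V (fderiv ℝ α y c) a b = 0
    rw [toBilin_apply, toBilin_apply, toBilin_apply, hsk]
    linarith

variable {B : V → V →L[ℝ] V →L[ℝ] ℝ} {O : Set V}

theorem IsClosedForm.congr {B' : V → V →L[ℝ] V →L[ℝ] ℝ} (hB : IsClosedForm B O) (hO : IsOpen O)
    (h : EqOn B' B O) : IsClosedForm B' O where
  contDiffOn := hB.contDiffOn.congr h
  skew := fun y hy a b => by rw [h hy, hB.skew y hy]
  closed := fun y hy a b c => by
    rw [(h.eventuallyEq_of_mem (hO.mem_nhds hy)).fderiv_eq, hB.closed y hy]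

theorem hasFDerivAt_pullbackForm (hO : IsOpen O) (hB : ContDiffOn ℝ ∞ B O) {Y : P → V} {p : P}
    (hY : ContDiffAt ℝ ∞ Y p) (hp : Y p ∈ O) (b c : P) :
    ∃ D : P →L[ℝ] ℝ, HasFDerivAt (fun q => pullbackForm B Y q b c) D p ∧ ∀ a, D a =
      fderiv ℝ B (Y p) (fderiv ℝ Y p a) (fderiv ℝ Y p b) (fderiv ℝ Y p c) +
      B (Y p) (fderiv ℝ (fderiv ℝ Y) p a b) (fderiv ℝ Y p c) +
      B (Y p) (fderiv ℝ Y p b) (fderiv ℝ (fderiv ℝ Y) p a c) := by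
  have h1 : HasFDerivAt Y (fderiv ℝ Y p) p := (hY.differentiableAt (by simp)).hasFDerivAt
  have h2 : HasFDerivAt (fderiv ℝ Y) (fderiv ℝ (fderiv ℝ Y) p) p :=
    ((hY.fderiv_right (m := ∞) (by simp)).differentiableAt
      (by simp)).hasFDerivAt
  have h3 : HasFDerivAt B (fderiv ℝ B (Y p)) (Y p) :=
    ((hB.contDiffAt (hO.mem_nhds hp)).differentiableAt (by simp)).hasFDerivAt
  have h4 : ∀ w : P, HasFDerivAt (fun q => fderiv ℝ Y q w)
      ((fderiv ℝ (fderiv ℝ Y) p).flip w) p := fun w => by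
    simpa using h2.clm_apply (hasFDerivAt_const w p)
  have h5 : HasFDerivAt (fun q => B (Y q)) ((fderiv ℝ B (Y p)).comp (fderiv ℝ Y p)) p :=
    HasFDerivAt.comp (g := B) p h3 h1
  refine ⟨_, (h5.clm_apply (h4 b)).clm_apply (h4 c), fun a => ?_⟩
  simp
  ring

/-- The terms with first derivatives of `Y` add up to zero because `B` is closed. Those with second
derivatives cancel in pairs, by the symmetry of the second derivative of `Y` and the skew-symmetry
of `B`. -/
theorem IsClosedForm.cyclic_sum_fderiv_pullbackForm (hO : IsOpen O) (hB : IsClosedForm B O)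
    {Y : P → V} {p : P} (hY : ContDiffAt ℝ ∞ Y p) (hp : Y p ∈ O) (a b c : P) :
    fderiv ℝ (fun q => pullbackForm B Y q b c) p a +
      fderiv ℝ (fun q => pullbackForm B Y q c a) p b +
      fderiv ℝ (fun q => pullbackForm B Y q a b) p c = 0 := by
  obtain ⟨D₁, h₁, e₁⟩ := hasFDerivAt_pullbackForm hO hB.contDiffOn hY hp b c
  obtain ⟨D₂, h₂, e₂⟩ := hasFDerivAt_pullbackForm hO hB.contDiffOn hY hp c a
  obtain ⟨D₃, h₃, e₃⟩ := hasFDerivAt_pullbackForm hO hB.contDiffOn hY hp a b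
  have hs := hY.isSymmSndFDerivAt (by
    rw [minSmoothness_of_isRCLikeNormedField]
    exact WithTop.coe_le_coe.2 (le_top : (2 : ℕ∞) ≤ ⊤))
  rw [h₁.fderiv, h₂.fderiv, h₃.fderiv, e₁, e₂, e₃, hs b a, hs c a, hs c b]
  have hc := hB.closed _ hp (fderiv ℝ Y p a) (fderiv ℝ Y p b) (fderiv ℝ Y p c)
  have s1 := hB.skew _ hp (fderiv ℝ Y p a) (fderiv ℝ (fderiv ℝ Y) p b c)
  have s2 := hB.skew _ hp (fderiv ℝ Y p b) (fderiv ℝ (fderiv ℝ Y) p a c)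
  have s3 := hB.skew _ hp (fderiv ℝ Y p c) (fderiv ℝ (fderiv ℝ Y) p a b)
  linarith

theorem contDiffOn_pullbackForm_apply (hB : ContDiffOn ℝ ∞ B O) {Y : P → V} {U : Set P}
    (hU : IsOpen U) (hY : ContDiffOn ℝ ∞ Y U) (hYO : MapsTo Y U O) (a b : P) :
    ContDiffOn ℝ ∞ (fun q => pullbackForm B Y q a b) U := by
  have h1 := hY.fderiv_of_isOpen hU (m := ∞) (by simp)
  exact ((hB.comp hY hYO).clm_apply (h1.clm_apply contDiffOn_const)).clm_apply
    (h1.clm_apply contDiffOn_const)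

/-- The pullback of a closed form under a smooth map is a closed form. -/
theorem IsClosedForm.pullbackForm [FiniteDimensional ℝ P] (hO : IsOpen O) (hB : IsClosedForm B O)
    {Y : P → V} {U : Set P} (hU : IsOpen U) (hY : ContDiffOn ℝ ∞ Y U) (hYO : MapsTo Y U O) :
    IsClosedForm (pullbackForm B Y) U where
  contDiffOn := contDiffOn_clm_apply.2 fun a => contDiffOn_clm_apply.2 fun b =>
    contDiffOn_pullbackForm_apply hB.contDiffOn hU hY hYO a b
  skew := fun p hp a b => hB.skew _ (hYO hp) _ _
  closed := fun p hp a b c => by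
    have hd : DifferentiableAt ℝ (SymplecticClosing.pullbackForm B Y) p := by
      have : ContDiffOn ℝ ∞ (SymplecticClosing.pullbackForm B Y) U :=
        contDiffOn_clm_apply.2 fun a => contDiffOn_clm_apply.2 fun b =>
          contDiffOn_pullbackForm_apply hB.contDiffOn hU hY hYO a b
      exact (this.contDiffAt (hU.mem_nhds hp)).differentiableAt (by simp)
    have h1 : ∀ v w u, fderiv ℝ (fun q => SymplecticClosing.pullbackForm B Y q v w) p u =
        fderiv ℝ (SymplecticClosing.pullbackForm B Y) p u v w := by
      intro v w u
      have := (hd.hasFDerivAt.clm_apply (hasFDerivAt_const v p)).clm_apply (hasFDerivAt_const w p)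
      rw [this.fderiv]
      simp
    have := hB.cyclic_sum_fderiv_pullbackForm hO (hY.contDiffAt (hU.mem_nhds hp)) (hYO hp) a b c
    rwa [h1, h1, h1] at this

end ClosedForms

end SymplecticClosing

namespace SymplecticClosing

/-! ### The symplectic form and Hamiltonian vector fields in the ambient vector space -/

section Ambient

theorem IsClosedForm.of_locally {V : Type*} [NormedAddCommGroup V] [NormedSpace ℝ V]
    {B : V → V →L[ℝ] V →L[ℝ] ℝ} {O : Set V}
    (h : ∀ y ∈ O, ∃ U, IsOpen U ∧ y ∈ U ∧ IsClosedForm B U) : IsClosedForm B O where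
  contDiffOn := fun y hy => by
    obtain ⟨U, hU, hyU, hB⟩ := h y hy
    exact (hB.contDiffOn.contDiffAt (hU.mem_nhds hyU)).contDiffWithinAt
  skew := fun y hy => by
    obtain ⟨U, -, hyU, hB⟩ := h y hy
    exact hB.skew y hyU
  closed := fun y hy => by
    obtain ⟨U, -, hyU, hB⟩ := h y hy
    exact hB.closed y hyU

theorem exists_contDiff_cutoff {X : Type*} [NormedAddCommGroup X] [NormedSpace ℝ X]
    [FiniteDimensional ℝ X] {K U : Set X} (hK : IsCompact K) (hU : IsOpen U) (hKU : K ⊆ U) :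
    ∃ ρ : X → ℝ, ContDiff ℝ ∞ ρ ∧ HasCompactSupport ρ ∧ tsupport ρ ⊆ U ∧ (∀ x ∈ K, ρ x = 1) ∧
      ∀ x, ρ x ∈ Icc (0 : ℝ) 1 := by
  have : ProperSpace X := FiniteDimensional.proper ℝ X
  obtain ⟨K₁, hK₁, hKK₁, hK₁U⟩ := exists_compact_between hK hU hKU
  obtain ⟨f, hf1, hf0, hf⟩ := exists_contMDiffMap_one_nhds_of_subset_interior (n := ⊤) 𝓘(ℝ, X)
    hK.isClosed hKK₁
  have hs : tsupport f ⊆ K₁ := closure_minimal (fun x hx => by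
    by_contra h
    exact hx (hf0 x h)) hK₁.isClosed
  exact ⟨f, f.contMDiff.contDiff, HasCompactSupport.of_support_subset_isCompact hK₁
    (subset_closure.trans hs), hs.trans hK₁U, fun x hx => hf1.self_of_nhdsSet x hx, hf⟩

theorem contDiff_smul_of_tsupport {X F : Type*} [NormedAddCommGroup X] [NormedSpace ℝ X]
    [NormedAddCommGroup F] [NormedSpace ℝ F] {ρ : X → ℝ} {w : X → F} {U : Set X} (hU : IsOpen U)
    (hρ : ContDiff ℝ ∞ ρ) (hs : tsupport ρ ⊆ U) (hw : ContDiffOn ℝ ∞ w U) :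
    ContDiff ℝ ∞ fun x => ρ x • w x := by
  rw [contDiff_iff_contDiffAt]
  intro x
  by_cases hx : x ∈ tsupport ρ
  · exact hρ.contDiffAt.smul (hw.contDiffAt (hU.mem_nhds (hs hx)))
  · refine contDiffAt_const (c := (0 : F)) |>.congr_of_eventuallyEq ?_
    filter_upwards [(isClosed_tsupport ρ).isOpen_compl.mem_nhds hx] with y hy
    rw [image_eq_zero_of_notMem_tsupport hy, zero_smul]

variable {n : ℕ} {M : Type*} [TopologicalSpace M] [ChartedSpace (EuclideanSpace ℝ (Fin (2 * n))) M]

/-- The symplectic form at a point, as an alternating form on the model space. -/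
noncomputable def SymplecticForm.alt (Ω : SymplecticForm n M) (x : M) :
    EuclideanSpace ℝ (Fin (2 * n)) [⋀^Fin 2]→L[ℝ] ℝ := Ω.form x

/-- The Hamiltonian vector of a function at a point. -/
noncomputable def symGrad (Ω : SymplecticForm n M) (f : M → ℝ) (x : M) :
    EuclideanSpace ℝ (Fin (2 * n)) :=
  (exists_form_eq Ω x (-(mfderiv (𝓡 (2 * n)) 𝓘(ℝ, ℝ) f x :
      TangentSpace (𝓡 (2 * n)) x →L[ℝ] ℝ))).choose

/-- The differential of a function at a point, as a functional on the model space. -/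
noncomputable def dM (f : M → ℝ) (x : M) : EuclideanSpace ℝ (Fin (2 * n)) →L[ℝ] ℝ :=
  mfderiv (𝓡 (2 * n)) 𝓘(ℝ, ℝ) f x

theorem alt_symGrad (Ω : SymplecticForm n M) (f : M → ℝ) (x : M)
    (w : EuclideanSpace ℝ (Fin (2 * n))) :
    Ω.alt x ![symGrad Ω f x, w] = -dM f x w :=
  (exists_form_eq Ω x (-(mfderiv (𝓡 (2 * n)) 𝓘(ℝ, ℝ) f x :
      TangentSpace (𝓡 (2 * n)) x →L[ℝ] ℝ))).choose_spec w

/-- Nondegeneracy of the form. Every formula for Hamiltonian vectors below is proved by checking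
this characterization. -/
theorem eq_symGrad (Ω : SymplecticForm n M) (f : M → ℝ) (x : M)
    (u : EuclideanSpace ℝ (Fin (2 * n)))
    (hu : ∀ w : EuclideanSpace ℝ (Fin (2 * n)),
      toBilin _ (Ω.alt x) u w = -dM f x w) :
    u = symGrad Ω f x := by
  have key : ∀ w : EuclideanSpace ℝ (Fin (2 * n)),
      toBilin _ (Ω.alt x) (u - symGrad Ω f x) w = 0 := by
    intro w
    rw [map_sub, sub_apply, hu w, toBilin_apply, alt_symGrad, sub_self]
  have h : u - symGrad Ω f x = 0 :=
    Ω.nondegenerate x _ fun w => (toBilin_apply (Ω.alt x) _ _).symm.trans (key w)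
  exact sub_eq_zero.1 h

variable {V : Type} [NormedAddCommGroup V] [InnerProductSpace ℝ V]

/-- The derivative of the retraction. -/
noncomputable def SmoothRetract.retrD (R : SmoothRetract (2 * n) M V) (y : V) :
    V →L[ℝ] EuclideanSpace ℝ (Fin (2 * n)) := mfderiv 𝓘(ℝ, V) (𝓡 (2 * n)) R.retr y

/-- The derivative of the inclusion. -/
noncomputable def SmoothRetract.inclD (R : SmoothRetract (2 * n) M V) (x : M) :
    EuclideanSpace ℝ (Fin (2 * n)) →L[ℝ] V := mfderiv (𝓡 (2 * n)) 𝓘(ℝ, V) R.incl x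

variable (R : SmoothRetract (2 * n) M V)

theorem SmoothRetract.hasMFDerivAt_incl (x : M) :
    HasMFDerivAt (𝓡 (2 * n)) 𝓘(ℝ, V) R.incl x (R.inclD x) :=
  ((R.contMDiff_incl x).mdifferentiableAt (by simp)).hasMFDerivAt

theorem SmoothRetract.hasMFDerivAt_retr {y : V} (hy : y ∈ R.dom) :
    HasMFDerivAt 𝓘(ℝ, V) (𝓡 (2 * n)) R.retr y (R.retrD y) :=
  ((R.contMDiffOn_retr.contMDiffAt (R.isOpen_dom.mem_nhds hy)).mdifferentiableAt
    (by simp)).hasMFDerivAt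

theorem SmoothRetract.retrD_inclD (x : M) (ξ : EuclideanSpace ℝ (Fin (2 * n))) :
    R.retrD (R.incl x) (R.inclD x ξ) = ξ := by
  have h1 := (R.hasMFDerivAt_retr (R.incl_mem x)).comp x (R.hasMFDerivAt_incl x)
  have h2 : R.retr ∘ R.incl = id := funext R.retr_incl
  rw [h2] at h1
  have h3 := congrArg (fun A => A ξ) (h1.mfderiv.symm.trans mfderiv_id)
  exact h3

/-- The pullback of the symplectic form under the retraction. -/
noncomputable def formV (Ω : SymplecticForm n M) (y : V) : V →L[ℝ] V →L[ℝ] ℝ :=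
  (toBilin _ (Ω.alt (R.retr y))).bilinearComp (R.retrD y) (R.retrD y)

theorem formV_apply (Ω : SymplecticForm n M) (y u w : V) :
    formV R Ω y u w = toBilin _ (Ω.alt (R.retr y)) (R.retrD y u) (R.retrD y w) := rfl

theorem formV_inclD (Ω : SymplecticForm n M) (x : M) (ξ η : EuclideanSpace ℝ (Fin (2 * n))) :
    formV R Ω (R.incl x) (R.inclD x ξ) (R.inclD x η) = Ω.alt x ![ξ, η] := by
  rw [formV_apply, R.retrD_inclD, R.retrD_inclD, R.retr_incl, toBilin_apply]

/-- The Hamiltonian vector field of a function, as a vector of the ambient space. -/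
noncomputable def gradV (Ω : SymplecticForm n M) (f : M → ℝ) (x : M) : V :=
  R.inclD x (symGrad Ω f x)

theorem formV_gradV (Ω : SymplecticForm n M) (f : M → ℝ) (x : M) (w : V) :
    formV R Ω (R.incl x) (gradV R Ω f x) w =
      -dM f x (R.retrD (R.incl x) w) := by
  rw [formV_apply, gradV, R.retrD_inclD, R.retr_incl, toBilin_apply, alt_symGrad]

theorem fderiv_comp_retr {f : M → ℝ} {y : V} (hy : y ∈ R.dom)
    (hf : MDifferentiableAt (𝓡 (2 * n)) 𝓘(ℝ, ℝ) f (R.retr y)) (w : V) :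
    fderiv ℝ (fun y => f (R.retr y)) y w =
      dM f (R.retr y) (R.retrD y w) := by
  have h : HasFDerivAt (fun y => f (R.retr y)) ((dM f (R.retr y)).comp (R.retrD y)) y := by
    have h0 := hf.hasMFDerivAt.comp y (R.hasMFDerivAt_retr hy)
    exact hasMFDerivAt_iff_hasFDerivAt.1 h0
  rw [h.fderiv]
  rfl

variable [IsManifold (𝓡 (2 * n)) ∞ M] [FiniteDimensional ℝ V]

/-- The ambient form is smooth and closed. -/
theorem isClosedForm_formV (Ω : SymplecticForm n M) : IsClosedForm (formV R Ω) R.dom := by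
  refine IsClosedForm.of_locally fun y₀ hy₀ => ?_
  let E := EuclideanSpace ℝ (Fin (2 * n))
  let x₀ := R.retr y₀
  let φ := extChartAt (𝓡 (2 * n)) x₀
  let N : Set V := R.dom ∩ R.retr ⁻¹' φ.source
  have hN : IsOpen N := R.contMDiffOn_retr.continuousOn.isOpen_inter_preimage R.isOpen_dom
    (isOpen_extChartAt_source x₀)
  have hy₀N : y₀ ∈ N := ⟨hy₀, mem_extChartAt_source x₀⟩
  refine ⟨N, hN, hy₀N, ?_⟩
  have hT : IsOpen φ.target := isOpen_extChartAt_target x₀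
  let g : V → E := fun y => φ (R.retr y)
  have hg : ContDiffOn ℝ ∞ g N := by
    rw [← contMDiffOn_iff_contDiffOn]
    refine (contMDiffOn_extChartAt (x := x₀)).comp (R.contMDiffOn_retr.mono inter_subset_left) ?_
    intro y hy
    have := hy.2
    rwa [mem_preimage, extChartAt_source] at this
  have hgT : MapsTo g N φ.target := fun y hy => φ.map_source hy.2
  have hB : IsClosedForm (fun u => toBilin E (formInChart Ω.form x₀ u)) φ.target :=
    isClosedForm_of_extDeriv hT (Ω.smooth x₀) (Ω.closed x₀)
  -- Near `y₀` the ambient form is the pullback of the closed form in a chart under the chart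
  -- composed with the retraction.
  refine (hB.pullbackForm hT hN hg hgT).congr hN fun y hy => ?_
  have hsymm : R.retr y = φ.symm (g y) := (φ.left_inv hy.2).symm
  have h1 : HasMFDerivAt 𝓘(ℝ, V) 𝓘(ℝ, E) g y (fderiv ℝ g y) :=
    ((hg.contDiffAt (hN.mem_nhds hy)).differentiableAt (by simp)).hasFDerivAt.hasMFDerivAt
  have h2 : HasMFDerivAt 𝓘(ℝ, E) (𝓡 (2 * n)) φ.symm (g y)
      (mfderiv 𝓘(ℝ, E) (𝓡 (2 * n)) φ.symm (g y)) :=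
    (((contMDiffOn_extChartAt_symm (n := ∞) x₀).contMDiffAt (hT.mem_nhds (hgT hy))).mdifferentiableAt
      (by simp)).hasMFDerivAt
  have h3 : mfderiv 𝓘(ℝ, V) (𝓡 (2 * n)) (φ.symm ∘ g) y = _ := (h2.comp y h1).mfderiv
  have h4 : φ.symm ∘ g =ᶠ[𝓝 y] R.retr := by
    filter_upwards [hN.mem_nhds hy] with z hz
    exact φ.left_inv hz.2
  have h5 : ∀ u, R.retrD y u =
      (mfderiv 𝓘(ℝ, E) (𝓡 (2 * n)) φ.symm (g y) : E →L[ℝ] E) (fderiv ℝ g y u) := by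
    intro u
    have h6 := h4.mfderiv_eq (I := 𝓘(ℝ, V)) (I' := 𝓡 (2 * n))
    exact congrArg (fun A : V →L[ℝ] E => A u) (h6.symm.trans h3)
  ext u w
  rw [formV_apply, toBilin_apply, pullbackForm_apply, toBilin_apply]
  change Ω.alt (R.retr y) _ = Ω.alt (φ.symm (g y)) (fun i =>
    (mfderiv 𝓘(ℝ, E) (𝓡 (2 * n)) φ.symm (g y) : E →L[ℝ] E) (![fderiv ℝ g y u, fderiv ℝ g y w] i))
  rw [← hsymm]
  congr 1
  ext1 i
  fin_cases i
  · exact h5 u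
  · exact h5 w

theorem exists_equiv_dual_of_injective (A : V →L[ℝ] V →L[ℝ] ℝ) (hA : Function.Injective A) :
    ∃ e : V ≃L[ℝ] V →L[ℝ] ℝ, (e : V →L[ℝ] V →L[ℝ] ℝ) = A := by
  have hfin : Module.finrank ℝ V = Module.finrank ℝ (V →L[ℝ] ℝ) := by
    rw [← (LinearMap.toContinuousLinearMap (𝕜 := ℝ) (E := V) (F' := ℝ)).finrank_eq]
    exact (Subspace.dual_finrank_eq).symm
  exact ⟨(LinearMap.linearEquivOfInjective (A : V →ₗ[ℝ] V →L[ℝ] ℝ) hA hfin).toContinuousLinearEquiv,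
    by ext x; rfl⟩

/-- The derivative of the ambient retraction `incl ∘ retr`. -/
noncomputable def SmoothRetract.proj (y : V) : V →L[ℝ] V :=
  fderiv ℝ (fun y => R.incl (R.retr y)) y

omit [IsManifold (𝓡 (2 * n)) ∞ M] [FiniteDimensional ℝ V] in
theorem SmoothRetract.contDiffOn_incl_retr : ContDiffOn ℝ ∞ (fun y => R.incl (R.retr y)) R.dom := by
  rw [← contMDiffOn_iff_contDiffOn]
  exact R.contMDiff_incl.comp_contMDiffOn R.contMDiffOn_retr

omit [IsManifold (𝓡 (2 * n)) ∞ M] [FiniteDimensional ℝ V] in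
theorem SmoothRetract.proj_apply {y : V} (hy : y ∈ R.dom) (w : V) :
    R.proj y w = R.inclD (R.retr y) (R.retrD y w) := by
  have h : HasFDerivAt (fun y => R.incl (R.retr y)) ((R.inclD (R.retr y)).comp (R.retrD y)) y := by
    have h0 := (R.hasMFDerivAt_incl (R.retr y)).comp y (R.hasMFDerivAt_retr hy)
    exact hasMFDerivAt_iff_hasFDerivAt.1 h0
  rw [SmoothRetract.proj, h.fderiv]
  rfl

/-- The real inner product as a continuous bilinear map. -/
noncomputable def realInner (V : Type*) [NormedAddCommGroup V] [InnerProductSpace ℝ V] :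
    V →L[ℝ] V →L[ℝ] ℝ :=
  (innerₗ V).mkContinuous₂ 1 fun u w => by
    rw [one_mul]
    exact abs_real_inner_le_norm u w

/-- The ambient form, made nondegenerate in the normal directions. -/
noncomputable def ambientForm (Ω : SymplecticForm n M) (y : V) : V →L[ℝ] V →L[ℝ] ℝ :=
  formV R Ω y + (realInner V).bilinearComp
    (ContinuousLinearMap.id ℝ V - R.proj y) (ContinuousLinearMap.id ℝ V - R.proj y)

omit [IsManifold (𝓡 (2 * n)) ∞ M] [FiniteDimensional ℝ V] in
theorem ambientForm_apply (Ω : SymplecticForm n M) (y u w : V) :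
    ambientForm R Ω y u w = formV R Ω y u w + inner ℝ (u - R.proj y u) (w - R.proj y w) := rfl

-- A Hamiltonian vector is tangent to the manifold, so the added normal term does not see it. Hence
-- the Hamiltonian vector solves a linear equation whose coefficients are smooth functions of the
-- ambient point.
omit [IsManifold (𝓡 (2 * n)) ∞ M] [FiniteDimensional ℝ V] in
theorem ambientForm_gradV (Ω : SymplecticForm n M) (f : M → ℝ) (x : M) (w : V) :
    ambientForm R Ω (R.incl x) (gradV R Ω f x) w =
      -dM f x (R.retrD (R.incl x) w) := by
  have h : R.proj (R.incl x) (gradV R Ω f x) = gradV R Ω f x := by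
    rw [R.proj_apply (R.incl_mem x), R.retr_incl, gradV, R.retrD_inclD]
  rw [ambientForm_apply, formV_gradV, h, sub_self, inner_zero_left, add_zero]

-- Testing `u` against tangent vectors leaves only the symplectic term and kills the tangential part
-- of `u`; testing it against itself then leaves its squared norm.
omit [IsManifold (𝓡 (2 * n)) ∞ M] [FiniteDimensional ℝ V] in
theorem injective_ambientForm (Ω : SymplecticForm n M) (x : M) :
    Function.Injective (ambientForm R Ω (R.incl x)) := by
  rw [injective_iff_map_eq_zero]
  intro u hu
  have hP : ∀ w, R.proj (R.incl x) w = R.inclD x (R.retrD (R.incl x) w) := fun w => by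
    rw [R.proj_apply (R.incl_mem x), R.retr_incl]
  have hD : R.retrD (R.incl x) u = 0 := by
    refine Ω.nondegenerate x _ fun (η : EuclideanSpace ℝ (Fin (2 * n))) => ?_
    have h1 : ambientForm R Ω (R.incl x) u (R.inclD x η) = 0 := by rw [hu]; rfl
    rw [ambientForm_apply, hP (R.inclD x η), R.retrD_inclD, sub_self, inner_zero_right, add_zero,
      formV_apply, R.retrD_inclD, R.retr_incl, toBilin_apply] at h1
    exact h1
  have h2 : ambientForm R Ω (R.incl x) u u = 0 := by rw [hu]; rfl
  rw [ambientForm_apply, formV_apply, hP, hD, map_zero, map_zero, sub_zero] at h2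
  simpa using h2

theorem contDiffOn_ambientForm (Ω : SymplecticForm n M) :
    ContDiffOn ℝ ∞ (ambientForm R Ω) R.dom := by
  have hP : ContDiffOn ℝ ∞ R.proj R.dom :=
    R.contDiffOn_incl_retr.fderiv_of_isOpen R.isOpen_dom (by simp)
  refine contDiffOn_clm_apply.2 fun u => contDiffOn_clm_apply.2 fun w => ?_
  simp only [ambientForm_apply]
  exact (((isClosedForm_formV R Ω).contDiffOn.clm_apply contDiffOn_const).clm_apply
    contDiffOn_const).add ((contDiffOn_const.sub (hP.clm_apply contDiffOn_const)).inner ℝ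
      (contDiffOn_const.sub (hP.clm_apply contDiffOn_const)))

/-- The Hamiltonian vector field of a time-dependent function extends to a compactly supported
smooth vector field of the ambient space. -/
theorem exists_contDiff_extend_gradV [CompactSpace M] (Ω : SymplecticForm n M) {K : ℝ × M → ℝ}
    (hK : ContMDiff (𝓘(ℝ, ℝ).prod (𝓡 (2 * n))) 𝓘(ℝ, ℝ) ∞ K) (T : ℝ) :
    ∃ v : ℝ × V → V, ContDiff ℝ ∞ v ∧ HasCompactSupport v ∧
      ∀ t ∈ Icc (-T) T, ∀ x, v (t, R.incl x) = gradV R Ω (fun z => K (t, z)) x := by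
  -- On this open set around the manifold the ambient form is invertible, and the extension solves
  -- `ambientForm (w, ·) = -dκ`, with `κ` the Hamiltonian composed with the retraction.
  let O₁ : Set V := R.dom ∩ ambientForm R Ω ⁻¹'
    range ((↑) : (V ≃L[ℝ] V →L[ℝ] ℝ) → (V →L[ℝ] V →L[ℝ] ℝ))
  have hO₁ : IsOpen O₁ := (contDiffOn_ambientForm R Ω).continuousOn.isOpen_inter_preimage
    R.isOpen_dom ContinuousLinearEquiv.isOpen
  have hmem : ∀ x, R.incl x ∈ O₁ := fun x =>
    ⟨R.incl_mem x, exists_equiv_dual_of_injective _ (injective_ambientForm R Ω x)⟩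
  let U : Set (ℝ × V) := univ ×ˢ O₁
  have hU : IsOpen U := isOpen_univ.prod hO₁
  let κ : ℝ × V → ℝ := fun p => K (p.1, R.retr p.2)
  have hκ : ContDiffOn ℝ ∞ κ U := by
    rw [← contMDiffOn_iff_contDiffOn]
    refine hK.comp_contMDiffOn (f := fun p : ℝ × V => (p.1, R.retr p.2)) ?_
    refine ContMDiffOn.prodMk contDiff_fst.contMDiff.contMDiffOn ?_
    exact R.contMDiffOn_retr.comp contDiff_snd.contMDiff.contMDiffOn fun p hp => hp.2.1
  let w : ℝ × V → V := fun p => (ambientForm R Ω p.2).inverse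
    (-((fderiv ℝ κ p).comp (ContinuousLinearMap.inr ℝ ℝ V)))
  have hw : ContDiffOn ℝ ∞ w U := by
    intro p hp
    obtain ⟨e, he⟩ := hp.2.2
    have h1 : ContDiffAt ℝ ∞ (fun p : ℝ × V => ambientForm R Ω p.2) p :=
      ((contDiffOn_ambientForm R Ω).contDiffAt (R.isOpen_dom.mem_nhds hp.2.1)).comp p
        contDiffAt_snd
    have h2 : ContDiffAt ℝ ∞ (fun p : ℝ × V => (ambientForm R Ω p.2).inverse) p := by
      refine ContDiffAt.comp p (g := ContinuousLinearMap.inverse) ?_ h1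
      rw [← he]
      exact contDiffAt_map_inverse e
    have h3 : ContDiffAt ℝ ∞ (fun p => fderiv ℝ κ p) p :=
      (hκ.contDiffAt (hU.mem_nhds hp)).fderiv_right (by simp)
    exact (h2.clm_apply (h3.clm_comp contDiffAt_const).neg).contDiffWithinAt
  -- A cutoff equal to one on this set makes the field compactly supported, hence globally
  -- Lipschitz, at the cost of restricting the times to `[-T, T]`.
  have hC : IsCompact (Icc (-T) T ×ˢ range R.incl) :=
    isCompact_Icc.prod (isCompact_range R.contMDiff_incl.continuous)
  obtain ⟨ρ, hρ, hρc, hρs, hρ1, -⟩ := exists_contDiff_cutoff hC hU (by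
    rintro ⟨t, _⟩ ⟨-, x, rfl⟩
    exact ⟨mem_univ _, hmem x⟩)
  refine ⟨fun p => ρ p • w p, contDiff_smul_of_tsupport hU hρ hρs hw, hρc.smul_right, ?_⟩
  intro t ht x
  simp only
  rw [hρ1 (t, R.incl x) ⟨ht, x, rfl⟩, one_smul]
  obtain ⟨e, he⟩ := (hmem x).2
  have hd : HasFDerivAt κ (fderiv ℝ κ (t, R.incl x)) (t, R.incl x) :=
    ((hκ.contDiffAt (hU.mem_nhds ⟨mem_univ _, hmem x⟩)).differentiableAt (by simp)).hasFDerivAt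
  have h1 : fderiv ℝ (fun y => K (t, R.retr y)) (R.incl x) =
      (fderiv ℝ κ (t, R.incl x)).comp (ContinuousLinearMap.inr ℝ ℝ V) :=
    (HasFDerivAt.comp (g := κ) (R.incl x) hd (hasFDerivAt_prodMk_right t (R.incl x))).fderiv
  have hKt : MDifferentiableAt (𝓡 (2 * n)) 𝓘(ℝ, ℝ) (fun z => K (t, z)) (R.retr (R.incl x)) := by
    have : ContMDiff (𝓡 (2 * n)) 𝓘(ℝ, ℝ) ∞ (fun z => K (t, z)) :=
      hK.comp (contMDiff_const.prodMk contMDiff_id)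
    exact (this _).mdifferentiableAt (by simp)
  change (ambientForm R Ω (R.incl x)).inverse (-((fderiv ℝ κ (t, R.incl x)).comp
    (ContinuousLinearMap.inr ℝ ℝ V))) = _
  have h2 : ambientForm R Ω (R.incl x) (gradV R Ω (fun z => K (t, z)) x) =
      -((fderiv ℝ κ (t, R.incl x)).comp (ContinuousLinearMap.inr ℝ ℝ V)) := by
    ext u
    rw [ambientForm_gradV, ← h1, neg_apply,
      fderiv_comp_retr R (R.incl_mem x) hKt, R.retr_incl]
  rw [← h2, ← he, ContinuousLinearMap.inverse_equiv]
  exact e.symm_apply_apply _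

end Ambient

end SymplecticClosing

namespace SymplecticClosing

/-! ### Smooth Hamiltonian flows -/

section Flows

theorem eqOn_Ioo_of_hasDerivAt {V : Type*} [NormedAddCommGroup V] [NormedSpace ℝ V]
    {v : ℝ × V → V} {L : NNReal} (hv : LipschitzWith L v) {f g : ℝ → V} {a b t₀ : ℝ}
    (ht₀ : t₀ ∈ Ioo a b) (hf : ∀ t ∈ Ioo a b, HasDerivAt f (v (t, f t)) t)
    (hg : ∀ t ∈ Ioo a b, HasDerivAt g (v (t, g t)) t) (h : f t₀ = g t₀) : EqOn f g (Ioo a b) :=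
  ODE_solution_unique_of_mem_Ioo (v := fun t y => v (t, y)) (s := fun _ => univ) (K := L)
    (fun t _ => (LipschitzWith.of_dist_le_mul fun x y => by
      simpa [Prod.dist_eq] using hv.dist_le_mul (t, x) (t, y)).lipschitzOnWith)
    ht₀ (fun t ht => ⟨hf t ht, mem_univ _⟩) (fun t ht => ⟨hg t ht, mem_univ _⟩) h

variable {n : ℕ} {M : Type*} [TopologicalSpace M] [ChartedSpace (EuclideanSpace ℝ (Fin (2 * n))) M]
variable {V : Type} [NormedAddCommGroup V] [InnerProductSpace ℝ V]
variable (R : SmoothRetract (2 * n) M V)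

/-- A smooth isotopy, over the whole line, that is the Hamiltonian flow of a smooth function. -/
structure IsSmoothFlow (Ω : SymplecticForm n M) (K : ℝ × M → ℝ)
    (φ : ℝ → (M ≃ₘ⟮𝓡 (2 * n), 𝓡 (2 * n)⟯ M)) : Prop where
  smooth : ContMDiff (𝓘(ℝ, ℝ).prod (𝓡 (2 * n))) 𝓘(ℝ, ℝ) ∞ K
  zero : ∀ x, φ 0 x = x
  hasDerivAt : ∀ x t, HasDerivAt (fun s => R.incl (φ s x))
    (gradV R Ω (fun z => K (t, z)) (φ t x)) t

theorem SmoothRetract.incl_injective : Function.Injective R.incl :=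
  Function.LeftInverse.injective R.retr_incl

theorem contMDiff_slice {K : ℝ × M → ℝ} (hK : ContMDiff (𝓘(ℝ, ℝ).prod (𝓡 (2 * n))) 𝓘(ℝ, ℝ) ∞ K)
    (t : ℝ) : ContMDiff (𝓡 (2 * n)) 𝓘(ℝ, ℝ) ∞ fun z => K (t, z) :=
  hK.comp (contMDiff_const.prodMk contMDiff_id)

theorem symGrad_add (Ω : SymplecticForm n M) {f g : M → ℝ} {x : M}
    (hf : MDifferentiableAt (𝓡 (2 * n)) 𝓘(ℝ, ℝ) f x)
    (hg : MDifferentiableAt (𝓡 (2 * n)) 𝓘(ℝ, ℝ) g x) :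
    symGrad Ω (fun z => f z + g z) x = symGrad Ω f x + symGrad Ω g x := by
  refine (eq_symGrad Ω _ x _ fun w => ?_).symm
  have h : dM (fun z => f z + g z) x = dM f x + dM g x :=
    (hf.hasMFDerivAt.add hg.hasMFDerivAt).mfderiv
  rw [map_add, add_apply, toBilin_apply, toBilin_apply, alt_symGrad, alt_symGrad, h, add_apply]
  ring

theorem symGrad_const_mul (Ω : SymplecticForm n M) {f : M → ℝ} {x : M}
    (hf : MDifferentiableAt (𝓡 (2 * n)) 𝓘(ℝ, ℝ) f x) (c : ℝ) :
    symGrad Ω (fun z => c * f z) x = c • symGrad Ω f x := by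
  refine (eq_symGrad Ω _ x _ fun w => ?_).symm
  have h : dM (fun z => c * f z) x = c • dM f x :=
    (hf.hasMFDerivAt.const_smul c).mfderiv
  rw [map_smul, smul_apply, toBilin_apply, alt_symGrad, h, smul_apply, smul_neg]

theorem gradV_add (Ω : SymplecticForm n M) {f g : M → ℝ} {x : M}
    (hf : MDifferentiableAt (𝓡 (2 * n)) 𝓘(ℝ, ℝ) f x)
    (hg : MDifferentiableAt (𝓡 (2 * n)) 𝓘(ℝ, ℝ) g x) :
    gradV R Ω (fun z => f z + g z) x = gradV R Ω f x + gradV R Ω g x := by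
  rw [gradV, symGrad_add Ω hf hg, map_add]; rfl

theorem gradV_const_mul (Ω : SymplecticForm n M) {f : M → ℝ} {x : M}
    (hf : MDifferentiableAt (𝓡 (2 * n)) 𝓘(ℝ, ℝ) f x) (c : ℝ) :
    gradV R Ω (fun z => c * f z) x = c • gradV R Ω f x := by
  rw [gradV, symGrad_const_mul Ω hf, map_smul]; rfl

theorem gradV_eq_zero_of_eventuallyEq (Ω : SymplecticForm n M) {f : M → ℝ} {x : M} {c : ℝ}
    (hf : f =ᶠ[𝓝 x] fun _ => c) : gradV R Ω f x = 0 := by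
  have h : symGrad Ω f x = 0 := by
    refine (eq_symGrad Ω _ x _ fun w => ?_).symm
    have h1 : dM f x = 0 := (hf.mfderiv_eq (I := 𝓡 (2 * n)) (I' := 𝓘(ℝ, ℝ))).trans mfderiv_const
    rw [map_zero, h1]
    simp
  rw [gradV, h, map_zero]

variable [IsManifold (𝓡 (2 * n)) ∞ M] [CompactSpace M] [FiniteDimensional ℝ V]
variable {R} {Ω : SymplecticForm n M} {K : ℝ × M → ℝ}
  {φ : ℝ → (M ≃ₘ⟮𝓡 (2 * n), 𝓡 (2 * n)⟯ M)}

/-- The field `(1, v)` on `ℝ × V` turns a time-dependent equation into an autonomous one, whose flow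
`Z` is smooth in the duration, the starting time and the starting point together. The definition of
`IsSmoothFlow` does not include joint smoothness; it is obtained from `Z`. -/
theorem IsSmoothFlow.exists_propagator (h : IsSmoothFlow R Ω K φ) (T : ℝ) :
    ∃ δ > 0, ∃ Z : ℝ → ℝ × V → V,
      ContDiffOn ℝ ∞ (fun p : ℝ × (ℝ × V) => Z p.1 p.2) (Ioo (-δ) δ ×ˢ univ) ∧
        ∀ t u x, |t| < T → |u| < δ → Z u (t, R.incl (φ t x)) = R.incl (φ (t + u) x) := by
  obtain ⟨v, hv, hvc, hvK⟩ := exists_contDiff_extend_gradV R Ω h.smooth (T + 1)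
  obtain ⟨L, hL⟩ := hv.lipschitzWith_of_hasCompactSupport hvc (by simp)
  let W : ℝ × V → ℝ × V := fun p => (1, v p)
  have hW : ContDiff ℝ ∞ W := contDiff_const.prodMk hv
  have hWL : LipschitzWith (max 0 L) W := (LipschitzWith.const (1 : ℝ)).prodMk hL
  obtain ⟨δ, hδ, Ψ, hΨ, hΨ0, hΨd⟩ := exists_contDiffOn_flow hW hWL
  refine ⟨min δ 1, lt_min hδ one_pos, fun u p => (Ψ u p).2,
    contDiff_snd.comp_contDiffOn (hΨ.mono (prod_mono (Ioo_subset_Ioo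
      (neg_le_neg (min_le_left _ _)) (min_le_left _ _)) subset_rfl)), ?_⟩
  intro t u x ht hu
  have hsub : ∀ s ∈ Ioo (-min δ 1) (min δ 1), s ∈ Ioo (-δ) δ ∧ t + s ∈ Icc (-(T + 1)) (T + 1) := by
    intro s hs
    have h1 := min_le_left δ 1
    have h2 := min_le_right δ 1
    have h3 := abs_lt.1 ht
    exact ⟨⟨by linarith [hs.1], by linarith [hs.2]⟩, by linarith [hs.1], by linarith [hs.2]⟩
  have := eqOn_Ioo_of_hasDerivAt (v := fun q : ℝ × (ℝ × V) => W q.2) (L := max 0 L * 1)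
    (hWL.comp LipschitzWith.prod_snd) (a := -min δ 1) (b := min δ 1) (t₀ := 0)
    (f := fun s => Ψ s (t, R.incl (φ t x))) (g := fun s => (t + s, R.incl (φ (t + s) x)))
    ⟨by linarith [lt_min hδ one_pos], lt_min hδ one_pos⟩
    (fun s hs => hΨd s (hsub s hs).1 _) (fun s hs => ?_) (by simp [hΨ0]) (abs_lt.1 hu)
  · exact congrArg Prod.snd this
  · have h1 : HasDerivAt (fun s => R.incl (φ (t + s) x))
        (gradV R Ω (fun z => K (t + s, z)) (φ (t + s) x)) s :=
      (h.hasDerivAt x (t + s)).comp_const_add t s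
    rw [← hvK (t + s) (hsub s hs).2] at h1
    exact ((hasDerivAt_id s).const_add t).prodMk h1

/-- The flow is jointly smooth. -/
theorem IsSmoothFlow.contMDiff (h : IsSmoothFlow R Ω K φ) :
    ContMDiff (𝓘(ℝ, ℝ).prod (𝓡 (2 * n))) (𝓡 (2 * n)) ∞ fun p : ℝ × M => φ p.1 p.2 := by
  rintro ⟨t₀, x₀⟩
  -- Near time `t₀` the flow is `φ t₀`, which is smooth, followed by the propagator from `t₀` to `t`
  -- and the retraction.
  obtain ⟨δ, hδ, Z, hZ, hZφ⟩ := h.exists_propagator (|t₀| + 1)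
  have hin : ContMDiff (𝓘(ℝ, ℝ).prod (𝓡 (2 * n))) 𝓘(ℝ, ℝ × (ℝ × V)) ∞
      fun p : ℝ × M => (p.1 - t₀, (t₀, R.incl (φ t₀ p.2))) := by
    refine ContMDiff.prodMk_space ?_ (ContMDiff.prodMk_space contMDiff_const ?_)
    · have h1 : ContDiff ℝ ∞ fun t : ℝ => t - t₀ := contDiff_id.sub contDiff_const
      exact h1.contMDiff.comp contMDiff_fst
    · exact R.contMDiff_incl.comp ((φ t₀).contMDiff.comp contMDiff_snd)
  have hmem : Ioo (-δ) δ ×ˢ (univ : Set (ℝ × V)) ∈ 𝓝 (t₀ - t₀, (t₀, R.incl (φ t₀ x₀))) :=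
    (isOpen_Ioo.prod isOpen_univ).mem_nhds ⟨by simp [hδ], mem_univ _⟩
  have h2 := (hZ.contDiffAt hmem).contMDiffAt.comp (t₀, x₀) (hin (t₀, x₀))
  have hval : Z (t₀ - t₀) (t₀, R.incl (φ t₀ x₀)) = R.incl (φ t₀ x₀) := by
    rw [hZφ t₀ (t₀ - t₀) x₀ (by linarith) (by simpa using hδ)]
    simp
  have h3 : ContMDiffAt 𝓘(ℝ, V) (𝓡 (2 * n)) ∞ R.retr
      (Z (t₀ - t₀) (t₀, R.incl (φ t₀ x₀))) := by
    rw [hval]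
    exact R.contMDiffOn_retr.contMDiffAt (R.isOpen_dom.mem_nhds (R.incl_mem _))
  refine (h3.comp (t₀, x₀) h2).congr_of_eventuallyEq ?_
  have hev : ∀ᶠ p : ℝ × M in 𝓝 (t₀, x₀), |p.1 - t₀| < δ := by
    have : Tendsto (fun p : ℝ × M => |p.1 - t₀|) (𝓝 (t₀, x₀)) (𝓝 0) := by
      have hc : Continuous fun p : ℝ × M => |p.1 - t₀| := by fun_prop
      simpa using hc.tendsto (t₀, x₀)
    exact this.eventually (gt_mem_nhds hδ)
  filter_upwards [hev] with p hp
  simp only [Function.comp]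
  rw [hZφ t₀ (p.1 - t₀) p.2 (by linarith) hp, R.retr_incl, add_sub_cancel]

/-- The inverse flow is jointly smooth. -/
theorem IsSmoothFlow.contMDiff_symm (h : IsSmoothFlow R Ω K φ) :
    ContMDiff (𝓘(ℝ, ℝ).prod (𝓡 (2 * n))) (𝓡 (2 * n)) ∞ fun p : ℝ × M => (φ p.1).symm p.2 := by
  rintro ⟨t₀, x₀⟩
  obtain ⟨δ, hδ, Z, hZ, hZφ⟩ := h.exists_propagator (|t₀| + 1)
  have hin : ContMDiff (𝓘(ℝ, ℝ).prod (𝓡 (2 * n))) 𝓘(ℝ, ℝ × (ℝ × V)) ∞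
      fun p : ℝ × M => (t₀ - p.1, (p.1, R.incl p.2)) := by
    refine ContMDiff.prodMk_space ?_ (ContMDiff.prodMk_space contMDiff_fst ?_)
    · have h1 : ContDiff ℝ ∞ fun t : ℝ => t₀ - t := contDiff_const.sub contDiff_id
      exact h1.contMDiff.comp contMDiff_fst
    · exact R.contMDiff_incl.comp contMDiff_snd
  have hmem : Ioo (-δ) δ ×ˢ (univ : Set (ℝ × V)) ∈ 𝓝 (t₀ - t₀, (t₀, R.incl x₀)) :=
    (isOpen_Ioo.prod isOpen_univ).mem_nhds ⟨by simp [hδ], mem_univ _⟩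
  have h2 := (hZ.contDiffAt hmem).contMDiffAt.comp (t₀, x₀) (hin (t₀, x₀))
  -- The inverse of `φ t` is the propagator from `t` to `t₀` followed by the inverse of `φ t₀`. Here
  -- the starting time varies, so a duration `δ` uniform in the starting time is essential.
  have hstep : ∀ t z, |t| < |t₀| + 1 → |t₀ - t| < δ →
      Z (t₀ - t) (t, R.incl z) = R.incl (φ t₀ ((φ t).symm z)) := by
    intro t z ht hu
    have := hZφ t (t₀ - t) ((φ t).symm z) ht hu
    rwa [(φ t).apply_symm_apply, add_sub_cancel] at this
  have h3 : ContMDiffAt 𝓘(ℝ, V) (𝓡 (2 * n)) ∞ R.retr (Z (t₀ - t₀) (t₀, R.incl x₀)) := by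
    rw [hstep t₀ x₀ (by linarith) (by simpa using hδ)]
    exact R.contMDiffOn_retr.contMDiffAt (R.isOpen_dom.mem_nhds (R.incl_mem _))
  refine ((φ t₀).symm.contMDiff.contMDiffAt.comp (t₀, x₀)
    (h3.comp (t₀, x₀) h2)).congr_of_eventuallyEq ?_
  have hev : ∀ᶠ p : ℝ × M in 𝓝 (t₀, x₀), |t₀ - p.1| < min δ 1 := by
    have : Tendsto (fun p : ℝ × M => |t₀ - p.1|) (𝓝 (t₀, x₀)) (𝓝 0) := by
      have hc : Continuous fun p : ℝ × M => |t₀ - p.1| := by fun_prop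
      simpa using hc.tendsto (t₀, x₀)
    exact this.eventually (gt_mem_nhds (lt_min hδ one_pos))
  filter_upwards [hev] with p hp
  have hp1 : |p.1| < |t₀| + 1 := by
    have h4 := abs_sub_abs_le_abs_sub p.1 t₀
    have h5 := hp.trans_le (min_le_right _ _)
    rw [abs_sub_comm] at h5
    linarith
  simp only [Function.comp]
  rw [hstep p.1 p.2 hp1 (hp.trans_le (min_le_left _ _)), R.retr_incl, (φ t₀).symm_apply_apply]

/-- Orbits of the Hamiltonian field over `[0, 1]` are given by the flow. -/
theorem IsSmoothFlow.eqOn_Icc (h : IsSmoothFlow R Ω K φ) {γ : ℝ → V} {x : M} (h0 : γ 0 = R.incl x)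
    {y : ℝ → M} (hy : ∀ t ∈ Icc (0 : ℝ) 1, γ t = R.incl (y t))
    (hγ : ∀ t ∈ Icc (0 : ℝ) 1, HasDerivWithinAt γ (gradV R Ω (fun z => K (t, z)) (y t))
      (Icc 0 1) t) : ∀ t ∈ Icc (0 : ℝ) 1, y t = φ t x := by
  obtain ⟨v, hv, hvc, hvK⟩ := exists_contDiff_extend_gradV R Ω h.smooth 1
  obtain ⟨L, hL⟩ := hv.lipschitzWith_of_hasCompactSupport hvc (by simp)
  have hI : ∀ t ∈ Icc (0 : ℝ) 1, t ∈ Icc (-1 : ℝ) 1 := fun t ht => ⟨by linarith [ht.1], ht.2⟩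
  have hIci : ∀ {f : ℝ → V} {f' : V} {t : ℝ}, t ∈ Ico (0 : ℝ) 1 →
      HasDerivWithinAt f f' (Icc 0 1) t → HasDerivWithinAt f f' (Ici t) t := by
    intro f f' t ht hf
    refine hf.mono_of_mem_nhdsWithin ?_
    exact mem_of_superset (Icc_mem_nhdsGE ht.2) (Icc_subset_Icc ht.1 le_rfl)
  have key := ODE_solution_unique_of_mem_Icc_right (v := fun t y => v (t, y)) (K := L)
    (s := fun _ => univ) (f := γ) (g := fun t => R.incl (φ t x)) (a := 0) (b := 1)
    (fun t _ => (LipschitzWith.of_dist_le_mul fun x y => by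
      simpa [Prod.dist_eq] using hL.dist_le_mul (t, x) (t, y)).lipschitzOnWith)
    (fun t ht => (hγ t ht).continuousWithinAt)
    (fun t ht => by
      have := hγ t ⟨ht.1, ht.2.le⟩
      rw [← hvK t (hI t ⟨ht.1, ht.2.le⟩), ← hy t ⟨ht.1, ht.2.le⟩] at this
      exact hIci ht this) (fun _ _ => mem_univ _)
    (fun t _ => (h.hasDerivAt x t).continuousAt.continuousWithinAt)
    (fun t ht => by
      have := h.hasDerivAt x t
      rw [← hvK t (hI t ⟨ht.1, ht.2.le⟩)] at this
      exact this.hasDerivWithinAt) (fun _ _ => mem_univ _) (by rw [h0, h.zero])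
  intro t ht
  exact R.incl_injective ((hy t ht).symm.trans (key ht))

end Flows

end SymplecticClosing

namespace SymplecticClosing

/-! ### Symplecticity of Hamiltonian flows and their composition -/

section Symplecticity

variable {n : ℕ} {M : Type*} [TopologicalSpace M] [ChartedSpace (EuclideanSpace ℝ (Fin (2 * n))) M]
variable {V : Type} [NormedAddCommGroup V] [InnerProductSpace ℝ V]

/-- The derivative of a self-map of the manifold, on the model space. -/
noncomputable def selfD (f : M → M) (x : M) :
    EuclideanSpace ℝ (Fin (2 * n)) →L[ℝ] EuclideanSpace ℝ (Fin (2 * n)) :=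
  mfderiv (𝓡 (2 * n)) (𝓡 (2 * n)) f x

/-- A symplectic diffeomorphism. -/
def IsSymplectic (Ω : SymplecticForm n M) (ψ : M ≃ₘ⟮𝓡 (2 * n), 𝓡 (2 * n)⟯ M) : Prop :=
  ∀ x ξ η, toBilin _ (Ω.alt (ψ x)) (selfD ψ x ξ) (selfD ψ x η) = toBilin _ (Ω.alt x) ξ η

/-- Hamiltonian vectors are natural under symplectic maps: the pushforward satisfies the defining
equation for the transported function. -/
theorem symGrad_comp_symm {Ω : SymplecticForm n M} {ψ : M ≃ₘ⟮𝓡 (2 * n), 𝓡 (2 * n)⟯ M}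
    (hψ : IsSymplectic Ω ψ) {f : M → ℝ} {x : M} (hf : MDifferentiableAt (𝓡 (2 * n)) 𝓘(ℝ, ℝ) f x) :
    symGrad Ω (fun z => f (ψ.symm z)) (ψ x) = selfD ψ x (symGrad Ω f x) := by
  refine (eq_symGrad Ω _ _ _ fun w => ?_).symm
  have hd : ∀ (χ : M ≃ₘ⟮𝓡 (2 * n), 𝓡 (2 * n)⟯ M) z,
      HasMFDerivAt (𝓡 (2 * n)) (𝓡 (2 * n)) χ z (selfD χ z) := fun χ z =>
    ((χ.contMDiff z).mdifferentiableAt (by simp)).hasMFDerivAt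
  have hw : selfD ψ x (selfD ψ.symm (ψ x) w) = w := by
    have h1 := HasMFDerivAt.comp (g := ψ) (f := ψ.symm) (ψ x) (hd ψ _) (hd ψ.symm (ψ x))
    have h2 : (ψ : M → M) ∘ ψ.symm = id := funext ψ.apply_symm_apply
    rw [h2] at h1
    have h3 := congrArg (fun A => A w) (h1.mfderiv.symm.trans mfderiv_id)
    have h4 : selfD ψ (ψ.symm (ψ x)) (selfD ψ.symm (ψ x) w) = w := h3
    rwa [ψ.symm_apply_apply] at h4
  have hf' : HasMFDerivAt (𝓡 (2 * n)) 𝓘(ℝ, ℝ) f (ψ.symm (ψ x)) (dM f x) := by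
    rw [ψ.symm_apply_apply]
    exact hf.hasMFDerivAt
  have h5 : dM (fun z => f (ψ.symm z)) (ψ x) = (dM f x).comp (selfD ψ.symm (ψ x)) :=
    (HasMFDerivAt.comp (g := f) (f := ψ.symm) (ψ x) hf' (hd ψ.symm (ψ x))).mfderiv
  rw [h5]
  conv_lhs => rw [← hw]
  rw [hψ, toBilin_apply, alt_symGrad]
  rfl

variable [IsManifold (𝓡 (2 * n)) ∞ M] [CompactSpace M] [FiniteDimensional ℝ V]
variable {R : SmoothRetract (2 * n) M V} {Ω : SymplecticForm n M} {K L : ℝ × M → ℝ}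
  {φ ψ : ℝ → (M ≃ₘ⟮𝓡 (2 * n), 𝓡 (2 * n)⟯ M)}

/-- The flow, as a family of maps of the ambient space. -/
noncomputable def flowV (R : SmoothRetract (2 * n) M V)
    (φ : ℝ → (M ≃ₘ⟮𝓡 (2 * n), 𝓡 (2 * n)⟯ M)) (p : ℝ × V) : V :=
  R.incl (φ p.1 (R.retr p.2))

theorem IsSmoothFlow.contDiffOn_flowV (h : IsSmoothFlow R Ω K φ) :
    ContDiffOn ℝ ∞ (flowV R φ) (univ ×ˢ R.dom) := by
  rw [← contMDiffOn_iff_contDiffOn]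
  refine (R.contMDiff_incl.comp h.contMDiff).comp_contMDiffOn
    (f := fun p : ℝ × V => (p.1, R.retr p.2)) ?_
  refine ContMDiffOn.prodMk contDiff_fst.contMDiff.contMDiffOn ?_
  exact R.contMDiffOn_retr.comp contDiff_snd.contMDiff.contMDiffOn fun p hp => hp.2

omit [IsManifold (𝓡 (2 * n)) ∞ M] [CompactSpace M] [FiniteDimensional ℝ V] in
theorem SmoothRetract.isOpen_univ_prod_dom (R : SmoothRetract (2 * n) M V) :
    IsOpen ((univ : Set ℝ) ×ˢ R.dom) := isOpen_univ.prod R.isOpen_dom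

theorem IsSmoothFlow.hasFDerivAt_flowV (h : IsSmoothFlow R Ω K φ) {p : ℝ × V} (hp : p.2 ∈ R.dom) :
    HasFDerivAt (flowV R φ) (fderiv ℝ (flowV R φ) p) p :=
  ((h.contDiffOn_flowV.contDiffAt (R.isOpen_univ_prod_dom.mem_nhds
    ⟨mem_univ _, hp⟩)).differentiableAt (by simp)).hasFDerivAt

theorem IsSmoothFlow.fderiv_flowV_time (h : IsSmoothFlow R Ω K φ) {p : ℝ × V} (hp : p.2 ∈ R.dom) :
    fderiv ℝ (flowV R φ) p (1, 0) =
      gradV R Ω (fun z => K (p.1, z)) (φ p.1 (R.retr p.2)) := by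
  have h1 : HasDerivAt (fun s : ℝ => (s, p.2)) ((1 : ℝ), (0 : V)) p.1 :=
    (hasDerivAt_id p.1).prodMk (hasDerivAt_const p.1 p.2)
  have h2 := HasFDerivAt.comp_hasDerivAt (f := fun s : ℝ => (s, p.2)) (l := flowV R φ) p.1
    (h.hasFDerivAt_flowV hp) h1
  exact h2.unique (h.hasDerivAt (R.retr p.2) p.1)

theorem IsSmoothFlow.fderiv_flowV_space (h : IsSmoothFlow R Ω K φ) {p : ℝ × V} (hp : p.2 ∈ R.dom)
    (b : V) : fderiv ℝ (flowV R φ) p (0, b) =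
      R.inclD (φ p.1 (R.retr p.2)) (selfD (φ p.1) (R.retr p.2) (R.retrD p.2 b)) := by
  have h1 := HasFDerivAt.comp (g := flowV R φ) (f := fun y : V => (p.1, y)) p.2
    (h.hasFDerivAt_flowV hp) (hasFDerivAt_prodMk_right p.1 p.2)
  have h2 : HasMFDerivAt (𝓡 (2 * n)) (𝓡 (2 * n)) (φ p.1) (R.retr p.2)
      (selfD (φ p.1) (R.retr p.2)) :=
    (((φ p.1).contMDiff _).mdifferentiableAt (by simp)).hasMFDerivAt
  have h3 := HasMFDerivAt.comp (g := fun x => R.incl (φ p.1 x)) (f := R.retr) p.2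
    (HasMFDerivAt.comp (g := R.incl) (f := φ p.1) (R.retr p.2) (R.hasMFDerivAt_incl _) h2)
    (R.hasMFDerivAt_retr hp)
  have h4 : HasFDerivAt (fun y => R.incl (φ p.1 (R.retr y)))
    (((R.inclD (φ p.1 (R.retr p.2))).comp (selfD (φ p.1) (R.retr p.2))).comp (R.retrD p.2)) p.2 :=
    hasMFDerivAt_iff_hasFDerivAt.1 h3
  exact congrArg (fun A : V →L[ℝ] V => A b) (h1.unique h4)

/-- Cartan's formula in coordinates. The pullback of the form under `(t, y) ↦ flowV R φ (t, y)` is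
closed, and its contraction with the time direction is, on space vectors, minus the differential of
`κ`. In the cyclic identity for the time direction and two space directions, the terms with `κ`
cancel by the symmetry of second derivatives, and only the time derivative is left. -/
theorem IsSmoothFlow.hasDerivAt_pullbackForm (h : IsSmoothFlow R Ω K φ) {y : V} (hy : y ∈ R.dom)
    (b c : V) (t : ℝ) :
    HasDerivAt (fun t => pullbackForm (formV R Ω) (flowV R φ) (t, y) (0, b) (0, c)) 0 t := by
  have hΩ := isClosedForm_formV R Ω
  have hUo := R.isOpen_univ_prod_dom
  have hYs := h.contDiffOn_flowV
  have hmap : MapsTo (flowV R φ) (univ ×ˢ R.dom) R.dom := fun q _ => R.incl_mem _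
  have hp : ((t, y) : ℝ × V) ∈ (univ : Set ℝ) ×ˢ R.dom := ⟨mem_univ _, hy⟩
  let κ : ℝ × V → ℝ := fun q => K (q.1, R.retr (flowV R φ q))
  have hκ : ContDiffOn ℝ ∞ κ (univ ×ˢ R.dom) := by
    rw [← contMDiffOn_iff_contDiffOn]
    refine h.smooth.comp_contMDiffOn (f := fun q : ℝ × V => (q.1, R.retr (flowV R φ q))) ?_
    refine ContMDiffOn.prodMk contDiff_fst.contMDiff.contMDiffOn ?_
    exact R.contMDiffOn_retr.comp hYs.contMDiffOn hmap
  have hκd : ∀ q ∈ (univ : Set ℝ) ×ˢ R.dom, ∀ b, fderiv ℝ κ q (0, b) =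
      -formV R Ω (flowV R φ q) (fderiv ℝ (flowV R φ) q (1, 0))
        (fderiv ℝ (flowV R φ) q (0, b)) := by
    intro q hq b
    rw [h.fderiv_flowV_time hq.2]
    conv_rhs => rw [flowV, formV_gradV, neg_neg]
    have h0 := HasFDerivAt.comp (g := κ) (f := fun z : V => (q.1, z)) q.2
      ((hκ.contDiffAt (hUo.mem_nhds hq)).differentiableAt (by simp)).hasFDerivAt
      (hasFDerivAt_prodMk_right q.1 q.2)
    have hK : HasFDerivAt (fun z : V => K (q.1, R.retr z))
        (fderiv ℝ (fun z : V => K (q.1, R.retr z)) (flowV R φ q)) (flowV R φ q) := by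
      have h3 : ContMDiffOn 𝓘(ℝ, V) 𝓘(ℝ, ℝ) ∞ (fun z : V => K (q.1, R.retr z)) R.dom :=
        (contMDiff_slice h.smooth q.1).comp_contMDiffOn R.contMDiffOn_retr
      exact ((h3.contDiffOn.contDiffAt (R.isOpen_dom.mem_nhds (hmap hq))).differentiableAt
        (by simp)).hasFDerivAt
    have h1 := HasFDerivAt.comp (g := flowV R φ) (f := fun z : V => (q.1, z)) q.2
      (h.hasFDerivAt_flowV hq.2) (hasFDerivAt_prodMk_right q.1 q.2)
    have h2 := HasFDerivAt.comp (g := fun z : V => K (q.1, R.retr z))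
      (f := fun z : V => flowV R φ (q.1, z)) q.2 hK h1
    have h4 := congrArg (fun A : V →L[ℝ] ℝ => A b) (h0.unique h2)
    have h5 : fderiv ℝ κ q (0, b) = fderiv ℝ (fun z : V => K (q.1, R.retr z)) (flowV R φ q)
      (fderiv ℝ (flowV R φ) q (0, b)) := h4
    rw [h5, fderiv_comp_retr R (hmap hq)
      ((contMDiff_slice h.smooth q.1 _).mdifferentiableAt (by simp))]
    rw [flowV, R.retr_incl]
  have hcyc := hΩ.cyclic_sum_fderiv_pullbackForm R.isOpen_dom
    (hYs.contDiffAt (hUo.mem_nhds hp)) (hmap hp) ((1 : ℝ), (0 : V)) (0, b) (0, c)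
  have hbc : (fun q => pullbackForm (formV R Ω) (flowV R φ) q (0, c) (1, 0)) =ᶠ[𝓝 (t, y)]
      fun q => fderiv ℝ κ q (0, c) := by
    filter_upwards [hUo.mem_nhds hp] with q hq
    rw [hκd q hq, pullbackForm_apply, hΩ.skew _ (hmap hq)]
  have hab : (fun q => pullbackForm (formV R Ω) (flowV R φ) q (1, 0) (0, b)) =ᶠ[𝓝 (t, y)]
      fun q => -fderiv ℝ κ q (0, b) := by
    filter_upwards [hUo.mem_nhds hp] with q hq
    rw [hκd q hq, pullbackForm_apply, neg_neg]
  have hD2 : DifferentiableAt ℝ (fderiv ℝ κ) (t, y) :=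
    ((hκ.contDiffAt (hUo.mem_nhds hp)).fderiv_right (m := ∞) (by simp)).differentiableAt (by simp)
  have hsymm : fderiv ℝ (fderiv ℝ κ) (t, y) (0, b) (0, c) =
      fderiv ℝ (fderiv ℝ κ) (t, y) (0, c) (0, b) :=
    ((hκ.contDiffAt (hUo.mem_nhds hp)).isSymmSndFDerivAt
      (by rw [minSmoothness_of_isRCLikeNormedField]; exact WithTop.coe_le_coe.2 (le_top : (2 : ℕ∞) ≤ ⊤))) _ _
  have happ : ∀ w : ℝ × V, fderiv ℝ (fun q => fderiv ℝ κ q w) (t, y) =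
      (ContinuousLinearMap.apply ℝ ℝ w).comp (fderiv ℝ (fderiv ℝ κ) (t, y)) := fun w =>
    (HasFDerivAt.comp (g := ContinuousLinearMap.apply ℝ ℝ w) (t, y)
      (ContinuousLinearMap.hasFDerivAt _) hD2.hasFDerivAt).fderiv
  rw [hbc.fderiv_eq, hab.fderiv_eq, fderiv_fun_neg, happ, happ] at hcyc
  have hcyc' : fderiv ℝ (fun q => pullbackForm (formV R Ω) (flowV R φ) q (0, b) (0, c)) (t, y)
      (1, 0) = 0 := by
    have e1 : ((ContinuousLinearMap.apply ℝ ℝ ((0 : ℝ), c)).comp (fderiv ℝ (fderiv ℝ κ) (t, y)))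
      (0, b) = fderiv ℝ (fderiv ℝ κ) (t, y) (0, b) (0, c) := rfl
    have e2 : (-(ContinuousLinearMap.apply ℝ ℝ ((0 : ℝ), b)).comp (fderiv ℝ (fderiv ℝ κ) (t, y)))
      (0, c) = -fderiv ℝ (fderiv ℝ κ) (t, y) (0, c) (0, b) := rfl
    rw [e1, e2, hsymm] at hcyc
    linarith
  have hdiff : HasFDerivAt (fun q => pullbackForm (formV R Ω) (flowV R φ) q (0, b) (0, c)) _ (t, y) :=
    (((contDiffOn_pullbackForm_apply hΩ.contDiffOn hUo hYs hmap (0, b) (0, c)).contDiffAt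
      (hUo.mem_nhds hp)).differentiableAt (by simp)).hasFDerivAt
  have h1 : HasDerivAt (fun s : ℝ => (s, y)) ((1 : ℝ), (0 : V)) t :=
    (hasDerivAt_id t).prodMk (hasDerivAt_const t y)
  have h2 := HasFDerivAt.comp_hasDerivAt (f := fun s : ℝ => (s, y)) t hdiff h1
  rwa [hcyc'] at h2

/-- Hamiltonian flows consist of symplectic diffeomorphisms. -/
theorem IsSmoothFlow.isSymplectic (h : IsSmoothFlow R Ω K φ) (t : ℝ) : IsSymplectic Ω (φ t) := by
  intro x ξ η
  have hx := R.incl_mem x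
  have hc : ∀ s, pullbackForm (formV R Ω) (flowV R φ) (s, R.incl x) (0, R.inclD x ξ)
      (0, R.inclD x η) = toBilin _ (Ω.alt (φ s x)) (selfD (φ s) x ξ) (selfD (φ s) x η) := by
    intro s
    have hD : ∀ ζ, fderiv ℝ (flowV R φ) (s, R.incl x) (0, R.inclD x ζ) =
        R.inclD (φ s x) (selfD (φ s) x ζ) := by
      intro ζ
      rw [h.fderiv_flowV_space (p := (s, R.incl x)) hx]
      simp only
      rw [R.retrD_inclD, R.retr_incl]
    have hY : flowV R φ (s, R.incl x) = R.incl (φ s x) := by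
      rw [flowV, R.retr_incl]
    rw [pullbackForm_apply, hD, hD, hY, formV_inclD, toBilin_apply]
  have h0 : ∀ ζ : EuclideanSpace ℝ (Fin (2 * n)), selfD (φ 0) x ζ = ζ := by
    intro ζ
    have h1 : (φ 0 : M → M) = id := funext h.zero
    have h2 : selfD (n := n) (id : M → M) x = ContinuousLinearMap.id ℝ _ := mfderiv_id (I := 𝓡 (2 * n))
    rw [h1, h2]
    rfl
  have hconst := is_const_of_deriv_eq_zero
    (fun s => (h.hasDerivAt_pullbackForm hx (R.inclD x ξ) (R.inclD x η) s).differentiableAt)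
    (fun s => (h.hasDerivAt_pullbackForm hx (R.inclD x ξ) (R.inclD x η) s).deriv) t 0
  rw [hc, hc, h0, h0, h.zero] at hconst
  exact hconst

theorem gradV_comp_symm (h : IsSmoothFlow R Ω K φ) {f : M → ℝ} {x : M} (t : ℝ)
    (hf : MDifferentiableAt (𝓡 (2 * n)) 𝓘(ℝ, ℝ) f x) :
    gradV R Ω (fun z => f ((φ t).symm z)) (φ t x) =
      fderiv ℝ (flowV R φ) (t, R.incl x) (0, gradV R Ω f x) := by
  rw [gradV, symGrad_comp_symm (h.isSymplectic t) hf,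
    h.fderiv_flowV_space (p := (t, R.incl x)) (R.incl_mem x)]
  simp only
  rw [gradV, R.retrD_inclD, R.retr_incl]

/-- The Hamiltonian `K # L`, where `φ` is the flow of `K`. -/
noncomputable def sharp (K : ℝ × M → ℝ) (φ : ℝ → (M ≃ₘ⟮𝓡 (2 * n), 𝓡 (2 * n)⟯ M)) (L : ℝ × M → ℝ) :
    ℝ × M → ℝ := fun p => K p + L (p.1, (φ p.1).symm p.2)

/-- The composition of Hamiltonian flows is the Hamiltonian flow of `K # L`. -/
theorem IsSmoothFlow.sharp (h : IsSmoothFlow R Ω K φ) (hL : IsSmoothFlow R Ω L ψ) :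
    IsSmoothFlow R Ω (sharp K φ L) fun t => (ψ t).trans (φ t) where
  smooth := by
    refine ContMDiff.add h.smooth ?_
    exact hL.smooth.comp (contMDiff_fst.prodMk h.contMDiff_symm)
  zero := fun x => by
    rw [Diffeomorph.coe_trans, Function.comp, hL.zero, h.zero]
  hasDerivAt := fun x t => by
    have h1 : HasDerivAt (fun s : ℝ => (s, R.incl (ψ s x)))
        ((1 : ℝ), gradV R Ω (fun z => L (t, z)) (ψ t x)) t :=
      (hasDerivAt_id t).prodMk (hL.hasDerivAt x t)
    have h2 := HasFDerivAt.comp_hasDerivAt (f := fun s : ℝ => (s, R.incl (ψ s x)))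
      (l := flowV R φ) t (h.hasFDerivAt_flowV (p := (t, R.incl (ψ t x))) (R.incl_mem _)) h1
    -- The velocity splits into the motion of `φ`, which is the field of `K`, and the pushforward
    -- under `φ t` of the field of `L`, which by symplecticity is the field of `L ∘ (φ t)⁻¹`.
    have h3 : ((1 : ℝ), gradV R Ω (fun z => L (t, z)) (ψ t x)) =
        (1, 0) + (0, gradV R Ω (fun z => L (t, z)) (ψ t x)) := by simp
    have hLd : MDifferentiableAt (𝓡 (2 * n)) 𝓘(ℝ, ℝ) (fun z => L (t, z)) (ψ t x) :=
      ((contMDiff_slice hL.smooth t) _).mdifferentiableAt (by simp)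
    rw [h3, map_add, h.fderiv_flowV_time (p := (t, R.incl (ψ t x))) (R.incl_mem _),
      ← gradV_comp_symm h t hLd] at h2
    simp only [R.retr_incl] at h2
    have h4 : MDifferentiableAt (𝓡 (2 * n)) 𝓘(ℝ, ℝ) (fun z => L (t, (φ t).symm z))
        (φ t (ψ t x)) :=
      (((contMDiff_slice hL.smooth t).comp (φ t).symm.contMDiff) _).mdifferentiableAt (by simp)
    have h5 : MDifferentiableAt (𝓡 (2 * n)) 𝓘(ℝ, ℝ) (fun z => K (t, z)) (φ t (ψ t x)) :=
      ((contMDiff_slice h.smooth t) _).mdifferentiableAt (by simp)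
    rw [← gradV_add R Ω h5 h4] at h2
    refine h2.congr_of_eventuallyEq (Eventually.of_forall fun s => ?_)
    simp only [Function.comp, flowV, R.retr_incl, Diffeomorph.coe_trans]

end Symplecticity

end SymplecticClosing

namespace SymplecticClosing

/-! ### Orbits, powers, and flows of autonomous Hamiltonians -/

section Orbits

variable {n : ℕ} {M : Type*} [TopologicalSpace M] [ChartedSpace (EuclideanSpace ℝ (Fin (2 * n))) M]
variable {V : Type} [NormedAddCommGroup V] [InnerProductSpace ℝ V]

/-- The restriction of a smooth function on `ℝ × M` to `[0, 1] × M`. -/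
def toHam (K : ℝ × M → ℝ) (hK : ContMDiff (𝓘(ℝ, ℝ).prod (𝓡 (2 * n))) 𝓘(ℝ, ℝ) ∞ K) :
    Hamiltonian n M :=
  ⟨fun p => K (p.1, p.2),
    hK.comp ((contMDiff_subtypeVal_Icc.comp contMDiff_fst).prodMk contMDiff_snd)⟩

theorem toHam_apply {K : ℝ × M → ℝ} (hK : ContMDiff (𝓘(ℝ, ℝ).prod (𝓡 (2 * n))) 𝓘(ℝ, ℝ) ∞ K)
    (t : unitInterval) (x : M) : toHam K hK (t, x) = K (t, x) := rfl

variable (R : SmoothRetract (2 * n) M V) (Ω : SymplecticForm n M)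

/-- The intrinsic equation and the one in the ambient space are translated into each other by the
chain rule for `incl` and for `retr`, without continuity assumptions beyond differentiability. -/
theorem isHamOrbit_iff {H : Hamiltonian n M} {γ : ℝ → M} :
    IsHamOrbit Ω H γ ↔ ∀ t : unitInterval, HasDerivWithinAt (fun s => R.incl (γ s))
      (gradV R Ω (fun z => H (t, z)) (γ t)) (Icc 0 1) t := by
  refine forall_congr' fun t => ⟨fun h => ?_, fun h => ?_⟩
  · have h1 := HasMFDerivAt.comp_hasMFDerivWithinAt (g := R.incl) (t : ℝ) (R.hasMFDerivAt_incl _) h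
    have h2 : HasFDerivWithinAt (fun s => R.incl (γ s)) ((R.inclD (γ t)).comp
        (ContinuousLinearMap.toSpanSingleton ℝ (symGrad Ω (fun z => H (t, z)) (γ t))))
        (Icc 0 1) (t : ℝ) := hasMFDerivWithinAt_iff_hasFDerivWithinAt.1 h1
    have h2 := h2.hasDerivWithinAt
    have h3 : R.inclD (γ t) ((1 : ℝ) • symGrad Ω (fun z => H (t, z)) (γ t)) =
      gradV R Ω (fun z => H (t, z)) (γ t) := by rw [one_smul]; rfl
    rw [← h3]
    exact h2
  · have h1 : HasMFDerivWithinAt 𝓘(ℝ, ℝ) 𝓘(ℝ, V) (fun s => R.incl (γ s)) (Icc 0 1) (t : ℝ)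
        (ContinuousLinearMap.toSpanSingleton ℝ (gradV R Ω (fun z => H (t, z)) (γ t)) : ℝ →L[ℝ] V) :=
      hasMFDerivWithinAt_iff_hasFDerivWithinAt.2 h.hasFDerivWithinAt
    have h2 := HasMFDerivAt.comp_hasMFDerivWithinAt (g := R.retr) (t : ℝ)
      (R.hasMFDerivAt_retr (R.incl_mem _)) h1
    have h3 : R.retr ∘ (fun s => R.incl (γ s)) = γ := funext fun s => R.retr_incl _
    rw [h3] at h2
    refine h2.congr_mfderiv ?_
    refine ContinuousLinearMap.ext_ring ?_
    have h4 : R.retrD (R.incl (γ t)) ((1 : ℝ) • R.inclD (γ t) (symGrad Ω (fun z => H (t, z)) (γ t)))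
        = (1 : ℝ) • symGrad Ω (fun z => H (t, z)) (γ t) := by
      rw [one_smul, one_smul, R.retrD_inclD]
    exact h4

variable [IsManifold (𝓡 (2 * n)) ∞ M] [CompactSpace M] [FiniteDimensional ℝ V]
variable {R Ω} {K L : ℝ × M → ℝ} {φ ψ : ℝ → (M ≃ₘ⟮𝓡 (2 * n), 𝓡 (2 * n)⟯ M)}

theorem IsSmoothFlow.orbit_eq (h : IsSmoothFlow R Ω K φ) {γ : ℝ → M}
    (hγ : IsHamOrbit Ω (toHam K h.smooth) γ) : ∀ t ∈ Icc (0 : ℝ) 1, γ t = φ t (γ 0) :=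
  h.eqOn_Icc (γ := fun s => R.incl (γ s)) rfl (fun _ _ => rfl) fun t ht =>
    (isHamOrbit_iff R Ω).1 hγ ⟨t, ht⟩

omit [IsManifold (𝓡 (2 * n)) ∞ M] [CompactSpace M] [FiniteDimensional ℝ V] in
theorem IsSmoothFlow.isHamOrbit (h : IsSmoothFlow R Ω K φ) {γ : ℝ → M} {x : M}
    (hγ : ∀ t ∈ Icc (0 : ℝ) 1, γ t = φ t x) : IsHamOrbit Ω (toHam K h.smooth) γ := by
  refine (isHamOrbit_iff R Ω).2 fun t => ?_
  rw [hγ t t.2]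
  exact (h.hasDerivAt x t).hasDerivWithinAt.congr (fun s hs => by rw [hγ s hs])
    (by rw [hγ t t.2])

omit [IsManifold (𝓡 (2 * n)) ∞ M] [CompactSpace M] [FiniteDimensional ℝ V] in
theorem IsSmoothFlow.isHamFlow (h : IsSmoothFlow R Ω K φ) :
    IsHamFlow Ω (toHam K h.smooth) fun t => φ t :=
  ⟨h.zero, fun _ => h.isHamOrbit fun t ht => by rw [projIcc_of_mem _ ht]⟩

/-- Uniqueness of solutions: the flow in the existential definition of a composition may be taken to
be `φ`. -/
theorem IsSmoothFlow.eq_of_isHamFlow (h : IsSmoothFlow R Ω K φ)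
    {ψ : unitInterval → (M ≃ₘ⟮𝓡 (2 * n), 𝓡 (2 * n)⟯ M)}
    (hψ : IsHamFlow Ω (toHam K h.smooth) ψ) (t : unitInterval) : ψ t = φ t := by
  refine Diffeomorph.ext fun x => ?_
  have h1 := h.orbit_eq (hψ.2 x) t t.2
  simp only [projIcc_left] at h1
  rw [projIcc_of_mem _ t.2] at h1
  exact h1.trans (by rw [show (⟨0, left_mem_Icc.2 zero_le_one⟩ : unitInterval) = 0 from rfl, hψ.1])

theorem IsSmoothFlow.isComposition_iff (h : IsSmoothFlow R Ω K φ) {G P : Hamiltonian n M} :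
    IsComposition Ω (toHam K h.smooth) G P ↔
      ∀ (t : unitInterval) (x : M), P (t, x) = K (t, x) + G (t, (φ t).symm x) := by
  refine ⟨?_, fun hP => ⟨_, h.isHamFlow, hP⟩⟩
  rintro ⟨ψ, hψ, hP⟩ t x
  rw [hP, h.eq_of_isHamFlow hψ]
  rfl

/-- The `m`-fold composition `K # ⋯ # K`, where `φ` is the flow of `K`. -/
noncomputable def hamPow (K : ℝ × M → ℝ) (φ : ℝ → (M ≃ₘ⟮𝓡 (2 * n), 𝓡 (2 * n)⟯ M)) :
    ℕ → ℝ × M → ℝ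
  | 0 => fun _ => 0
  | m + 1 => sharp K φ (hamPow K φ m)

/-- The iterates of an isotopy. -/
noncomputable def flowPow (φ : ℝ → (M ≃ₘ⟮𝓡 (2 * n), 𝓡 (2 * n)⟯ M)) :
    ℕ → ℝ → (M ≃ₘ⟮𝓡 (2 * n), 𝓡 (2 * n)⟯ M)
  | 0 => fun _ => Diffeomorph.refl _ _ _
  | m + 1 => fun t => (flowPow φ m t).trans (φ t)

omit [IsManifold (𝓡 (2 * n)) ∞ M] [CompactSpace M] in
theorem flowPow_apply (φ : ℝ → (M ≃ₘ⟮𝓡 (2 * n), 𝓡 (2 * n)⟯ M)) (m : ℕ) (t : ℝ) (x : M) :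
    flowPow φ m t x = (φ t)^[m] x := by
  induction m with
  | zero => rfl
  | succ m ih =>
    rw [Function.iterate_succ_apply', ← ih]
    rfl

theorem IsSmoothFlow.pow (h : IsSmoothFlow R Ω K φ) (m : ℕ) :
    IsSmoothFlow R Ω (hamPow K φ m) (flowPow φ m) := by
  induction m with
  | zero =>
    refine ⟨contMDiff_const, fun x => rfl, fun x t => ?_⟩
    have h0 : gradV R Ω (fun z => hamPow K φ 0 (t, z)) (flowPow φ 0 t x) = 0 :=
      gradV_eq_zero_of_eventuallyEq R Ω (c := 0) (Eventually.of_forall fun _ => rfl)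
    rw [h0]
    exact hasDerivAt_const t (R.incl x)
  | succ m ih => exact h.sharp ih

/-- Powers exist, are unique, and have an explicit smooth representative, so the relation `IsPower`
can be replaced by a function. -/
theorem IsSmoothFlow.isPower_iff (h : IsSmoothFlow R Ω K φ) (m : ℕ) {P : Hamiltonian n M} :
    IsPower Ω (toHam K h.smooth) m P ↔ P = toHam (hamPow K φ m) (h.pow m).smooth := by
  induction m generalizing P with
  | zero => exact Iff.rfl
  | succ m ih =>
    constructor
    · rintro ⟨Q, hQ, hP⟩
      rw [ih.1 hQ] at hP
      ext ⟨t, x⟩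
      exact (h.isComposition_iff.1 hP) t x
    · rintro rfl
      exact ⟨_, ih.2 rfl, h.isComposition_iff.2 fun t x => rfl⟩

omit [IsManifold (𝓡 (2 * n)) ∞ M] [CompactSpace M] in
/-- The value of `K # ⋯ # K` along an orbit. -/
theorem hamPow_apply_iterate (m : ℕ) (t : ℝ) (x : M) :
    hamPow K φ m (t, (φ t)^[m] x) = ∑ j ∈ Finset.range m, K (t, (φ t)^[j + 1] x) := by
  induction m with
  | zero => rfl
  | succ m ih =>
    have h1 : hamPow K φ (m + 1) (t, (φ t)^[m + 1] x) = K (t, (φ t)^[m + 1] x) +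
      hamPow K φ m (t, (φ t).symm ((φ t)^[m + 1] x)) := rfl
    rw [Finset.sum_range_succ, ← ih, h1, Function.iterate_succ_apply', (φ t).symm_apply_apply,
      add_comm]

-- Every point is the end of a piece of orbit, since `φ t` is bijective. Along it both sides are the
-- sum of the same `m * k` values of `K`.
omit [IsManifold (𝓡 (2 * n)) ∞ M] [CompactSpace M] in
theorem hamPow_flowPow (m k : ℕ) (p : ℝ × M) :
    hamPow (hamPow K φ m) (flowPow φ m) k p = hamPow K φ (m * k) p := by
  obtain ⟨t, z⟩ := p
  obtain ⟨x, rfl⟩ : ∃ x, (φ t)^[m * k] x = z :=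
    ((φ t).surjective.iterate _) z
  have h1 : (φ t)^[m * k] x = (flowPow φ m t)^[k] x := by
    have : (flowPow φ m t : M → M) = (φ t)^[m] := funext fun y => flowPow_apply φ m t y
    rw [this, Function.iterate_mul]
  rw [hamPow_apply_iterate, h1, hamPow_apply_iterate]
  have : (flowPow φ m t : M → M) = (φ t)^[m] := funext fun y => flowPow_apply φ m t y
  simp only [this, ← Function.iterate_mul]
  have h2 : ∀ j, hamPow K φ m (t, (φ t)^[m * (j + 1)] x) =
      ∑ i ∈ Finset.range m, K (t, (φ t)^[m * j + i + 1] x) := by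
    intro j
    have : (φ t)^[m * (j + 1)] x = (φ t)^[m] ((φ t)^[m * j] x) := by
      rw [← Function.iterate_add_apply]; congr 1; ring
    rw [this, hamPow_apply_iterate]
    refine Finset.sum_congr rfl fun i _ => ?_
    rw [← Function.iterate_add_apply]
    congr 3
    ring
  simp only [h2]
  clear h1
  induction k with
  | zero => simp
  | succ k ih =>
    rw [Finset.sum_range_succ, ih, mul_add, mul_one, Finset.sum_range_add]

end Orbits

/-! ### Flows of autonomous Hamiltonians for small times. -/

section Autonomous

variable {n : ℕ} {M : Type*} [TopologicalSpace M] [ChartedSpace (EuclideanSpace ℝ (Fin (2 * n))) M]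
variable {V : Type} [NormedAddCommGroup V] [InnerProductSpace ℝ V]
variable [IsManifold (𝓡 (2 * n)) ∞ M] [CompactSpace M] [FiniteDimensional ℝ V]
variable {R : SmoothRetract (2 * n) M V} {Ω : SymplecticForm n M}

omit [IsManifold (𝓡 (2 * n)) ∞ M] [CompactSpace M] [FiniteDimensional ℝ V] in
theorem proj_gradV (f : M → ℝ) (x : M) : R.proj (R.incl x) (gradV R Ω f x) = gradV R Ω f x := by
  rw [R.proj_apply (R.incl_mem x), R.retr_incl, gradV, R.retrD_inclD]

omit [IsManifold (𝓡 (2 * n)) ∞ M] in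
/-- Integral curves of an extension of a tangent vector field that start on the manifold stay on
the manifold for a uniform time. -/
theorem exists_incl_retr_eq_of_hasDerivAt {v : V → V} (hv : ContDiff ℝ ∞ v)
    (hvc : HasCompactSupport v) (hvt : ∀ x, R.proj (R.incl x) (v (R.incl x)) = v (R.incl x)) :
    ∃ ε > 0, ∀ (c : ℝ) (γ : ℝ → V) (T : ℝ), |c| ≤ 1 → T ≤ ε →
      (∀ t ∈ Icc 0 T, HasDerivAt γ (c • v (γ t)) t) → γ 0 ∈ range R.incl →
        ∀ t ∈ Icc 0 T, γ t ∈ range R.incl := by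
  have : ProperSpace V := FiniteDimensional.proper ℝ V
  have hC : IsCompact (range R.incl) := isCompact_range R.contMDiff_incl.continuous
  -- Within distance `η` of the manifold the retraction is defined; the speed bound below keeps the
  -- curve in this range for a time that does not depend on the curve.
  obtain ⟨η, hη, hηs⟩ := hC.exists_cthickening_subset_open R.isOpen_dom (by
    rintro _ ⟨x, rfl⟩; exact R.incl_mem x)
  obtain ⟨B, hB⟩ := hvc.exists_bound_of_continuous hv.continuous
  obtain ⟨ρ, hρ, hρc, hρs, hρ1, -⟩ := exists_contDiff_cutoff
    (hC.cthickening (r := η)) R.isOpen_dom hηs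
  have hh : ContDiffOn ℝ ∞ (fun y => v y - R.proj y (v y)) R.dom :=
    hv.contDiffOn.sub ((R.contDiffOn_incl_retr.fderiv_of_isOpen R.isOpen_dom (by simp)).clm_apply
      hv.contDiffOn)
  obtain ⟨L, hL⟩ := (contDiff_smul_of_tsupport R.isOpen_dom hρ hρs hh).lipschitzWith_of_hasCompactSupport
    hρc.smul_right (by simp)
  refine ⟨η / (|B| + 1), by positivity, fun c γ T hc hT hγ h0 => ?_⟩
  obtain ⟨x₀, hx₀⟩ := h0
  have hcont : ContinuousOn γ (Icc 0 T) := fun t ht => (hγ t ht).continuousAt.continuousWithinAt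
  have hmem : ∀ t ∈ Icc 0 T, γ t ∈ Metric.cthickening η (range R.incl) := by
    intro t ht
    have h1 := (convex_Icc (0 : ℝ) T).norm_image_sub_le_of_norm_hasDerivWithin_le
      (f := γ) (f' := fun t => c • v (γ t)) (C := |B|) (x := 0) (y := t)
      (fun s hs => (hγ s hs).hasDerivWithinAt) (fun s hs => by
        rw [norm_smul, Real.norm_eq_abs]
        calc |c| * ‖v (γ s)‖ ≤ 1 * |B| :=
              mul_le_mul hc ((hB _).trans (le_abs_self B)) (norm_nonneg _) zero_le_one
          _ = |B| := one_mul _) ⟨le_rfl, ht.1.trans ht.2⟩ ht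
    refine Metric.mem_cthickening_of_dist_le (γ t) (γ 0) η _ ⟨x₀, hx₀⟩ ?_
    rw [dist_eq_norm]
    rw [sub_zero, Real.norm_eq_abs, abs_of_nonneg ht.1] at h1
    have h2 : t ≤ η / (|B| + 1) := ht.2.trans hT
    rw [le_div_iff₀ (by positivity)] at h2
    nlinarith [ht.1, abs_nonneg B]
  -- Grönwall's inequality for the difference between the curve and its retraction. Its derivative
  -- is the normal part of the field, which vanishes on the manifold and is Lipschitz, hence is
  -- bounded by a multiple of the difference itself.
  have key := eq_zero_of_abs_deriv_le_mul_abs_self_of_eq_zero_right (K := L) (a := 0) (b := T)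
    (f := fun t => γ t - R.incl (R.retr (γ t)))
    (f' := fun t => c • v (γ t) - R.proj (γ t) (c • v (γ t)))
    (fun t ht => by
      have hd : ContinuousAt (fun y => R.incl (R.retr y)) (γ t) :=
        (R.contDiffOn_incl_retr.contDiffAt (R.isOpen_dom.mem_nhds (hηs (hmem t ht)))).continuousAt
      exact ((hγ t ht).continuousAt.sub
        (ContinuousAt.comp (g := fun y => R.incl (R.retr y)) hd
          (hγ t ht).continuousAt)).continuousWithinAt)
    (fun t ht => by
      have ht' : t ∈ Icc 0 T := ⟨ht.1, ht.2.le⟩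
      have hd : HasFDerivAt (fun y => R.incl (R.retr y)) (R.proj (γ t)) (γ t) :=
        ((R.contDiffOn_incl_retr.contDiffAt (R.isOpen_dom.mem_nhds
          (hηs (hmem t ht')))).differentiableAt (by simp)).hasFDerivAt
      exact ((hγ t ht').sub (hd.comp_hasDerivAt t (hγ t ht'))).hasDerivWithinAt)
    (by simp only [← hx₀, R.retr_incl, sub_self])
    (fun t ht => by
      have ht' : t ∈ Icc 0 T := ⟨ht.1, ht.2.le⟩
      have h1 : dist (ρ (γ t) • (v (γ t) - R.proj (γ t) (v (γ t))))
          (ρ (R.incl (R.retr (γ t))) • (v (R.incl (R.retr (γ t))) -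
            R.proj (R.incl (R.retr (γ t))) (v (R.incl (R.retr (γ t)))))) ≤
          L * dist (γ t) (R.incl (R.retr (γ t))) := hL.dist_le_mul _ _
      have h2 : v (R.incl (R.retr (γ t))) -
          R.proj (R.incl (R.retr (γ t))) (v (R.incl (R.retr (γ t)))) = 0 := by
        rw [hvt, sub_self]
      rw [h2, smul_zero, dist_zero_right, hρ1 _ (hmem t ht'), one_smul] at h1
      rw [dist_eq_norm] at h1
      rw [map_smul, ← smul_sub, norm_smul, Real.norm_eq_abs]
      calc _ ≤ 1 * ‖v (γ t) - R.proj (γ t) (v (γ t))‖ :=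
            mul_le_mul_of_nonneg_right hc (norm_nonneg _)
        _ ≤ _ := by rw [one_mul]; exact h1)
  intro t ht
  exact ⟨R.retr (γ t), (sub_eq_zero.1 (key t ht)).symm⟩

variable (R Ω) in
/-- The flow of an autonomous Hamiltonian for small times. -/
theorem exists_autonomous_flow {G : M → ℝ} (hG : ContMDiff (𝓡 (2 * n)) 𝓘(ℝ, ℝ) ∞ G) :
    ∃ δ > 0, ∃ Φ : ℝ → (M ≃ₘ⟮𝓡 (2 * n), 𝓡 (2 * n)⟯ M), (∀ x, Φ 0 x = x) ∧
      ContMDiffOn (𝓘(ℝ, ℝ).prod (𝓡 (2 * n))) (𝓡 (2 * n)) ∞ (fun p : ℝ × M => Φ p.1 p.2)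
        (Ioo (-δ) δ ×ˢ univ) ∧
      ContMDiffOn (𝓘(ℝ, ℝ).prod (𝓡 (2 * n))) (𝓡 (2 * n)) ∞ (fun p : ℝ × M => (Φ p.1).symm p.2)
        (Ioo (-δ) δ ×ˢ univ) ∧
      (∀ t ∈ Ioo (-δ) δ, ∀ x, HasDerivAt (fun s => R.incl (Φ s x)) (gradV R Ω G (Φ t x)) t) ∧
      ∀ t ∈ Ioo (-δ) δ, ∀ x, x ∉ tsupport G → Φ t x = x := by
  obtain ⟨w, hw, hwc, hwG⟩ := exists_contDiff_extend_gradV R Ω (K := fun p : ℝ × M => G p.2)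
    (hG.comp contMDiff_snd) 1
  let v : V → V := fun y => w (0, y)
  have hv : ContDiff ℝ ∞ v := hw.comp (contDiff_const.prodMk contDiff_id)
  have hvc : HasCompactSupport v := by
    refine hwc.comp_isClosedEmbedding (g := fun y : V => ((0 : ℝ), y)) ?_
    exact (Topology.IsClosedEmbedding.of_continuous_injective_isClosedMap (by fun_prop)
      (fun a b h => (Prod.ext_iff.1 h).2) (isClosedMap_prodMk_left 0))
  have hvG : ∀ x, v (R.incl x) = gradV R Ω G x := fun x => hwG 0 (by simp) x
  obtain ⟨L, hL⟩ := hv.lipschitzWith_of_hasCompactSupport hvc (by simp)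
  obtain ⟨δ₀, hδ₀, Ψ, hΨ, hΨ0, hΨd⟩ := exists_contDiffOn_flow hv hL
  obtain ⟨ε, hε, hinv⟩ := exists_incl_retr_eq_of_hasDerivAt (R := R) hv hvc fun x => by
    rw [hvG, proj_gradV]
  -- One half of `δ₀`, because the group law adds two times from `(-δ, δ)`; at most `ε`, so that the
  -- curves remain on the manifold. Negative times are treated by reversing the field, which is the
  -- case `c = -1` of `hinv`.
  let δ := min (δ₀ / 2) ε
  have hδ : 0 < δ := lt_min (by positivity) hε
  have hδ1 : δ ≤ δ₀ / 2 := min_le_left _ _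
  have hδ2 : δ ≤ ε := min_le_right _ _
  have hsub : ∀ t ∈ Ioo (-δ) δ, t ∈ Ioo (-δ₀) δ₀ := fun t ht =>
    ⟨by linarith [ht.1], by linarith [ht.2]⟩
  have hmem : ∀ t ∈ Ioo (-δ) δ, ∀ x, R.incl (R.retr (Ψ t (R.incl x))) = Ψ t (R.incl x) := by
    intro t ht x
    obtain ⟨y, hy⟩ : Ψ t (R.incl x) ∈ range R.incl := by
      rcases le_total 0 t with h0 | h0
      · exact hinv 1 (fun s => Ψ s (R.incl x)) t (by simp) (ht.2.le.trans hδ2)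
          (fun s hs => by
            rw [one_smul]
            exact hΨd s (hsub s ⟨by linarith [hs.1], by linarith [hs.2, ht.2]⟩) _)
          ⟨x, (hΨ0 _).symm⟩ t ⟨h0, le_rfl⟩
      · have := hinv (-1) (fun s => Ψ (-s) (R.incl x)) (-t) (by simp) (by linarith [ht.1])
          (fun s hs => by
            have h1 := hΨd (-s) (hsub (-s) ⟨by linarith [hs.2, ht.1], by linarith [hs.1]⟩)
              (R.incl x)
            exact h1.scomp s (hasDerivAt_neg s))
          ⟨x, by simp [hΨ0]⟩ (-t) ⟨by linarith, le_rfl⟩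
        simpa using this
    rw [← hy, R.retr_incl]
  let F : ℝ → M → M := fun t x => R.retr (Ψ t (R.incl x))
  have hF : ∀ t ∈ Ioo (-δ) δ, ∀ x, R.incl (F t x) = Ψ t (R.incl x) := hmem
  have hFF : ∀ t ∈ Ioo (-δ) δ, ∀ x, F (-t) (F t x) = x := by
    intro t ht x
    have ht' : -t ∈ Ioo (-δ) δ := ⟨by linarith [ht.2], by linarith [ht.1]⟩
    have h1 := eqOn_Ioo_of_hasDerivAt (v := fun q : ℝ × V => v q.2) (L := L * 1)
      (hL.comp LipschitzWith.prod_snd) (a := -δ) (b := δ) (t₀ := 0)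
      (f := fun s => Ψ (t + s) (R.incl x)) (g := fun s => Ψ s (Ψ t (R.incl x)))
      ⟨by linarith, hδ⟩
      (fun s hs => (hΨd (t + s) ⟨by linarith [hs.1, ht.1], by linarith [hs.2, ht.2]⟩
        (R.incl x)).comp_const_add t s)
      (fun s hs => hΨd s (hsub s hs) _) (by simp [hΨ0]) ht'
    simp only [add_neg_cancel, hΨ0] at h1
    refine R.incl_injective ?_
    rw [hF _ ht', hF _ ht, ← h1]
  have hFs : ContMDiffOn (𝓘(ℝ, ℝ).prod (𝓡 (2 * n))) (𝓡 (2 * n)) ∞ (fun p : ℝ × M => F p.1 p.2)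
      (Ioo (-δ) δ ×ˢ univ) := by
    have h1 : ContMDiffOn (𝓘(ℝ, ℝ).prod (𝓡 (2 * n))) 𝓘(ℝ, V) ∞
        (fun p : ℝ × M => Ψ p.1 (R.incl p.2)) (Ioo (-δ) δ ×ˢ univ) := by
      refine hΨ.contMDiffOn.comp (f := fun p : ℝ × M => (p.1, R.incl p.2)) ?_
        fun p hp => ⟨hsub _ hp.1, mem_univ _⟩
      exact (ContMDiff.prodMk_space contMDiff_fst
        (R.contMDiff_incl.comp contMDiff_snd)).contMDiffOn
    refine R.contMDiffOn_retr.comp h1 fun p hp => ?_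
    have := hF p.1 hp.1 p.2
    simp only [mem_preimage]
    rw [← this]
    exact R.incl_mem _
  have hFslice : ∀ t ∈ Ioo (-δ) δ, ContMDiff (𝓡 (2 * n)) (𝓡 (2 * n)) ∞ (F t) := fun t ht =>
    hFs.comp_contMDiff (f := fun x : M => (t, x)) (contMDiff_const.prodMk contMDiff_id)
      fun x => ⟨ht, mem_univ _⟩
  have hneg : ∀ t, t ∈ Ioo (-δ) δ → -t ∈ Ioo (-δ) δ := fun t ht =>
    ⟨by linarith [ht.2], by linarith [ht.1]⟩
  classical
  -- Outside the small time interval the value is the identity, as a default; only times in the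
  -- interval are used.
  let Φ : ℝ → (M ≃ₘ⟮𝓡 (2 * n), 𝓡 (2 * n)⟯ M) := fun t =>
    if ht : t ∈ Ioo (-δ) δ then
      { toFun := F t
        invFun := F (-t)
        left_inv := hFF t ht
        right_inv := fun x => by
          have := hFF (-t) (hneg t ht) x
          rwa [neg_neg] at this
        contMDiff_toFun := hFslice t ht
        contMDiff_invFun := hFslice (-t) (hneg t ht) }
    else Diffeomorph.refl _ _ _
  have hΦ : ∀ t ∈ Ioo (-δ) δ, ∀ x, Φ t x = F t x := fun t ht x => by
    simp only [Φ, dif_pos ht]; rfl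
  have hΦs : ∀ t ∈ Ioo (-δ) δ, ∀ x, (Φ t).symm x = F (-t) x := fun t ht x => by
    simp only [Φ, dif_pos ht]; rfl
  have h0 : (0 : ℝ) ∈ Ioo (-δ) δ := ⟨by linarith, hδ⟩
  refine ⟨δ, hδ, Φ, fun x => ?_, hFs.congr fun p hp => hΦ p.1 hp.1 p.2, ?_, fun t ht x => ?_,
    fun t ht x hx => ?_⟩
  · rw [hΦ 0 h0]
    refine R.incl_injective ?_
    rw [hF 0 h0, hΨ0]
  · refine ContMDiffOn.congr (f := fun p : ℝ × M => F (-p.1) p.2) ?_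
      fun p hp => hΦs p.1 hp.1 p.2
    refine hFs.comp (f := fun p : ℝ × M => (-p.1, p.2)) ?_ fun p hp => ⟨hneg _ hp.1, mem_univ _⟩
    have h1 : ContDiff ℝ ∞ fun t : ℝ => -t := contDiff_neg
    exact ((h1.contMDiff.comp contMDiff_fst).prodMk contMDiff_snd).contMDiffOn
  · have h1 := hΨd t (hsub t ht) (R.incl x)
    rw [← hF t ht, hvG, ← hΦ t ht] at h1
    refine h1.congr_of_eventuallyEq ?_
    filter_upwards [Ioo_mem_nhds ht.1 ht.2] with s hs
    rw [hΦ s hs, hF s hs]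
  · have hz : gradV R Ω G x = 0 := by
      refine gradV_eq_zero_of_eventuallyEq R Ω (c := 0) ?_
      filter_upwards [(isClosed_tsupport G).isOpen_compl.mem_nhds hx] with y hy
      exact image_eq_zero_of_notMem_tsupport hy
    have h1 := eqOn_Ioo_of_hasDerivAt (v := fun q : ℝ × V => v q.2) (L := L * 1)
      (hL.comp LipschitzWith.prod_snd) (a := -δ) (b := δ) (t₀ := 0)
      (f := fun s => Ψ s (R.incl x)) (g := fun _ => R.incl x) h0
      (fun s hs => hΨd s (hsub s hs) _)
      (fun s hs => by
        simp only [hvG, hz]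
        exact hasDerivAt_const _ _) (hΨ0 _) ht
    refine R.incl_injective ?_
    rw [hΦ t ht, hF t ht]
    exact h1

end Autonomous

end SymplecticClosing

namespace SymplecticClosing

/-! ### Reparametrized and perturbed Hamiltonians -/

section Perturbation

/-- A smooth step from `0` to `1` over the time interval `[0, 1/3]`. -/
noncomputable def earlyStep (t : ℝ) : ℝ := Real.smoothTransition (3 * t)

/-- A smooth step from `0` to `1` over the time interval `[2/3, 1]`. -/
noncomputable def lateStep (t : ℝ) : ℝ := Real.smoothTransition (3 * t - 2)

theorem contDiff_earlyStep : ContDiff ℝ ∞ earlyStep :=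
  Real.smoothTransition.contDiff.comp (contDiff_const.mul contDiff_id)

theorem contDiff_lateStep : ContDiff ℝ ∞ lateStep :=
  Real.smoothTransition.contDiff.comp ((contDiff_const.mul contDiff_id).sub contDiff_const)

theorem earlyStep_mem (t : ℝ) : earlyStep t ∈ Icc (0 : ℝ) 1 :=
  ⟨Real.smoothTransition.nonneg _, Real.smoothTransition.le_one _⟩

theorem lateStep_mem (t : ℝ) : lateStep t ∈ Icc (0 : ℝ) 1 :=
  ⟨Real.smoothTransition.nonneg _, Real.smoothTransition.le_one _⟩

theorem earlyStep_eq_one {t : ℝ} (ht : 1 / 3 ≤ t) : earlyStep t = 1 :=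
  Real.smoothTransition.one_of_one_le (by linarith)

theorem earlyStep_zero : earlyStep 0 = 0 := Real.smoothTransition.zero_of_nonpos (by simp)

theorem lateStep_eq_zero {t : ℝ} (ht : t ≤ 2 / 3) : lateStep t = 0 :=
  Real.smoothTransition.zero_of_nonpos (by linarith)

theorem lateStep_one : lateStep 1 = 1 := Real.smoothTransition.one_of_one_le (by norm_num)

theorem deriv_earlyStep {t : ℝ} (ht : 1 / 3 < t) : deriv earlyStep t = 0 := by
  have : earlyStep =ᶠ[𝓝 t] fun _ => 1 := by
    filter_upwards [lt_mem_nhds ht] with s hs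
    exact earlyStep_eq_one hs.le
  rw [this.deriv_eq, deriv_const]

theorem deriv_lateStep {t : ℝ} (ht : t < 2 / 3) : deriv lateStep t = 0 := by
  have : lateStep =ᶠ[𝓝 t] fun _ => 0 := by
    filter_upwards [gt_mem_nhds ht] with s hs
    exact lateStep_eq_zero (le_of_lt hs)
  rw [this.deriv_eq, deriv_const]

variable {n : ℕ} {M : Type*} [TopologicalSpace M] [ChartedSpace (EuclideanSpace ℝ (Fin (2 * n))) M]
variable {V : Type} [NormedAddCommGroup V] [InnerProductSpace ℝ V]
variable {R : SmoothRetract (2 * n) M V} {Ω : SymplecticForm n M}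

/-- The time `t` of the reparametrized isotopy, as a point of the unit interval. -/
noncomputable def earlyTime (t : ℝ) : unitInterval := ⟨earlyStep t, earlyStep_mem t⟩

theorem contMDiff_earlyTime : ContMDiff 𝓘(ℝ, ℝ) (𝓡∂ 1) ∞ earlyTime := by
  refine contMDiff_iff_comp_subtypeVal_Icc.2 ⟨?_, contDiff_earlyStep.contMDiff⟩
  exact contDiff_earlyStep.continuous.subtype_mk _

/-- The Hamiltonian of the isotopy run over the time interval `[0, 1/3]`. -/
noncomputable def earlyHam (H : Hamiltonian n M) (p : ℝ × M) : ℝ :=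
  deriv earlyStep p.1 * H (earlyTime p.1, p.2)

theorem contMDiff_earlyHam (H : Hamiltonian n M) :
    ContMDiff (𝓘(ℝ, ℝ).prod (𝓡 (2 * n))) 𝓘(ℝ, ℝ) ∞ (earlyHam H) := by
  have h1 : ContDiff ℝ ∞ (deriv earlyStep) := (contDiff_infty_iff_deriv.1 contDiff_earlyStep).2
  have h2 : ContMDiff (𝓘(ℝ, ℝ).prod (𝓡 (2 * n))) ((𝓡∂ 1).prod (𝓡 (2 * n))) ∞
      fun p : ℝ × M => (earlyTime p.1, p.2) :=
    (contMDiff_earlyTime.comp contMDiff_fst).prodMk contMDiff_snd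
  have h3 : ContMDiff (𝓘(ℝ, ℝ).prod (𝓡 (2 * n))) 𝓘(ℝ, ℝ) ∞
      fun p : ℝ × M => deriv earlyStep p.1 := h1.contMDiff.comp contMDiff_fst
  exact h3.mul (H.contMDiff.comp h2)

/-- The chain rule gives a two-sided derivative on the whole line although the orbit is only
differentiable within `[0, 1]`, since `earlyStep` never leaves that interval. -/
theorem IsHamFlow.hasDerivAt_earlyTime {H : Hamiltonian n M}
    {φ : unitInterval → (M ≃ₘ⟮𝓡 (2 * n), 𝓡 (2 * n)⟯ M)} (h : IsHamFlow Ω H φ) (x : M) (t : ℝ) :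
    HasDerivAt (fun s => R.incl (φ (earlyTime s) x))
      (deriv earlyStep t • gradV R Ω (fun z => H (earlyTime t, z)) (φ (earlyTime t) x)) t := by
  have h1 := (isHamOrbit_iff R Ω).1 (h.2 x) (earlyTime t)
  have h2 : HasDerivAt earlyStep (deriv earlyStep t) t :=
    (contDiff_earlyStep.differentiable (by simp)).differentiableAt.hasDerivAt
  have hp : ∀ s, projIcc (0 : ℝ) 1 zero_le_one (earlyStep s) = earlyTime s := fun s =>
    projIcc_of_mem _ (earlyStep_mem s)
  have he : ∀ s, ((earlyTime s : unitInterval) : ℝ) = earlyStep s := fun _ => rfl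
  rw [he] at h1
  simp only [hp] at h1
  have h3 := HasDerivWithinAt.scomp_hasDerivAt t h1 h2 earlyStep_mem
  refine h3.congr_of_eventuallyEq (Eventually.of_forall fun s => ?_)
  simp only [Function.comp, hp]

/-- The reparametrized isotopy has the same time-one map, is defined for all real times, and its
Hamiltonian vanishes after time `1/3`, which leaves room for the perturbation. -/
theorem IsHamFlow.isSmoothFlow {H : Hamiltonian n M}
    {φ : unitInterval → (M ≃ₘ⟮𝓡 (2 * n), 𝓡 (2 * n)⟯ M)} (h : IsHamFlow Ω H φ) :
    IsSmoothFlow R Ω (earlyHam H) fun t => φ (earlyTime t) where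
  smooth := contMDiff_earlyHam H
  zero := fun x => by
    have : earlyTime 0 = 0 := Subtype.ext earlyStep_zero
    rw [this, h.1]
  hasDerivAt := fun x t => by
    have hH : ContMDiff (𝓡 (2 * n)) 𝓘(ℝ, ℝ) ∞ fun z => H (earlyTime t, z) :=
      H.contMDiff.comp (contMDiff_const.prodMk contMDiff_id)
    have hg : (fun z => earlyHam H (t, z)) = fun z => deriv earlyStep t * H (earlyTime t, z) := by
      funext z
      rw [earlyHam]
    rw [hg, gradV_const_mul R Ω ((hH _).mdifferentiableAt (by simp))]
    exact h.hasDerivAt_earlyTime x t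

theorem earlyHam_eq_zero (H : Hamiltonian n M) {t : ℝ} (ht : 1 / 3 < t) (x : M) :
    earlyHam H (t, x) = 0 := by
  rw [earlyHam, deriv_earlyStep ht, zero_mul]

theorem earlyTime_eq_one {t : ℝ} (ht : 1 / 3 ≤ t) : earlyTime t = 1 :=
  Subtype.ext (earlyStep_eq_one ht)

/-- The perturbation of `K` by `c G`, which acts in the time interval `[2/3, 1]`. -/
noncomputable def pertHam (K : ℝ × M → ℝ) (G : M → ℝ) (c : ℝ) (p : ℝ × M) : ℝ :=
  K p + c * (deriv lateStep p.1 * G p.2)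

/-- The isotopy `φ`, followed by the isotopy `Φ` up to time `c`. -/
noncomputable def pertFlow (φ Φ : ℝ → (M ≃ₘ⟮𝓡 (2 * n), 𝓡 (2 * n)⟯ M)) (c : ℝ) :
    ℝ → (M ≃ₘ⟮𝓡 (2 * n), 𝓡 (2 * n)⟯ M) :=
  fun t => (φ t).trans (Φ (c * lateStep t))

theorem pertFlow_apply (φ Φ : ℝ → (M ≃ₘ⟮𝓡 (2 * n), 𝓡 (2 * n)⟯ M)) (c t : ℝ) (x : M) :
    pertFlow φ Φ c t x = Φ (c * lateStep t) (φ t x) := rfl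

variable {K : ℝ × M → ℝ} {G : M → ℝ} {φ Φ : ℝ → (M ≃ₘ⟮𝓡 (2 * n), 𝓡 (2 * n)⟯ M)} {c δ : ℝ}

theorem mul_lateStep_mem (hc : |c| < δ) (t : ℝ) : c * lateStep t ∈ Ioo (-δ) δ := by
  refine abs_lt.1 ?_
  rw [abs_mul, abs_of_nonneg (lateStep_mem t).1]
  exact (mul_le_of_le_one_right (abs_nonneg _) (lateStep_mem t).2).trans_lt hc

theorem pertFlow_of_lt (hΦ0 : ∀ x, Φ 0 x = x) {t : ℝ} (ht : t ≤ 2 / 3) (x : M) :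
    pertFlow φ Φ c t x = φ t x := by
  rw [pertFlow_apply, lateStep_eq_zero ht, mul_zero, hΦ0]

/-- The two Hamiltonians act at disjoint times: up to `2/3` the isotopy is `φ`, and from `1/3` on
`φ` stands still and only the flow of `G`, at speed `c` times the derivative of `lateStep`, moves
points. So the perturbed Hamiltonian is a plain sum. -/
theorem IsSmoothFlow.pert (h : IsSmoothFlow R Ω K φ) (hK : ∀ t, 1 / 3 < t → ∀ x, K (t, x) = 0)
    (hφ : ∀ t, 1 / 3 ≤ t → φ t = φ 1) (hG : ContMDiff (𝓡 (2 * n)) 𝓘(ℝ, ℝ) ∞ G)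
    (hΦ0 : ∀ x, Φ 0 x = x)
    (hΦ : ∀ t ∈ Ioo (-δ) δ, ∀ x, HasDerivAt (fun s => R.incl (Φ s x)) (gradV R Ω G (Φ t x)) t)
    (hc : |c| < δ) : IsSmoothFlow R Ω (pertHam K G c) (pertFlow φ Φ c) where
  smooth := by
    have h1 : ContDiff ℝ ∞ (deriv lateStep) := (contDiff_infty_iff_deriv.1 contDiff_lateStep).2
    exact h.smooth.add (contMDiff_const.mul ((h1.contMDiff.comp contMDiff_fst).mul
      (hG.comp contMDiff_snd)))
  zero := fun x => by rw [pertFlow_of_lt hΦ0 (by norm_num), h.zero]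
  hasDerivAt := fun x t => by
    rcases lt_or_ge t (2 / 3) with ht | ht
    · have h1 : (fun z => pertHam K G c (t, z)) = fun z => K (t, z) := by
        funext z
        rw [pertHam, deriv_lateStep ht, zero_mul, mul_zero, add_zero]
      rw [h1, pertFlow_of_lt hΦ0 ht.le]
      refine (h.hasDerivAt x t).congr_of_eventuallyEq ?_
      filter_upwards [gt_mem_nhds ht] with s hs
      rw [pertFlow_of_lt hΦ0 (le_of_lt hs)]
    · have ht' : 1 / 3 < t := by linarith
      have h1 : (fun z => pertHam K G c (t, z)) = fun z => (c * deriv lateStep t) * G z := by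
        funext z
        rw [pertHam, hK t ht', zero_add, mul_assoc]
      rw [h1, gradV_const_mul R Ω ((hG _).mdifferentiableAt (by simp))]
      have h2 : HasDerivAt (fun s => c * lateStep s) (c * deriv lateStep t) t :=
        ((contDiff_lateStep.differentiable (by simp)).differentiableAt.hasDerivAt).const_mul c
      have h3 := HasDerivAt.scomp (g₁ := fun s => R.incl (Φ s (φ 1 x))) t
        (hΦ _ (mul_lateStep_mem hc t) (φ 1 x)) h2
      rw [pertFlow_apply, hφ t ht'.le]
      refine h3.congr_of_eventuallyEq ?_
      filter_upwards [lt_mem_nhds ht'] with s hs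
      rw [pertFlow_apply, hφ s (le_of_lt hs)]
      rfl

/-! ### Actions do not change if no periodic point appears in `U`. -/

section Rigidity

variable {U : Set M}

/-- The orbit of a periodic point consists of periodic points, so by assumption it avoids `U`, where
the whole perturbation is concentrated. Hence the perturbation is invisible along this orbit, at
every time `t`. -/
theorem pertFlow_iterate_eq (hφ : ∀ t, 1 / 3 ≤ t → φ t = φ 1) (hΦ0 : ∀ x, Φ 0 x = x)
    (hΦU : ∀ t ∈ Ioo (-δ) δ, ∀ x, x ∉ U → Φ t x = x) (hc : |c| < δ)
    (hU : ∀ x ∈ U, x ∉ Function.periodicPts (pertFlow φ Φ c 1)) {p : M}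
    (hp : p ∈ Function.periodicPts (pertFlow φ Φ c 1)) (t : ℝ) (j : ℕ) :
    (pertFlow φ Φ c t)^[j] p = (φ t)^[j] p ∧ (1 / 3 ≤ t → (φ t)^[j] p ∉ U) := by
  obtain ⟨m, hm, hpm⟩ := hp
  have hnot : ∀ j, (pertFlow φ Φ c 1)^[j] p ∉ U := fun j hj =>
    hU _ hj ⟨m, hm, hpm.apply_iterate j⟩
  -- The next point of the orbit lies outside `U`, so `Φ` fixes it. It is also the image under `Φ`
  -- of the point on the left, and `Φ` is injective.
  have hstep : ∀ j, φ 1 ((pertFlow φ Φ c 1)^[j] p) = (pertFlow φ Φ c 1)^[j + 1] p := by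
    intro j
    have h1 := hnot (j + 1)
    rw [Function.iterate_succ_apply', pertFlow_apply] at h1 ⊢
    exact ((Φ _).injective (hΦU _ (mul_lateStep_mem hc 1) _ h1)).symm
  have key : 1 / 3 ≤ t → ∀ j, (pertFlow φ Φ c t)^[j] p = (pertFlow φ Φ c 1)^[j] p ∧
      (φ t)^[j] p = (pertFlow φ Φ c 1)^[j] p := by
    intro ht j
    induction j with
    | zero => exact ⟨rfl, rfl⟩
    | succ j ih =>
      constructor
      · rw [Function.iterate_succ_apply', ih.1, pertFlow_apply, hφ t ht, hstep,
          hΦU _ (mul_lateStep_mem hc t) _ (hnot _)]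
      · rw [Function.iterate_succ_apply', ih.2, hφ t ht, hstep]
  refine ⟨?_, fun ht => by rw [(key ht j).2]; exact hnot j⟩
  rcases le_total t (2 / 3) with ht | ht
  · have : (pertFlow φ Φ c t : M → M) = φ t := funext fun x => pertFlow_of_lt hΦ0 ht x
    rw [this]
  · rw [(key (by linarith) j).1, (key (by linarith) j).2]

variable [IsManifold (𝓡 (2 * n)) ∞ M] [CompactSpace M] [FiniteDimensional ℝ V]

/-- If the perturbed diffeomorphism has no periodic points in `U`, the action spectra of the powers
of the perturbed Hamiltonian are contained in those of the unperturbed one. -/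
theorem spec_hamPow_pert_subset (h : IsSmoothFlow R Ω K φ)
    (hpert : IsSmoothFlow R Ω (pertHam K G c) (pertFlow φ Φ c))
    (hφ : ∀ t, 1 / 3 ≤ t → φ t = φ 1) (hΦ0 : ∀ x, Φ 0 x = x)
    (hGU : ∀ x, x ∉ U → G x = 0)
    (hΦU : ∀ t ∈ Ioo (-δ) δ, ∀ x, x ∉ U → Φ t x = x) (hc : |c| < δ)
    (hU : ∀ x ∈ U, x ∉ Function.periodicPts (pertFlow φ Φ c 1)) (m : ℕ) :
    Spec Ω (toHam (hamPow (pertHam K G c) (pertFlow φ Φ c) m) (hpert.pow m).smooth) ⊆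
      Spec Ω (toHam (hamPow K φ m) (h.pow m).smooth) := by
  rintro a ⟨γ, v, hγ, hγ1, rfl⟩
  rcases Nat.eq_zero_or_pos m with rfl | hm
  · exact ⟨γ, v, hγ, hγ1, rfl⟩
  have h1 := (hpert.pow m).orbit_eq hγ
  -- A closed orbit of the `m`-th power starts at a point that is fixed by the `m`-th iterate of the
  -- time-one map.
  have hp : γ 0 ∈ Function.periodicPts (pertFlow φ Φ c 1) := by
    refine ⟨m, hm, ?_⟩
    have := h1 1 (by simp)
    rw [flowPow_apply, ← hγ1] at this
    exact this.symm
  have hit := pertFlow_iterate_eq hφ hΦ0 hΦU hc hU hp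
  have h2 : ∀ t ∈ Icc (0 : ℝ) 1, γ t = flowPow φ m t (γ 0) := by
    intro t ht
    rw [h1 t ht, flowPow_apply, flowPow_apply, (hit t m).1]
  -- The loop and the capping are kept, so the areas agree and only the Hamiltonians along the loop
  -- have to be compared.
  refine ⟨γ, v, (h.pow m).isHamOrbit h2, hγ1, ?_⟩
  rw [action, action]
  congr 1
  refine integral_congr_ae (Eventually.of_forall fun t => ?_)
  simp only [toHam_apply]
  have h3 : ((t : ℝ), γ t) = ((t : ℝ), (φ t)^[m] (γ 0)) := by rw [h2 t t.2, flowPow_apply]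
  have h4 : ((t : ℝ), γ t) = ((t : ℝ), (pertFlow φ Φ c t)^[m] (γ 0)) := by
    rw [h3, (hit t m).1]
  conv_rhs => rw [h3, hamPow_apply_iterate]
  rw [h4, hamPow_apply_iterate]
  refine Finset.sum_congr rfl fun j _ => ?_
  rw [(hit t (j + 1)).1, pertHam]
  -- Before `2/3` the perturbation is switched off; afterwards the iterates lie outside `U`, where
  -- `G` vanishes.
  rcases lt_or_ge (t : ℝ) (2 / 3) with ht | ht
  · simp only [deriv_lateStep ht, zero_mul, mul_zero, add_zero]
  · simp only [hGU _ ((hit t (j + 1)).2 (by linarith)), mul_zero, add_zero]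

/-- The set of all finite sums of elements of `S`. -/
def finiteSums (S : Set ℝ) : Set ℝ :=
  {a | ∃ (l : ℕ) (b : Fin l → ℝ), (∀ i, b i ∈ S) ∧ a = ∑ i, b i}

/-- A power of a power is a power of the original Hamiltonian. The exact exponents are forgotten, as
only the nullness of the set of all finite sums is needed. -/
theorem specK_hamPow_subset (h : IsSmoothFlow R Ω K φ) (k m : ℕ) :
    SpecK Ω k (toHam (hamPow K φ m) (h.pow m).smooth) ⊆
      finiteSums (⋃ j, Spec Ω (toHam (hamPow K φ j) (h.pow j).smooth)) := by
  rintro a ⟨κ, P, b, hPb, rfl⟩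
  refine ⟨κ.length, b, fun i => mem_iUnion.2 ⟨m * κ.blocksFun i, ?_⟩, rfl⟩
  obtain ⟨h1, h2⟩ := hPb i
  rw [(h.pow m).isPower_iff] at h1
  rw [h1] at h2
  convert h2 using 3
  funext p
  exact (hamPow_flowPow _ _ p).symm

end Rigidity

end Perturbation

end SymplecticClosing

namespace SymplecticClosing

/-! ### Smooth families are continuous in the smooth topology -/

section SmoothFamilies

/-- The derivative of a slice is the restriction to `E` of the full derivative, which is again
smooth in both variables; so the claim follows by induction on the order, over all target spaces. -/
theorem continuousOn_iteratedFDerivWithin_slice {E : Type} [NormedAddCommGroup E]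
    [NormedSpace ℝ E] {A : Set ℝ} (hA : IsOpen A) {T : Set E} (hT : UniqueDiffOn ℝ T) (j : ℕ) :
    ∀ {F : Type} [NormedAddCommGroup F] [NormedSpace ℝ F] {h : ℝ × E → F},
      ContDiffOn ℝ ∞ h (A ×ˢ T) →
        ContinuousOn (fun p : ℝ × E => iteratedFDerivWithin ℝ j (fun u => h (p.1, u)) T p.2)
          (A ×ˢ T) := by
  induction j with
  | zero =>
    intro F _ _ h hh
    simp only [iteratedFDerivWithin_zero_eq_comp]
    exact (LinearIsometryEquiv.continuous _).comp_continuousOn hh.continuousOn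
  | succ j ih =>
    intro F _ _ h hh
    have hu : UniqueDiffOn ℝ (A ×ˢ T) := hA.uniqueDiffOn.prod hT
    let h' : ℝ × E → E →L[ℝ] F := fun p =>
      (fderivWithin ℝ h (A ×ˢ T) p).comp (ContinuousLinearMap.inr ℝ ℝ E)
    have hh' : ContDiffOn ℝ ∞ h' (A ×ˢ T) :=
      (hh.fderivWithin hu (m := ∞) (by simp)).clm_comp contDiffOn_const
    have hd : ∀ p ∈ A ×ˢ T, fderivWithin ℝ (fun u => h (p.1, u)) T p.2 = h' p := by
      intro p hp
      have h1 : HasFDerivWithinAt h (fderivWithin ℝ h (A ×ˢ T) p) (A ×ˢ T) p :=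
        ((hh p hp).differentiableWithinAt (by simp)).hasFDerivWithinAt
      have h2 := HasFDerivWithinAt.comp (g := h) (f := fun u : E => (p.1, u)) (s := T) p.2 h1
        (hasFDerivAt_prodMk_right p.1 p.2).hasFDerivWithinAt fun u hu => ⟨hp.1, hu⟩
      exact h2.fderivWithin (hT p.2 hp.2)
    have hcont := (LinearIsometryEquiv.continuous
      (continuousMultilinearCurryRightEquiv' ℝ j E F).symm).comp_continuousOn (ih hh')
    refine hcont.congr fun p hp => ?_
    rw [iteratedFDerivWithin_succ_eq_comp_right hT hp.2]
    simp only [Function.comp]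
    congr 1
    exact iteratedFDerivWithin_congr (fun u hu => hd (p.1, u) ⟨hp.1, hu⟩) hp.2 j

variable {E : Type} [NormedAddCommGroup E] [NormedSpace ℝ E]
  {B : Type*} [TopologicalSpace B] {I : ModelWithCorners ℝ E B}
  {X : Type*} [TopologicalSpace X] [ChartedSpace B X] [IsManifold I ∞ X]
  {E' : Type} [NormedAddCommGroup E'] [NormedSpace ℝ E']
  {B' : Type*} [TopologicalSpace B'] {I' : ModelWithCorners ℝ E' B'}
  {Y : Type*} [TopologicalSpace Y] [ChartedSpace B' Y] [IsManifold I' ∞ Y]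

/-- The map reaches the chart around `y₀` only near `(s₀, x)`, so the previous lemma is applied on a
small product neighbourhood; intersecting with an open set does not change the iterated derivatives.
-/
theorem continuousAt_iteratedFDerivWithin_chart {F : ℝ × X → Y}
    (hF : ContMDiff (𝓘(ℝ, ℝ).prod I) I' ∞ F) {x₀ x : X} {y₀ : Y} {s₀ : ℝ}
    (hx : x ∈ (chartAt B x₀).source) (hy : F (s₀, x) ∈ (chartAt B' y₀).source) (j : ℕ) :
    ContinuousAt (fun p : ℝ × X => iteratedFDerivWithin ℝ j
      (extChartAt I' y₀ ∘ (fun z => F (p.1, z)) ∘ (extChartAt I x₀).symm)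
      (extChartAt I x₀).target (extChartAt I x₀ p.2)) (s₀, x) := by
  set φ := extChartAt I x₀ with hφ
  have hx' : x ∈ φ.source := by rwa [hφ, extChartAt_source]
  have hT : UniqueDiffOn ℝ φ.target := uniqueDiffOn_extChartAt_target x₀
  let k : ℝ × E → Y := fun p => F (p.1, φ.symm p.2)
  have hin : ContMDiffOn 𝓘(ℝ, ℝ × E) (𝓘(ℝ, ℝ).prod I) ∞
      (fun p : ℝ × E => (p.1, φ.symm p.2)) (univ ×ˢ φ.target) :=
    contDiff_fst.contMDiff.contMDiffOn.prodMk
      ((contMDiffOn_extChartAt_symm x₀).comp contDiff_snd.contMDiff.contMDiffOn fun p hp => hp.2)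
  have hk : ContMDiffOn 𝓘(ℝ, ℝ × E) I' ∞ k (univ ×ˢ φ.target) := hF.comp_contMDiffOn hin
  have hmem : k ⁻¹' (chartAt B' y₀).source ∈ 𝓝[univ ×ˢ φ.target] (s₀, φ x) := by
    refine (hk.continuousOn (s₀, φ x) ⟨mem_univ _, φ.map_source hx'⟩).preimage_mem_nhdsWithin ?_
    refine (chartAt B' y₀).open_source.mem_nhds ?_
    simp only [k]
    rwa [φ.left_inv hx']
  obtain ⟨W, hW, hWk⟩ := mem_nhdsWithin_iff_exists_mem_nhds_inter.1 hmem
  obtain ⟨A, C, hA, hsA, hC, hxC, hAC⟩ := mem_nhds_prod_iff'.1 hW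
  have hsmooth : ContDiffOn ℝ ∞ (fun p : ℝ × E => extChartAt I' y₀ (k p)) (A ×ˢ (φ.target ∩ C)) := by
    rw [← contMDiffOn_iff_contDiffOn]
    refine (contMDiffOn_extChartAt (x := y₀)).comp
      (hk.mono (prod_mono (subset_univ _) inter_subset_left)) ?_
    intro p hp
    exact hWk ⟨hAC ⟨hp.1, hp.2.2⟩, mem_univ _, hp.2.1⟩
  have hcont := continuousOn_iteratedFDerivWithin_slice hA (hT.inter hC) j hsmooth
  have hg : ContinuousAt (fun p : ℝ × X => (p.1, φ p.2)) (s₀, x) :=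
    continuousAt_fst.prodMk (ContinuousAt.comp (g := φ) (f := Prod.snd) (x := (s₀, x))
      (continuousAt_extChartAt' hx') continuousAt_snd)
  have hev : ∀ᶠ p : ℝ × X in 𝓝 (s₀, x), (p.1, φ p.2) ∈ A ×ˢ (φ.target ∩ C) := by
    have h1 : ∀ᶠ p : ℝ × X in 𝓝 (s₀, x), p.2 ∈ φ.source :=
      continuousAt_snd.eventually ((isOpen_extChartAt_source x₀).mem_nhds hx')
    have h2 : ∀ᶠ p : ℝ × X in 𝓝 (s₀, x), (p.1, φ p.2) ∈ A ×ˢ C :=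
      hg.eventually ((hA.prod hC).mem_nhds ⟨hsA, hxC⟩)
    filter_upwards [h1, h2] with p hp1 hp2
    exact ⟨hp2.1, φ.map_source hp1, hp2.2⟩
  have h3 : ContinuousWithinAt (fun p : ℝ × X => iteratedFDerivWithin ℝ j
      (fun u => extChartAt I' y₀ (k (p.1, u))) (φ.target ∩ C) (φ p.2))
      {p | (p.1, φ p.2) ∈ A ×ˢ (φ.target ∩ C)} (s₀, x) :=
    ContinuousWithinAt.comp (g := fun p : ℝ × E => iteratedFDerivWithin ℝ j
      (fun u => extChartAt I' y₀ (k (p.1, u))) (φ.target ∩ C) p.2)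
      (f := fun p : ℝ × X => (p.1, φ p.2)) (x := (s₀, x)) (t := A ×ˢ (φ.target ∩ C))
      (hcont (s₀, φ x) ⟨hsA, φ.map_source hx', hxC⟩) hg.continuousWithinAt fun p hp => hp
  refine (h3.continuousAt hev).congr ?_
  filter_upwards [hev] with p hp
  exact iteratedFDerivWithin_inter_open hC hp.2.2

/-- A smooth family of smooth maps is continuous for the smooth topology. -/
theorem continuous_smoothTopology {F : ℝ × X → Y} (hF : ContMDiff (𝓘(ℝ, ℝ).prod I) I' ∞ F)
    {f : ℝ → C^∞⟮I, X; I', Y⟯} (hf : ∀ s x, f s x = F (s, x)) :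
    Continuous[inferInstance, smoothTopology I I'] f := by
  refine continuous_generateFrom_iff.2 ?_
  rintro _ ⟨g, x₀, y₀, K, r, ε, hK, hKx, hgK, hε, rfl⟩
  have hfs : ∀ s, (f s : X → Y) = fun z => F (s, z) := fun s => funext fun x => hf s x
  rw [isOpen_iff_mem_nhds]
  rintro s₀ ⟨h1, h2⟩
  -- Joint continuity at each point of `K` becomes an estimate uniform over `K` by compactness, here
  -- and for each of the finitely many orders below.
  have e1 : ∀ᶠ s in 𝓝 s₀, ∀ x ∈ K, F (s, x) ∈ (chartAt B' y₀).source := by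
    refine hK.eventually_forall_of_forall_eventually fun x hx => ?_
    have hy := h1 hx
    rw [hfs] at hy
    have hc : ContinuousAt (fun p : ℝ × X => F p) (s₀, x) := hF.continuous.continuousAt
    exact hc.eventually ((chartAt B' y₀).open_source.mem_nhds hy)
  have e2 : ∀ j ∈ Finset.range (r + 1), ∀ᶠ s in 𝓝 s₀, ∀ x ∈ K,
      ‖iteratedFDerivWithin ℝ j (extChartAt I' y₀ ∘ g ∘ (extChartAt I x₀).symm)
          (extChartAt I x₀).target (extChartAt I x₀ x) -
        iteratedFDerivWithin ℝ j (extChartAt I' y₀ ∘ (fun z => F (s, z)) ∘ (extChartAt I x₀).symm)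
          (extChartAt I x₀).target (extChartAt I x₀ x)‖ < ε := by
    intro j hj
    refine hK.eventually_forall_of_forall_eventually fun x hx => ?_
    have hy := h1 hx
    rw [hfs] at hy
    have c1 := continuousAt_iteratedFDerivWithin_chart hF (hKx hx) hy j
    have c2 := continuousAt_iteratedFDerivWithin_chart (F := fun p : ℝ × X => g p.2) (s₀ := s₀)
      (g.contMDiff.comp contMDiff_snd) (hKx hx) (hgK hx) j
    have hlt := h2 x hx j (by simpa [Nat.lt_succ_iff] using hj)
    rw [hfs] at hlt
    exact (c2.sub c1).norm.eventually (gt_mem_nhds hlt)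
  filter_upwards [e1, (Filter.eventually_all_finset _).2 e2] with s hs1 hs2
  refine ⟨fun x hx => ?_, fun x hx j hj => ?_⟩
  · rw [hfs]
    exact hs1 x hx
  · rw [hfs]
    exact hs2 j (by simpa [Nat.lt_succ_iff] using hj) x hx

end SmoothFamilies

end SymplecticClosing

namespace SymplecticClosing

/-! ### The top power of a nondegenerate form -/

section TopPower

/-- Symplectic Gram–Schmidt: normalize a pair with `B u w = 1` and continue in its `B`-orthogonal
complement, which has codimension two. -/
theorem exists_symplectic_family (n : ℕ) : ∀ {E : Type} [AddCommGroup E] [Module ℝ E]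
    [FiniteDimensional ℝ E], Module.finrank ℝ E = 2 * n → ∀ B : E →ₗ[ℝ] E →ₗ[ℝ] ℝ,
    (∀ x, B x x = 0) → (∀ x, (∀ y, B x y = 0) → x = 0) →
      ∃ p q : Fin n → E, (∀ i j, B (p i) (p j) = 0) ∧ (∀ i j, B (q i) (q j) = 0) ∧
        ∀ i j, B (p i) (q j) = if i = j then 1 else 0 := by
  induction n with
  | zero => exact fun _ _ _ _ => ⟨Fin.elim0, Fin.elim0, fun i => i.elim0, fun i => i.elim0,
      fun i => i.elim0⟩
  | succ n ih =>
    intro E _ _ _ hE B halt hnd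
    have hskew : ∀ x y, B x y = -B y x := by
      intro x y
      have h := halt (x + y)
      simp only [map_add, LinearMap.add_apply, halt] at h
      linarith
    obtain ⟨u, hu⟩ : ∃ u : E, u ≠ 0 := by
      have : Nontrivial E := Module.nontrivial_of_finrank_pos (R := ℝ) (by omega)
      exact exists_ne 0
    obtain ⟨w', hw'⟩ : ∃ w, B u w ≠ 0 := by
      by_contra! h
      exact hu (hnd u h)
    let w := (B u w')⁻¹ • w'
    have huw : B u w = 1 := by simp [w, hw']
    have hwu : B w u = -1 := by rw [hskew, huw]
    let A : E →ₗ[ℝ] ℝ × ℝ := (B u).prod (B w)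
    have hA : ∀ x, A x = (B u x, B w x) := fun _ => rfl
    have hsurj : Function.Surjective A := fun ab => ⟨ab.1 • w - ab.2 • u, by
      rw [hA]
      simp [huw, hwu, halt]⟩
    let W := LinearMap.ker A
    have hWd : Module.finrank ℝ W = 2 * n := by
      have h := LinearMap.finrank_range_add_finrank_ker A
      rw [LinearMap.range_eq_top.2 hsurj, finrank_top, Module.finrank_prod, Module.finrank_self,
        hE] at h
      change Module.finrank ℝ (LinearMap.ker A) = 2 * n
      omega
    have hWu : ∀ x : W, B u x = 0 ∧ B w x = 0 := fun x => by
      have h : A x = 0 := x.2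
      rw [hA] at h
      exact ⟨(Prod.ext_iff.1 h).1, (Prod.ext_iff.1 h).2⟩
    let B' : W →ₗ[ℝ] W →ₗ[ℝ] ℝ := B.compl₁₂ W.subtype W.subtype
    have hB' : ∀ x y, B' x y = B x y := fun _ _ => rfl
    obtain ⟨p, q, hpp, hqq, hpq⟩ := ih hWd B' (fun x => halt x) (fun x hx => by
      refine Subtype.ext (hnd _ fun z => ?_)
      -- The projection of `z` to the complement. Pairing an element of `W` with it gives the same
      -- value as with `z`, so `B` is nondegenerate on `W`.
      have hz : z - B u z • w + B w z • u ∈ W := by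
        change A _ = 0
        rw [hA]
        simp [huw, hwu, halt]
      have h1 := hx ⟨_, hz⟩
      rw [hB'] at h1
      simp only [map_add, map_sub, map_smul] at h1
      rw [hskew x u, hskew x w, (hWu x).1, (hWu x).2] at h1
      simpa using h1)
    refine ⟨Fin.cons u fun i => p i, Fin.cons w fun i => q i, ?_, ?_, ?_⟩
    · intro i j
      refine Fin.cases ?_ (fun i => ?_) i <;> refine Fin.cases ?_ (fun j => ?_) j
      · simp [halt]
      · simp [(hWu (p j)).1]
      · simp [hskew (p i) u, (hWu (p i)).1]
      · exact hpp i j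
    · intro i j
      refine Fin.cases ?_ (fun i => ?_) i <;> refine Fin.cases ?_ (fun j => ?_) j
      · simp [halt]
      · simp [(hWu (q j)).2]
      · simp [hskew (q i) w, (hWu (q i)).2]
      · exact hqq i j
    · intro i j
      refine Fin.cases ?_ (fun i => ?_) i <;> refine Fin.cases ?_ (fun j => ?_) j
      · simp [huw]
      · simp [(hWu (q j)).1, (Fin.succ_ne_zero j).symm]
      · simp [hskew (p i) w, (hWu (p i)).2]
      · simpa [hB'] using hpq i j

variable {E : Type*} [AddCommGroup E] [Module ℝ E]

/-- The multilinear map `v ↦ ∏ i, B (v (i, 0)) (v (i, 1))`. -/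
noncomputable def pairProduct (n : ℕ) (B : E →ₗ[ℝ] E →ₗ[ℝ] ℝ) :
    MultilinearMap ℝ (fun _ : Fin n × Fin 2 => E) ℝ :=
  MultilinearMap.mk' (fun v => ∏ i, B (v (i, 0)) (v (i, 1)))
    (by
      rintro v ⟨i, j⟩ x y
      rw [Fintype.prod_eq_mul_prod_compl i, Fintype.prod_eq_mul_prod_compl i,
        Fintype.prod_eq_mul_prod_compl i]
      have h : ∀ z : E, ∏ k ∈ ({i} : Finset (Fin n))ᶜ, B (Function.update v (i, j) z (k, 0))
          (Function.update v (i, j) z (k, 1)) = ∏ k ∈ ({i} : Finset (Fin n))ᶜ,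
          B (v (k, 0)) (v (k, 1)) := by
        intro z
        refine Finset.prod_congr rfl fun k hk => ?_
        have hk' : k ≠ i := by simpa using hk
        rw [Function.update_of_ne (fun h => hk' (Prod.ext_iff.1 h).1),
          Function.update_of_ne (fun h => hk' (Prod.ext_iff.1 h).1)]
      simp only [h]
      rw [← add_mul]
      congr 1
      fin_cases j <;> simp)
    (by
      rintro v ⟨i, j⟩ c x
      rw [Fintype.prod_eq_mul_prod_compl i, Fintype.prod_eq_mul_prod_compl i]
      have h : ∀ z : E, ∏ k ∈ ({i} : Finset (Fin n))ᶜ, B (Function.update v (i, j) z (k, 0))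
          (Function.update v (i, j) z (k, 1)) = ∏ k ∈ ({i} : Finset (Fin n))ᶜ,
          B (v (k, 0)) (v (k, 1)) := by
        intro z
        refine Finset.prod_congr rfl fun k hk => ?_
        have hk' : k ≠ i := by simpa using hk
        rw [Function.update_of_ne (fun h => hk' (Prod.ext_iff.1 h).1),
          Function.update_of_ne (fun h => hk' (Prod.ext_iff.1 h).1)]
      simp only [h]
      rw [smul_eq_mul, ← mul_assoc]
      congr 1
      fin_cases j <;> simp)

/-- The alternating map `2ⁿ Bⁿ`. -/
noncomputable def pairAlternating (n : ℕ) (B : E →ₗ[ℝ] E →ₗ[ℝ] ℝ) :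
    E [⋀^Fin n × Fin 2]→ₗ[ℝ] ℝ := MultilinearMap.alternatization (pairProduct n B)

theorem pairAlternating_apply (n : ℕ) (B : E →ₗ[ℝ] E →ₗ[ℝ] ℝ) (v : Fin n × Fin 2 → E) :
    pairAlternating n B v = ∑ σ : Equiv.Perm (Fin n × Fin 2), ((Equiv.Perm.sign σ : ℤ) : ℝ) *
      ∏ i, B (v (σ (i, 0))) (v (σ (i, 1))) := by
  rw [pairAlternating, MultilinearMap.alternatization_apply]
  refine Finset.sum_congr rfl fun σ _ => ?_
  rw [MultilinearMap.domDomCongr_apply, Units.smul_def, zsmul_eq_mul]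
  rfl

/-- A nonzero term forces `σ` to map pairs to pairs. Then `σ` is a permutation of the pairs composed
with swaps inside them. The former moves both members of a pair in the same way, so its sign is a
square; the sign of each swap occurs a second time as the corresponding factor of the product. -/
theorem pairAlternating_term_nonneg {n : ℕ} {B : E →ₗ[ℝ] E →ₗ[ℝ] ℝ} {v : Fin n × Fin 2 → E}
    (hv : ∀ d d', B (v d) (v d') = if d.1 = d'.1 ∧ d.2 ≠ d'.2 then (if d.2 = 0 then 1 else -1)
      else 0) (σ : Equiv.Perm (Fin n × Fin 2)) :
    0 ≤ ((Equiv.Perm.sign σ : ℤ) : ℝ) * ∏ i, B (v (σ (i, 0))) (v (σ (i, 1))) := by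
  by_cases h0 : ∃ i, B (v (σ (i, 0))) (v (σ (i, 1))) = 0
  · obtain ⟨i, hi⟩ := h0
    rw [Finset.prod_eq_zero (Finset.mem_univ i) hi, mul_zero]
  push Not at h0
  have hσ : ∀ i, (σ (i, 0)).1 = (σ (i, 1)).1 ∧ (σ (i, 0)).2 ≠ (σ (i, 1)).2 := by
    intro i
    by_contra h
    exact h0 i (by rw [hv, if_neg h])
  let f : Fin n → Equiv.Perm (Fin 2) := fun i =>
    if (σ (i, 0)).2 = 0 then 1 else Equiv.swap 0 1
  have hf : ∀ i j, σ (i, j) = ((σ (i, 0)).1, f i j) := by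
    intro i j
    have h1 := hσ i
    refine Prod.ext ?_ ?_
    · fin_cases j
      · rfl
      · exact h1.1.symm
    · simp only [f]
      fin_cases j
      · split_ifs with h
        · exact h
        · simp only [Fin.zero_eta, Equiv.swap_apply_left]; omega
      · split_ifs with h
        · simp only [Fin.mk_one, Equiv.Perm.coe_one, id]; omega
        · simp only [Fin.mk_one, Equiv.swap_apply_right]; omega
  have hτ : Function.Bijective fun i => (σ (i, 0)).1 := by
    rw [← Finite.surjective_iff_bijective]
    intro k
    obtain ⟨⟨i, j⟩, hij⟩ := σ.surjective (k, 0)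
    refine ⟨i, ?_⟩
    rw [hf] at hij
    exact (Prod.ext_iff.1 hij).1
  let τ : Equiv.Perm (Fin n) := Equiv.ofBijective _ hτ
  have hσeq : σ = (Equiv.prodCongrLeft fun _ : Fin 2 => τ) * Equiv.prodCongrRight f := by
    ext1 ⟨i, j⟩
    exact hf i j
  have hsign : Equiv.Perm.sign σ = ∏ i, Equiv.Perm.sign (f i) := by
    rw [hσeq, map_mul, Equiv.Perm.sign_prodCongrLeft, Equiv.Perm.sign_prodCongrRight]
    simp
  have hterm : ∀ i, B (v (σ (i, 0))) (v (σ (i, 1))) = ((Equiv.Perm.sign (f i) : ℤ) : ℝ) := by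
    intro i
    rw [hv, if_pos (hσ i)]
    simp only [f]
    split_ifs with h
    · simp
    · rw [Equiv.Perm.sign_swap (by decide)]; simp
  simp only [hterm, hsign]
  push_cast
  rw [← Finset.prod_mul_distrib]
  exact Finset.prod_nonneg fun i _ => mul_self_nonneg _

theorem pairAlternating_pos {n : ℕ} {B : E →ₗ[ℝ] E →ₗ[ℝ] ℝ} {v : Fin n × Fin 2 → E}
    (hv : ∀ d d', B (v d) (v d') = if d.1 = d'.1 ∧ d.2 ≠ d'.2 then (if d.2 = 0 then 1 else -1)
      else 0) : 0 < pairAlternating n B v := by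
  rw [pairAlternating_apply]
  refine Finset.sum_pos' (fun σ _ => pairAlternating_term_nonneg hv σ) ⟨1, Finset.mem_univ _, ?_⟩
  simp [hv]

/-- The indexing of the standard basis by pairs. -/
def pairIndex (n : ℕ) : Fin n × Fin 2 ≃ Fin (2 * n) :=
  finProdFinEquiv.trans (finCongr (mul_comm n 2))

theorem pairIndex_zero {n : ℕ} (i : Fin n) : pairIndex n (i, 0) = ⟨2 * i, by omega⟩ := by
  ext
  simp [pairIndex]

theorem pairIndex_one {n : ℕ} (i : Fin n) : pairIndex n (i, 1) = ⟨2 * i + 1, by omega⟩ := by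
  ext
  simp [pairIndex]
  ring

/-- The standard basis, indexed by pairs. -/
noncomputable def pairBasis (n : ℕ) :
    Module.Basis (Fin n × Fin 2) ℝ (EuclideanSpace ℝ (Fin (2 * n))) :=
  (EuclideanSpace.basisFun (Fin (2 * n)) ℝ).toBasis.reindex (pairIndex n).symm

theorem pairBasis_apply {n : ℕ} (d : Fin n × Fin 2) :
    pairBasis n d = EuclideanSpace.single (pairIndex n d) 1 := by
  simp [pairBasis]

/-- A bounded bilinear form, as an algebraic bilinear form. -/
noncomputable def bilinOf {n : ℕ} (α : EuclideanSpace ℝ (Fin (2 * n)) [⋀^Fin 2]→L[ℝ] ℝ) :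
    EuclideanSpace ℝ (Fin (2 * n)) →ₗ[ℝ] EuclideanSpace ℝ (Fin (2 * n)) →ₗ[ℝ] ℝ :=
  ContinuousLinearMap.toLinearMap₁₂ (toBilin _ α)

theorem bilinOf_apply {n : ℕ} (α : EuclideanSpace ℝ (Fin (2 * n)) [⋀^Fin 2]→L[ℝ] ℝ)
    (u w : EuclideanSpace ℝ (Fin (2 * n))) : bilinOf α u w = α ![u, w] := toBilin_apply α u w

theorem topPower_eq {n : ℕ} (α : EuclideanSpace ℝ (Fin (2 * n)) [⋀^Fin 2]→L[ℝ] ℝ) :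
    topPower α = (1 / 2 ^ n) * pairAlternating n (bilinOf α) (pairBasis n) := by
  rw [topPower, pairAlternating_apply]
  congr 1
  refine (Fintype.sum_equiv (pairIndex n).permCongr _ _ fun σ => ?_).symm
  rw [Equiv.Perm.sign_permCongr]
  congr 1
  refine Finset.prod_congr rfl fun i _ => ?_
  rw [bilinOf_apply, pairBasis_apply, pairBasis_apply, ← pairIndex_zero, ← pairIndex_one,
    Equiv.permCongr_apply, Equiv.permCongr_apply, Equiv.symm_apply_apply, Equiv.symm_apply_apply]

/-- An alternating map of top degree is a multiple of the determinant. This is the transformation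
law that makes the densities in different charts agree. -/
theorem topPower_comp {n : ℕ} (α : EuclideanSpace ℝ (Fin (2 * n)) [⋀^Fin 2]→L[ℝ] ℝ)
    (A : EuclideanSpace ℝ (Fin (2 * n)) →L[ℝ] EuclideanSpace ℝ (Fin (2 * n))) :
    topPower (α.compContinuousLinearMap A) = A.det * topPower α := by
  have h1 : pairAlternating n (bilinOf (α.compContinuousLinearMap A)) (pairBasis n) =
      pairAlternating n (bilinOf α) (A ∘ pairBasis n) := by
    rw [pairAlternating_apply, pairAlternating_apply]
    refine Finset.sum_congr rfl fun σ _ => ?_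
    congr 1
    refine Finset.prod_congr rfl fun i _ => ?_
    rw [bilinOf_apply, bilinOf_apply]
    change α (A ∘ _) = _
    congr 1
    ext1 j
    fin_cases j <;> rfl
  rw [topPower_eq, topPower_eq, h1]
  conv_lhs => rw [(pairAlternating n (bilinOf α)).eq_smul_basis_det (pairBasis n)]
  rw [AlternatingMap.smul_apply, smul_eq_mul]
  have h2 := (pairBasis n).det_comp (A : EuclideanSpace ℝ (Fin (2 * n)) →ₗ[ℝ] _) (pairBasis n)
  rw [(pairBasis n).det_self, mul_one] at h2
  have h3 : (pairBasis n).det (A ∘ pairBasis n) = A.det := h2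
  rw [h3]
  ring

/-- If the value on the standard basis were zero, the alternating map of top degree would vanish
identically, but it is positive on a symplectic family. -/
theorem topPower_ne_zero {n : ℕ} (α : EuclideanSpace ℝ (Fin (2 * n)) [⋀^Fin 2]→L[ℝ] ℝ)
    (hα : ∀ u, (∀ w, α ![u, w] = 0) → u = 0) : topPower α ≠ 0 := by
  have halt : ∀ x, bilinOf α x x = 0 := fun x => by
    rw [bilinOf_apply]
    exact α.map_eq_zero_of_eq _ (i := 0) (j := 1) rfl (by decide)
  have hskew : ∀ x y, bilinOf α x y = -bilinOf α y x := by
    intro x y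
    have h := halt (x + y)
    simp only [map_add, LinearMap.add_apply, halt] at h
    linarith
  obtain ⟨p, q, hpp, hqq, hpq⟩ := exists_symplectic_family n (by simp) (bilinOf α) halt
    (fun x hx => hα x fun w => by rw [← bilinOf_apply]; exact hx w)
  have hpos := pairAlternating_pos (n := n) (B := bilinOf α)
    (v := fun d => if d.2 = 0 then p d.1 else q d.1) (by
      rintro ⟨i, j⟩ ⟨i', j'⟩
      fin_cases j <;> fin_cases j' <;> simp [hpp, hqq, hpq]
      rw [hskew, hpq]
      rcases eq_or_ne i i' with rfl | h
      · simp
      · simp [h, h.symm])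
  rw [topPower_eq]
  intro h0
  have h1 : pairAlternating n (bilinOf α) (pairBasis n) = 0 := by
    rcases mul_eq_zero.1 h0 with h | h
    · simp at h
    · exact h
  rw [(pairAlternating n (bilinOf α)).eq_smul_basis_det (pairBasis n), h1, zero_smul] at hpos
  simp at hpos

theorem continuous_topPower {n : ℕ} :
    Continuous (topPower : (EuclideanSpace ℝ (Fin (2 * n)) [⋀^Fin 2]→L[ℝ] ℝ) → ℝ) := by
  unfold topPower
  simp only [← toBilin_apply]
  fun_prop

end TopPower

end SymplecticClosing

namespace SymplecticClosing

/-! ### The symplectic volume -/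

section Volume

variable {n : ℕ} {M : Type*} [TopologicalSpace M] [ChartedSpace (EuclideanSpace ℝ (Fin (2 * n))) M]
  (Ω : SymplecticForm n M)

/-- The density of the volume in a chart. -/
noncomputable def chartDensity (x₀ : M) (y : EuclideanSpace ℝ (Fin (2 * n))) : ENNReal :=
  ENNReal.ofReal |topPower (formInChart Ω.form x₀ y)|

/-- The volume of the part of a set in a chart domain. -/
noncomputable def chartMeasure [MeasurableSpace M] (x₀ : M) : Measure M :=
  (((volume : Measure (EuclideanSpace ℝ (Fin (2 * n)))).restrict
    (extChartAt (𝓡 (2 * n)) x₀).target).withDensity (chartDensity Ω x₀)).map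
      (extChartAt (𝓡 (2 * n)) x₀).symm

theorem volume_eq_iSup [MeasurableSpace M] : Ω.volume = ⨆ x₀, chartMeasure Ω x₀ := rfl

theorem continuousOn_topPower_chart (x₀ : M) :
    ContinuousOn (fun y => |topPower (formInChart Ω.form x₀ y)|) (extChartAt (𝓡 (2 * n)) x₀).target :=
  (continuous_topPower.comp_continuousOn (Ω.smooth x₀).continuousOn).abs

theorem chartMeasure_apply [MeasurableSpace M] [BorelSpace M] (x₀ : M) {S : Set M}
    (hS : MeasurableSet S) : chartMeasure Ω x₀ S =
      ∫⁻ y in (extChartAt (𝓡 (2 * n)) x₀).symm ⁻¹' S ∩ (extChartAt (𝓡 (2 * n)) x₀).target,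
        chartDensity Ω x₀ y := by
  have hT : MeasurableSet (extChartAt (𝓡 (2 * n)) x₀).target :=
    (isOpen_extChartAt_target x₀).measurableSet
  have hm : AEMeasurable (extChartAt (𝓡 (2 * n)) x₀).symm
      (((volume : Measure (EuclideanSpace ℝ (Fin (2 * n)))).restrict
        (extChartAt (𝓡 (2 * n)) x₀).target).withDensity (chartDensity Ω x₀)) :=
    ((continuousOn_extChartAt_symm x₀).aemeasurable hT).mono_ac (withDensity_absolutelyContinuous _ _)
  rw [chartMeasure, Measure.map_apply_of_aemeasurable hm hS, withDensity_apply',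
    Measure.restrict_restrict' hT]

theorem measurableSet_symm_preimage [MeasurableSpace M] [BorelSpace M] (x₀ : M) {S : Set M}
    (hS : MeasurableSet S) : MeasurableSet
      ((extChartAt (𝓡 (2 * n)) x₀).symm ⁻¹' S ∩ (extChartAt (𝓡 (2 * n)) x₀).target) := by
  have hT : MeasurableSet (extChartAt (𝓡 (2 * n)) x₀).target :=
    (isOpen_extChartAt_target x₀).measurableSet
  have h1 := (continuousOn_iff_continuous_domRestrict.1
    (continuousOn_extChartAt_symm (I := 𝓡 (2 * n)) x₀)).measurable hS
  have h2 := hT.subtype_image h1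
  convert h2 using 1
  ext y
  simp [and_comm]

variable [IsManifold (𝓡 (2 * n)) ∞ M]

/-- The measures in two charts agree on the overlap of the chart domains. -/
theorem chartMeasure_eq [MeasurableSpace M] [BorelSpace M] (x₀ x₁ : M) {S : Set M}
    (hS : MeasurableSet S) (h0 : S ⊆ (extChartAt (𝓡 (2 * n)) x₀).source)
    (h1 : S ⊆ (extChartAt (𝓡 (2 * n)) x₁).source) :
    chartMeasure Ω x₀ S = chartMeasure Ω x₁ S := by
  let E := EuclideanSpace ℝ (Fin (2 * n))
  rw [chartMeasure_apply Ω x₀ hS, chartMeasure_apply Ω x₁ hS]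
  set φ := extChartAt (𝓡 (2 * n)) x₀ with hφ
  set ψ := extChartAt (𝓡 (2 * n)) x₁ with hψ
  let τ : E → E := fun y => ψ (φ.symm y)
  have hA : MeasurableSet (φ.symm ⁻¹' S ∩ φ.target) := measurableSet_symm_preimage x₀ hS
  have hN : IsOpen (φ.target ∩ φ.symm ⁻¹' ψ.source) :=
    (continuousOn_extChartAt_symm x₀).isOpen_inter_preimage (isOpen_extChartAt_target x₀)
      (isOpen_extChartAt_source x₁)
  have hAN : φ.symm ⁻¹' S ∩ φ.target ⊆ φ.target ∩ φ.symm ⁻¹' ψ.source := fun y hy =>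
    ⟨hy.2, h1 hy.1⟩
  have himage : ψ.symm ⁻¹' S ∩ ψ.target = τ '' (φ.symm ⁻¹' S ∩ φ.target) := by
    ext z
    constructor
    · rintro ⟨hz, hzT⟩
      refine ⟨φ (ψ.symm z), ⟨?_, φ.map_source (h0 hz)⟩, ?_⟩
      · rw [mem_preimage, φ.left_inv (h0 hz)]; exact hz
      · simp only [τ]
        rw [φ.left_inv (h0 hz), ψ.right_inv hzT]
    · rintro ⟨y, ⟨hy, hyT⟩, rfl⟩
      refine ⟨?_, ψ.map_source (h1 hy)⟩
      simp only [τ, mem_preimage]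
      rw [ψ.left_inv (h1 hy)]
      exact hy
  have hinj : InjOn τ (φ.symm ⁻¹' S ∩ φ.target) := by
    rintro y ⟨hy, hyT⟩ z ⟨hz, hzT⟩ hyz
    have h2 := ψ.injOn (h1 hy) (h1 hz) hyz
    exact φ.symm.injOn hyT hzT h2
  have hτ : ContDiffOn ℝ ∞ τ (φ.target ∩ φ.symm ⁻¹' ψ.source) := by
    rw [← contMDiffOn_iff_contDiffOn]
    refine (contMDiffOn_extChartAt (x := x₁)).comp
      ((contMDiffOn_extChartAt_symm x₀).mono inter_subset_left) ?_
    intro y hy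
    have := hy.2
    rwa [mem_preimage, hψ, extChartAt_source] at this
  have hτd : ∀ y ∈ φ.symm ⁻¹' S ∩ φ.target, HasFDerivAt τ (fderiv ℝ τ y) y := fun y hy =>
    ((hτ.contDiffAt (hN.mem_nhds (hAN hy))).differentiableAt (by simp)).hasFDerivAt
  -- Change of variables: the Jacobian of the transition map is exactly the factor by which the top
  -- power of the form changes.
  rw [himage, lintegral_image_eq_lintegral_abs_det_fderiv_mul volume hA
    (fun y hy => (hτd y hy).hasFDerivWithinAt) hinj]
  refine setLIntegral_congr_fun hA fun y hy => ?_
  have hform : formInChart Ω.form x₀ y =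
      (formInChart Ω.form x₁ (τ y)).compContinuousLinearMap (fderiv ℝ τ y) := by
    have hsymm : ψ.symm (τ y) = φ.symm y := ψ.left_inv (h1 hy.1)
    have hτy : τ y ∈ ψ.target := ψ.map_source (h1 hy.1)
    have e1 : HasMFDerivAt 𝓘(ℝ, E) 𝓘(ℝ, E) τ y (fderiv ℝ τ y) := (hτd y hy).hasMFDerivAt
    have e2 : HasMFDerivAt 𝓘(ℝ, E) (𝓡 (2 * n)) ψ.symm (τ y)
        (mfderiv 𝓘(ℝ, E) (𝓡 (2 * n)) ψ.symm (τ y)) :=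
      (((contMDiffOn_extChartAt_symm (n := ∞) x₁).contMDiffAt
        ((isOpen_extChartAt_target x₁).mem_nhds hτy)).mdifferentiableAt (by simp)).hasMFDerivAt
    have e3 := (e2.comp y e1).mfderiv
    have e4 : ψ.symm ∘ τ =ᶠ[𝓝 y] φ.symm := by
      filter_upwards [hN.mem_nhds (hAN hy)] with z hz
      exact ψ.left_inv hz.2
    have e5 : ∀ u : E, (mfderiv 𝓘(ℝ, E) (𝓡 (2 * n)) φ.symm y : E →L[ℝ] E) u =
        (mfderiv 𝓘(ℝ, E) (𝓡 (2 * n)) ψ.symm (τ y) : E →L[ℝ] E) (fderiv ℝ τ y u) := fun u =>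
      congrArg (fun A : E →L[ℝ] E => A u)
        ((e4.mfderiv_eq (I := 𝓘(ℝ, E)) (I' := 𝓡 (2 * n))).symm.trans e3)
    ext v
    change Ω.alt (φ.symm y) (fun i => (mfderiv 𝓘(ℝ, E) (𝓡 (2 * n)) φ.symm y : E →L[ℝ] E) (v i)) =
      Ω.alt (ψ.symm (τ y)) (fun i => (mfderiv 𝓘(ℝ, E) (𝓡 (2 * n)) ψ.symm (τ y) : E →L[ℝ] E)
        (fderiv ℝ τ y (v i)))
    rw [hsymm]
    congr 1
    ext1 i
    exact e5 _
  simp only [chartDensity]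
  rw [hform, topPower_comp, abs_mul, ENNReal.ofReal_mul (abs_nonneg _)]

omit [IsManifold (𝓡 (2 * n)) ∞ M] in
theorem exists_nhd_chartMeasure_lt_top [MeasurableSpace M] [BorelSpace M] (x : M) :
    ∃ W, IsOpen W ∧ x ∈ W ∧ W ⊆ (extChartAt (𝓡 (2 * n)) x).source ∧ chartMeasure Ω x W < ⊤ := by
  set φ := extChartAt (𝓡 (2 * n)) x with hφ
  obtain ⟨r, hr, hrT⟩ := Metric.nhds_basis_closedBall.mem_iff.1
    ((isOpen_extChartAt_target x).mem_nhds (mem_extChartAt_target (I := 𝓡 (2 * n)) x))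
  have hW : IsOpen (φ.source ∩ φ ⁻¹' Metric.ball (φ x) r) :=
    (continuousOn_extChartAt x).isOpen_inter_preimage (isOpen_extChartAt_source x) Metric.isOpen_ball
  refine ⟨_, hW, ⟨mem_extChartAt_source x, Metric.mem_ball_self hr⟩, inter_subset_left, ?_⟩
  rw [chartMeasure_apply Ω x hW.measurableSet]
  have hsub : φ.symm ⁻¹' (φ.source ∩ φ ⁻¹' Metric.ball (φ x) r) ∩ φ.target ⊆
      Metric.closedBall (φ x) r := by
    rintro y ⟨hy, hyT⟩
    have := hy.2
    rw [mem_preimage, φ.right_inv hyT] at this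
    exact Metric.ball_subset_closedBall this
  refine (lintegral_mono_set hsub).trans_lt ?_
  have hint := ((continuousOn_topPower_chart Ω x).mono hrT).integrableOn_compact
    (μ := (volume : Measure (EuclideanSpace ℝ (Fin (2 * n))))) (isCompact_closedBall (φ x) r)
  exact hint.lintegral_lt_top

/-- Finitely many neighbourhoods of finite chart measure cover `M`. Cutting a set along this cover
and changing charts on each piece bounds every chart measure, and so their supremum, by one finite
sum. -/
theorem isFiniteMeasure_volume [MeasurableSpace M] [BorelSpace M] [CompactSpace M] :
    IsFiniteMeasure Ω.volume := by
  choose W hWo hxW hWs hWfin using exists_nhd_chartMeasure_lt_top Ω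
  obtain ⟨t, ht⟩ := isCompact_univ.elim_finite_subcover W hWo fun x _ => mem_iUnion.2 ⟨x, hxW x⟩
  have hle : Ω.volume ≤ ∑ x ∈ t, (chartMeasure Ω x).restrict (W x) := by
    rw [volume_eq_iSup]
    refine iSup_le fun x₀ => Measure.le_iff.2 fun S hS => ?_
    have hsrc : MeasurableSet (extChartAt (𝓡 (2 * n)) x₀).source :=
      (isOpen_extChartAt_source x₀).measurableSet
    have h1 : chartMeasure Ω x₀ S = chartMeasure Ω x₀ (S ∩ (extChartAt (𝓡 (2 * n)) x₀).source) := by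
      rw [chartMeasure_apply Ω x₀ hS, chartMeasure_apply Ω x₀ (hS.inter hsrc)]
      congr 2
      ext y
      exact ⟨fun h => ⟨⟨h.1, (extChartAt (𝓡 (2 * n)) x₀).map_target h.2⟩, h.2⟩,
        fun h => ⟨h.1.1, h.2⟩⟩
    rw [h1]
    have h2 : S ∩ (extChartAt (𝓡 (2 * n)) x₀).source ⊆
        ⋃ x ∈ t, S ∩ W x ∩ (extChartAt (𝓡 (2 * n)) x₀).source := by
      intro z hz
      obtain ⟨x, hx, hzx⟩ := mem_iUnion₂.1 (ht (mem_univ z))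
      exact mem_iUnion₂.2 ⟨x, hx, ⟨hz.1, hzx⟩, hz.2⟩
    refine (measure_mono h2).trans ((measure_biUnion_finset_le _ _).trans ?_)
    rw [Measure.finsetSum_apply]
    refine Finset.sum_le_sum fun x _ => ?_
    rw [Measure.restrict_apply hS, chartMeasure_eq Ω x₀ x
      ((hS.inter (hWo x).measurableSet).inter hsrc) inter_subset_right
      (fun z hz => hWs x hz.1.2)]
    exact measure_mono inter_subset_left
  refine ⟨(hle univ).trans_lt ?_⟩
  rw [Measure.finsetSum_apply]
  refine ENNReal.sum_lt_top.2 fun x _ => ?_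
  rw [Measure.restrict_apply MeasurableSet.univ, univ_inter]
  exact hWfin x

theorem topPower_chart_ne_zero (x₀ : M) {y : EuclideanSpace ℝ (Fin (2 * n))}
    (hy : y ∈ (extChartAt (𝓡 (2 * n)) x₀).target) : topPower (formInChart Ω.form x₀ y) ≠ 0 := by
  let E := EuclideanSpace ℝ (Fin (2 * n))
  set φ := extChartAt (𝓡 (2 * n)) x₀ with hφ
  have h1 : HasMFDerivAt 𝓘(ℝ, E) (𝓡 (2 * n)) φ.symm y (mfderiv 𝓘(ℝ, E) (𝓡 (2 * n)) φ.symm y) :=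
    (((contMDiffOn_extChartAt_symm (n := ∞) x₀).contMDiffAt
      ((isOpen_extChartAt_target x₀).mem_nhds hy)).mdifferentiableAt (by simp)).hasMFDerivAt
  have h2 : HasMFDerivAt (𝓡 (2 * n)) 𝓘(ℝ, E) φ (φ.symm y)
      (mfderiv (𝓡 (2 * n)) 𝓘(ℝ, E) φ (φ.symm y)) := by
    refine (((contMDiffOn_extChartAt (n := ∞) (x := x₀)).contMDiffAt
      ((chartAt _ x₀).open_source.mem_nhds ?_)).mdifferentiableAt (by simp)).hasMFDerivAt
    have := φ.map_target hy
    rwa [hφ, extChartAt_source] at this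
  let A : E →L[ℝ] E := mfderiv 𝓘(ℝ, E) (𝓡 (2 * n)) φ.symm y
  let C : E →L[ℝ] E := mfderiv (𝓡 (2 * n)) 𝓘(ℝ, E) φ (φ.symm y)
  have h3 := HasMFDerivAt.comp y h2 h1
  have h4 : φ ∘ φ.symm =ᶠ[𝓝 y] id := by
    filter_upwards [(isOpen_extChartAt_target x₀).mem_nhds hy] with z hz
    exact φ.right_inv hz
  have h5 : ∀ u : E, C (A u) = u := fun u => by
    have h6 := congrArg (fun D : E →L[ℝ] E => D u)
      ((h3.mfderiv.symm.trans (h4.mfderiv_eq (I := 𝓘(ℝ, E)) (I' := 𝓘(ℝ, E)))).trans mfderiv_id)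
    exact h6
  have hinj : Function.Injective A := fun a b hab => by rw [← h5 a, hab, h5]
  have hsurj : Function.Surjective A :=
    (LinearMap.injective_iff_surjective (f := (A : E →ₗ[ℝ] E))).1 hinj
  have hform : formInChart Ω.form x₀ y = (Ω.alt (φ.symm y)).compContinuousLinearMap A := rfl
  refine topPower_ne_zero _ fun u hu => hinj ?_
  rw [map_zero]
  refine Ω.nondegenerate (φ.symm y) _ fun w => ?_
  obtain ⟨w', rfl⟩ := hsurj w
  have := hu w'
  rw [hform] at this
  refine Eq.trans ?_ this
  change Ω.alt (φ.symm y) _ = Ω.alt (φ.symm y) _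
  congr 1
  ext1 i
  fin_cases i <;> rfl

theorem isOpenPosMeasure_volume [MeasurableSpace M] [BorelSpace M] :
    Ω.volume.IsOpenPosMeasure := by
  refine ⟨fun U hU hUne hzero => ?_⟩
  obtain ⟨x₀, hx₀⟩ := hUne
  have h1 : chartMeasure Ω x₀ U = 0 :=
    le_antisymm ((le_iSup (chartMeasure Ω) x₀ U).trans hzero.le) zero_le
  rw [chartMeasure_apply Ω x₀ hU.measurableSet] at h1
  set φ := extChartAt (𝓡 (2 * n)) x₀ with hφ
  have hA : IsOpen (φ.symm ⁻¹' U ∩ φ.target) := by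
    rw [inter_comm]
    exact (continuousOn_extChartAt_symm x₀).isOpen_inter_preimage (isOpen_extChartAt_target x₀) hU
  have hne : (φ.symm ⁻¹' U ∩ φ.target).Nonempty :=
    ⟨φ x₀, by rw [mem_preimage, hφ, extChartAt_to_inv]; exact hx₀, mem_extChartAt_target x₀⟩
  have hmeas : AEMeasurable (chartDensity Ω x₀)
      ((volume : Measure (EuclideanSpace ℝ (Fin (2 * n)))).restrict (φ.symm ⁻¹' U ∩ φ.target)) :=
    (((continuousOn_topPower_chart Ω x₀).mono inter_subset_right).aemeasurable
      hA.measurableSet).ennreal_ofReal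
  have h2 := (lintegral_eq_zero_iff' hmeas).1 h1
  have h3 : ∀ᵐ y ∂((volume : Measure (EuclideanSpace ℝ (Fin (2 * n)))).restrict
      (φ.symm ⁻¹' U ∩ φ.target)), False := by
    filter_upwards [h2, ae_restrict_mem hA.measurableSet] with y hy hyA
    have h4 : 0 < |topPower (formInChart Ω.form x₀ y)| :=
      abs_pos.2 (topPower_chart_ne_zero Ω x₀ hyA.2)
    have h5 : chartDensity Ω x₀ y = 0 := hy
    rw [chartDensity, ENNReal.ofReal_eq_zero] at h5
    linarith
  rw [eventually_false_iff_eq_bot, ae_eq_bot, Measure.restrict_eq_zero] at h3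
  exact (hA.measure_pos _ hne).ne' h3

end Volume

/-! ### The average of a perturbed Hamiltonian. -/

section Average

variable {n : ℕ} {M : Type*} [TopologicalSpace M] [ChartedSpace (EuclideanSpace ℝ (Fin (2 * n))) M]
  [IsManifold (𝓡 (2 * n)) ∞ M] [CompactSpace M] [MeasurableSpace M] [BorelSpace M]
  (Ω : SymplecticForm n M)

omit [IsManifold (𝓡 (2 * n)) ∞ M] [CompactSpace M] [MeasurableSpace M] [BorelSpace M] in
theorem integral_deriv_lateStep : ∫ t : unitInterval, deriv lateStep t = 1 := by
  have h1 : ∫ t : unitInterval, deriv lateStep t = ∫ t in Icc (0 : ℝ) 1, deriv lateStep t :=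
    integral_subtype_comap measurableSet_Icc (deriv lateStep)
  have hc : Continuous (deriv lateStep) :=
    (contDiff_infty_iff_deriv.1 contDiff_lateStep).2.continuous
  rw [h1, integral_Icc_eq_integral_Ioc, ← intervalIntegral.integral_of_le zero_le_one,
    intervalIntegral.integral_deriv_eq_sub
      (fun t _ => (contDiff_lateStep.differentiable (by simp)).differentiableAt)
      (hc.intervalIntegrable _ _), lateStep_one, lateStep_eq_zero (by norm_num), sub_zero]

/-- The time factor of the perturbation has integral one, so the perturbation adds `c` times the
average of `G`. -/
theorem average_pertHam [T2Space M] {K : ℝ × M → ℝ} {G : M → ℝ} {c : ℝ}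
    (hK : ContMDiff (𝓘(ℝ, ℝ).prod (𝓡 (2 * n))) 𝓘(ℝ, ℝ) ∞ K)
    (hG : Continuous G)
    (hKc : ContMDiff (𝓘(ℝ, ℝ).prod (𝓡 (2 * n))) 𝓘(ℝ, ℝ) ∞ (pertHam K G c)) :
    average Ω (toHam (pertHam K G c) hKc) = average Ω (toHam K hK) +
      c * (1 / Ω.volume.real univ * ∫ x, G x ∂Ω.volume) := by
  have := isFiniteMeasure_volume Ω
  have hint : ∀ f : M → ℝ, Continuous f → Integrable f Ω.volume := fun f hf =>
    hf.integrable_of_hasCompactSupport (HasCompactSupport.of_compactSpace f)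
  have h1 : ∀ t : unitInterval, ∫ x, toHam (pertHam K G c) hKc (t, x) ∂Ω.volume =
      (∫ x, K (t, x) ∂Ω.volume) + c * deriv lateStep t * ∫ x, G x ∂Ω.volume := by
    intro t
    have h2 : ∀ x, toHam (pertHam K G c) hKc (t, x) = K (t, x) + c * deriv lateStep t * G x := by
      intro x
      rw [toHam_apply, pertHam, mul_assoc]
    simp only [h2]
    have hKt : Continuous fun x => K ((t : ℝ), x) :=
      hK.continuous.comp (Continuous.prodMk continuous_const continuous_id)
    rw [integral_add (hint _ hKt)
      ((hint G hG).const_mul _), integral_const_mul]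
  have hc1 : Continuous fun t : unitInterval => ∫ x, K (t, x) ∂Ω.volume := by
    have := continuous_parametric_integral_of_continuous (μ := Ω.volume)
      (f := fun (t : unitInterval) (x : M) => K (t, x)) (s := univ)
      (hK.continuous.comp (f := fun p : unitInterval × M => ((p.1 : ℝ), p.2))
        (by fun_prop)) isCompact_univ
    simpa using this
  have hc2 : Continuous fun t : unitInterval => deriv lateStep t :=
    (contDiff_infty_iff_deriv.1 contDiff_lateStep).2.continuous.comp continuous_subtype_val
  have hint2 : ∀ f : unitInterval → ℝ, Continuous f → Integrable f := fun f hf =>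
    hf.integrable_of_hasCompactSupport (HasCompactSupport.of_compactSpace f)
  simp only [average, h1]
  rw [integral_add (hint2 _ hc1) (((hint2 _ hc2).const_mul c).mul_const _), integral_mul_const,
    integral_const_mul, integral_deriv_lateStep]
  simp only [toHam_apply]
  ring

theorem integral_volume_pos {G : M → ℝ} (hG : Continuous G) (hG0 : ∀ x, 0 ≤ G x) {x : M}
    (hx : G x ≠ 0) : 0 < 1 / Ω.volume.real univ * ∫ x, G x ∂Ω.volume := by
  have := isFiniteMeasure_volume Ω
  have := isOpenPosMeasure_volume Ω
  have : Nonempty M := ⟨x⟩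
  have h1 : 0 < ∫ x, G x ∂Ω.volume :=
    hG.integral_pos_of_hasCompactSupport_nonneg_nonzero (HasCompactSupport.of_compactSpace G) hG0 hx
  have h2 : 0 < Ω.volume.real univ :=
    ENNReal.toReal_pos (isOpen_univ.measure_pos _ univ_nonempty).ne' (measure_ne_top _ _)
  positivity

end Average

end SymplecticClosing

namespace SymplecticClosing

/-! ### Stokes' theorem for triangles and prisms -/

section Triangle

theorem isCompact_stdTriangle : IsCompact stdTriangle := by
  refine (isCompact_Icc (a := ((0 : ℝ), (0 : ℝ))) (b := (1, 1))).of_isClosed_subset ?_ ?_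
  · exact (isClosed_le continuous_const continuous_fst).inter
      ((isClosed_le continuous_const continuous_snd).inter
        (isClosed_le (continuous_fst.add continuous_snd) continuous_const))
  · rintro p ⟨h1, h2, h3⟩
    exact ⟨⟨h1, h2⟩, ⟨by simp only; linarith, by simp only; linarith⟩⟩

theorem convex_stdTriangle : Convex ℝ stdTriangle := by
  rintro p ⟨p1, p2, p3⟩ q ⟨q1, q2, q3⟩ a b ha hb hab
  refine ⟨?_, ?_, ?_⟩
  · simp only [Prod.fst_add, Prod.smul_fst, smul_eq_mul]; positivity
  · simp only [Prod.snd_add, Prod.smul_snd, smul_eq_mul]; positivity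
  · simp only [Prod.fst_add, Prod.smul_fst, Prod.snd_add, Prod.smul_snd, smul_eq_mul]
    nlinarith

/-- The interior of the standard triangle. -/
def openTriangle : Set (ℝ × ℝ) := {p | 0 < p.1 ∧ 0 < p.2 ∧ p.1 + p.2 < 1}

theorem isOpen_openTriangle : IsOpen openTriangle :=
  (isOpen_lt continuous_const continuous_fst).inter
    ((isOpen_lt continuous_const continuous_snd).inter
      (isOpen_lt (continuous_fst.add continuous_snd) continuous_const))

theorem openTriangle_subset : openTriangle ⊆ stdTriangle := fun _ h => ⟨h.1.le, h.2.1.le, h.2.2.le⟩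

theorem uniqueDiffOn_stdTriangle : UniqueDiffOn ℝ stdTriangle :=
  uniqueDiffOn_convex convex_stdTriangle ⟨(1 / 3, 1 / 3),
    interior_maximal openTriangle_subset isOpen_openTriangle
      ⟨by norm_num, by norm_num, by norm_num⟩⟩

theorem side_mem (j : Fin 3) {t : ℝ} (ht : t ∈ Icc (0 : ℝ) 1) : side j t ∈ stdTriangle := by
  fin_cases j <;> simp [side, stdTriangle, ht.1, ht.2]

theorem setIntegral_stdTriangle {f : ℝ × ℝ → ℝ} (hf : ContinuousOn f stdTriangle) :
    ∫ p in stdTriangle, f p = ∫ a in Ioo (0 : ℝ) 1, ∫ b in (0 : ℝ)..(1 - a), f (a, b) := by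
  have hm : MeasurableSet stdTriangle := isCompact_stdTriangle.measurableSet
  have hint : IntegrableOn f stdTriangle := hf.integrableOn_compact isCompact_stdTriangle
  rw [← integral_indicator hm, Measure.volume_eq_prod,
    integral_prod _ (by rw [← Measure.volume_eq_prod]; exact hint.integrable_indicator hm)]
  have h0 : ∀ a ∉ Icc (0 : ℝ) 1, ∫ b, stdTriangle.indicator f (a, b) = 0 := by
    intro a ha
    have : ∀ b, stdTriangle.indicator f (a, b) = 0 := by
      intro b
      refine indicator_of_notMem (fun h => ha ?_) _
      have h2 := h.2.1
      have h3 := h.2.2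
      simp only at h2 h3
      exact ⟨h.1, by linarith⟩
    simp [this]
  rw [← setIntegral_eq_integral_of_forall_compl_eq_zero h0, integral_Icc_eq_integral_Ioo]
  refine setIntegral_congr_fun measurableSet_Ioo fun a ha => ?_
  rw [intervalIntegral.integral_of_le (by linarith [ha.2]), ← integral_Icc_eq_integral_Ioc,
    ← integral_indicator measurableSet_Icc]
  congr 1
  ext b
  by_cases hb : b ∈ Icc 0 (1 - a)
  · rw [indicator_of_mem hb, indicator_of_mem]
    exact ⟨ha.1.le, hb.1, by simp only; linarith [hb.2]⟩
  · rw [indicator_of_notMem hb, indicator_of_notMem]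
    exact fun h => hb ⟨h.2.1, by have h3 := h.2.2; simp only at h3; linarith⟩

theorem setIntegral_stdTriangle_swap (f : ℝ × ℝ → ℝ) :
    ∫ p in stdTriangle, f p = ∫ p in stdTriangle, f p.swap := by
  have h := (Measure.measurePreserving_swap (μ := (volume : Measure ℝ))
    (ν := (volume : Measure ℝ))).setIntegral_preimage_emb
    MeasurableEquiv.prodComm.measurableEmbedding f stdTriangle
  have hs : Prod.swap ⁻¹' stdTriangle = stdTriangle := by
    ext p
    simp only [stdTriangle, mem_preimage, mem_ofPred_eq, Prod.fst_swap, Prod.snd_swap]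
    rw [add_comm]
    tauto
  rw [hs] at h
  exact h.symm

theorem setIntegral_stdTriangle_deriv_snd {P P' : ℝ × ℝ → ℝ} (hP : ContinuousOn P stdTriangle)
    (hP' : ContinuousOn P' stdTriangle)
    (hd : ∀ x ∈ openTriangle, HasDerivAt (fun b => P (x.1, b)) (P' x) x.2) :
    ∫ p in stdTriangle, P' p = ∫ a in (0 : ℝ)..1, (P (a, 1 - a) - P (a, 0)) := by
  rw [setIntegral_stdTriangle hP', intervalIntegral.integral_of_le zero_le_one,
    integral_Ioc_eq_integral_Ioo]
  refine setIntegral_congr_fun measurableSet_Ioo fun a ha => ?_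
  have hmap : MapsTo (fun b => (a, b)) (Icc 0 (1 - a)) stdTriangle := fun b hb =>
    ⟨ha.1.le, hb.1, by simp only; linarith [hb.2]⟩
  have hc : ContinuousOn (fun b : ℝ => (a, b)) (Icc 0 (1 - a)) :=
    (continuous_const.prodMk continuous_id).continuousOn
  refine intervalIntegral.integral_eq_sub_of_hasDerivAt_of_le (f := fun b => P (a, b))
    (by linarith [ha.2]) (hP.comp hc hmap)
    (fun b hb => hd (a, b) ⟨ha.1, hb.1, by simp only; linarith [hb.2]⟩) ?_
  refine ContinuousOn.intervalIntegrable ?_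
  rw [uIcc_of_le (by linarith [ha.2])]
  exact hP'.comp hc hmap

theorem setIntegral_stdTriangle_deriv_fst {Q Q' : ℝ × ℝ → ℝ} (hQ : ContinuousOn Q stdTriangle)
    (hQ' : ContinuousOn Q' stdTriangle)
    (hd : ∀ x ∈ openTriangle, HasDerivAt (fun a => Q (a, x.2)) (Q' x) x.1) :
    ∫ p in stdTriangle, Q' p = ∫ b in (0 : ℝ)..1, (Q (1 - b, b) - Q (0, b)) := by
  have hmap : MapsTo Prod.swap stdTriangle stdTriangle := fun p hp =>
    ⟨hp.2.1, hp.1, by simp only [Prod.fst_swap, Prod.snd_swap]; linarith [hp.2.2]⟩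
  rw [setIntegral_stdTriangle_swap, setIntegral_stdTriangle_deriv_snd (P := fun p => Q p.swap)
    (P' := fun p => Q' p.swap)
    (hQ.comp continuous_swap.continuousOn hmap) (hQ'.comp continuous_swap.continuousOn hmap)
    (fun x hx => hd x.swap ⟨hx.2.1, hx.1, by
      simp only [Prod.fst_swap, Prod.snd_swap]; linarith [hx.2.2]⟩)]
  rfl

/-- The velocities of the sides of the standard triangle. -/
def sideVel (j : Fin 3) : ℝ × ℝ := ![(1, 0), (-1, 1), (0, -1)] j

theorem hasDerivAt_side (j : Fin 3) (t : ℝ) : HasDerivAt (side j) (sideVel j) t := by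
  fin_cases j
  · exact (hasDerivAt_id t).prodMk (hasDerivAt_const t 0)
  · exact ((hasDerivAt_id t).const_sub 1).prodMk (hasDerivAt_id t)
  · exact (hasDerivAt_const t 0).prodMk ((hasDerivAt_id t).const_sub 1)

/-- The prism over the standard triangle. -/
def prism : Set (ℝ × (ℝ × ℝ)) := Icc (0 : ℝ) 1 ×ˢ stdTriangle

theorem uniqueDiffOn_prism : UniqueDiffOn ℝ prism :=
  (uniqueDiffOn_Icc zero_lt_one).prod uniqueDiffOn_stdTriangle

theorem isCompact_prism : IsCompact prism := isCompact_Icc.prod isCompact_stdTriangle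

theorem prism_mem_nhds {s : ℝ} (hs : s ∈ Ioo (0 : ℝ) 1) {p : ℝ × ℝ} (hp : p ∈ openTriangle) :
    prism ∈ 𝓝 (s, p) :=
  prod_mem_nhds (Icc_mem_nhds hs.1 hs.2)
    (mem_of_superset (isOpen_openTriangle.mem_nhds hp) openTriangle_subset)

/-- The boundary of a convex set is null; derivatives within the triangle may thus be treated as
ordinary derivatives under the integral. -/
theorem ae_mem_openTriangle :
    ∀ᵐ p ∂(volume : Measure (ℝ × ℝ)).restrict stdTriangle, p ∈ openTriangle := by
  have h1 : interior stdTriangle ⊆ openTriangle := by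
    intro p hp
    obtain ⟨A, C, hA, hpA, hC, hpC, hAC⟩ := mem_nhds_prod_iff'.1 (mem_interior_iff_mem_nhds.1 hp)
    obtain ⟨ε, hε, hεA⟩ := Metric.isOpen_iff.1 hA p.1 hpA
    obtain ⟨ε', hε', hεC⟩ := Metric.isOpen_iff.1 hC p.2 hpC
    have e1 : ∀ r, |r| < ε → p.1 + r ∈ A := fun r hr => hεA (by simpa [Real.dist_eq] using hr)
    have e2 : ∀ r, |r| < ε' → p.2 + r ∈ C := fun r hr => hεC (by simpa [Real.dist_eq] using hr)
    have m1 := hAC (mk_mem_prod (e1 (-(ε / 2)) (by rw [abs_neg, abs_of_pos] <;> linarith)) hpC)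
    have m2 := hAC (mk_mem_prod hpA (e2 (-(ε' / 2)) (by rw [abs_neg, abs_of_pos] <;> linarith)))
    have m3 := hAC (mk_mem_prod (e1 (ε / 2) (by rw [abs_of_pos] <;> linarith)) hpC)
    have n1 := m1.1
    have n2 := m2.2.1
    have n3 := m3.2.2
    simp only at n1 n2 n3
    exact ⟨by linarith, by linarith, by linarith⟩
  have h2 := convex_stdTriangle.addHaar_frontier (volume : Measure (ℝ × ℝ))
  rw [ae_restrict_iff' isCompact_stdTriangle.measurableSet]
  filter_upwards [measure_eq_zero_iff_ae_notMem.1 h2] with p hp hpT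
  refine h1 ?_
  by_contra h
  exact hp ⟨subset_closure hpT, h⟩

variable {V : Type*} [NormedAddCommGroup V] [NormedSpace ℝ V] {B : V → V →L[ℝ] V →L[ℝ] ℝ}
  {O : Set V} {U : ℝ × (ℝ × ℝ) → V}

/-- The pullback of a form to the prism. -/
noncomputable def prismForm (B : V → V →L[ℝ] V →L[ℝ] ℝ) (U : ℝ × (ℝ × ℝ) → V)
    (q a b : ℝ × (ℝ × ℝ)) : ℝ :=
  B (U q) (fderivWithin ℝ U prism q a) (fderivWithin ℝ U prism q b)

theorem contDiffOn_prismForm (hB : ContDiffOn ℝ ∞ B O) (hU : ContDiffOn ℝ ∞ U prism)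
    (hUO : MapsTo U prism O) (a b : ℝ × (ℝ × ℝ)) :
    ContDiffOn ℝ ∞ (fun q => prismForm B U q a b) prism := by
  have h1 := hU.fderivWithin uniqueDiffOn_prism (m := ∞) (by simp)
  exact ((hB.comp hU hUO).clm_apply (h1.clm_apply contDiffOn_const)).clm_apply
    (h1.clm_apply contDiffOn_const)

theorem prismForm_cyclic (hB : IsClosedForm B O) (hO : IsOpen O) (hU : ContDiffOn ℝ ∞ U prism)
    (hUO : MapsTo U prism O) {q : ℝ × (ℝ × ℝ)} (hq : prism ∈ 𝓝 q) (a b c : ℝ × (ℝ × ℝ)) :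
    fderiv ℝ (fun q => prismForm B U q b c) q a + fderiv ℝ (fun q => prismForm B U q c a) q b +
      fderiv ℝ (fun q => prismForm B U q a b) q c = 0 := by
  have hev : ∀ u w, (fun q => prismForm B U q u w) =ᶠ[𝓝 q] fun q => pullbackForm B U q u w := by
    intro u w
    filter_upwards [eventually_mem_nhds_iff.2 hq] with z hz
    rw [prismForm, pullbackForm_apply, fderivWithin_of_mem_nhds hz]
  rw [(hev b c).fderiv_eq, (hev c a).fderiv_eq, (hev a b).fderiv_eq]
  exact hB.cyclic_sum_fderiv_pullbackForm hO (hU.contDiffAt hq) (hUO (mem_of_mem_nhds hq)) a b c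

theorem hasFDerivAt_fderivWithin_prism {A : ℝ × (ℝ × ℝ) → ℝ} (hA : ContDiffOn ℝ ∞ A prism)
    {q : ℝ × (ℝ × ℝ)} (hq : prism ∈ 𝓝 q) : HasFDerivAt A (fderivWithin ℝ A prism q) q := by
  rw [fderivWithin_of_mem_nhds hq]
  exact ((hA.contDiffAt hq).differentiableAt (by simp)).hasFDerivAt

theorem continuousOn_fderivWithin_prism {A : ℝ × (ℝ × ℝ) → ℝ} (hA : ContDiffOn ℝ ∞ A prism)
    (a : ℝ × (ℝ × ℝ)) : ContinuousOn (fun q => fderivWithin ℝ A prism q a) prism :=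
  (hA.continuousOn_fderivWithin uniqueDiffOn_prism (by simp)).clm_apply continuousOn_const

theorem integral_fderivWithin_prism {A : ℝ × (ℝ × ℝ) → ℝ} (hA : ContDiffOn ℝ ∞ A prism) :
    ∫ s in (0 : ℝ)..1, ∫ p in stdTriangle, fderivWithin ℝ A prism (s, p) (1, 0) =
      ∫ p in stdTriangle, (A (1, p) - A (0, p)) := by
  have hc := continuousOn_fderivWithin_prism hA (1, 0)
  have hint : IntegrableOn (fun q => fderivWithin ℝ A prism q (1, 0)) prism :=
    hc.integrableOn_compact isCompact_prism
  rw [intervalIntegral.integral_of_le zero_le_one, ← integral_Icc_eq_integral_Ioc,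
    integral_integral_swap]
  · refine integral_congr_ae ?_
    filter_upwards [ae_mem_openTriangle] with p hp
    rw [integral_Icc_eq_integral_Ioc, ← intervalIntegral.integral_of_le zero_le_one]
    have hmap : MapsTo (fun s : ℝ => (s, p)) (Icc 0 1) prism := fun s hs =>
      ⟨hs, openTriangle_subset hp⟩
    have hcm : ContinuousOn (fun s : ℝ => (s, p)) (Icc 0 1) :=
      (continuous_id.prodMk continuous_const).continuousOn
    refine intervalIntegral.integral_eq_sub_of_hasDerivAt_of_le (f := fun s => A (s, p))
      zero_le_one (hA.continuousOn.comp hcm hmap) (fun s hs => ?_) ?_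
    · have h1 := hasFDerivAt_fderivWithin_prism hA (prism_mem_nhds hs hp)
      exact HasFDerivAt.comp_hasDerivAt (f := fun s : ℝ => (s, p)) s h1
        ((hasDerivAt_id s).prodMk (hasDerivAt_const s p))
    · refine ContinuousOn.intervalIntegrable ?_
      rw [uIcc_of_le zero_le_one]
      exact hc.comp hcm hmap
  · rw [Measure.prod_restrict, ← Measure.volume_eq_prod]
    exact hint

/-- Stokes' theorem on the slices of the prism. -/
theorem setIntegral_fderivWithin_prismForm (hB : IsClosedForm B O) (hO : IsOpen O)
    (hU : ContDiffOn ℝ ∞ U prism) (hUO : MapsTo U prism O) {s : ℝ} (hs : s ∈ Ioo (0 : ℝ) 1) :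
    ∫ p in stdTriangle,
        fderivWithin ℝ (fun q => prismForm B U q (0, 1, 0) (0, 0, 1)) prism (s, p) (1, 0) =
      ∑ j, ∫ t in (0 : ℝ)..1, prismForm B U (s, side j t) (1, 0) (0, sideVel j) := by
  have hA := contDiffOn_prismForm hB.contDiffOn hU hUO (0, 1, 0) (0, 0, 1)
  have hP := contDiffOn_prismForm hB.contDiffOn hU hUO (1, 0, 0) (0, 1, 0)
  have hQ := contDiffOn_prismForm hB.contDiffOn hU hUO (1, 0, 0) (0, 0, 1)
  have hQ' := contDiffOn_prismForm hB.contDiffOn hU hUO (0, 0, 1) (1, 0, 0)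
  have hmap : MapsTo (fun p : ℝ × ℝ => (s, p)) stdTriangle prism := fun p hp =>
    ⟨Ioo_subset_Icc_self hs, hp⟩
  have hcm : ContinuousOn (fun p : ℝ × ℝ => (s, p)) stdTriangle :=
    (continuous_const.prodMk continuous_id).continuousOn
  have cP := (continuousOn_fderivWithin_prism hP (0, 0, 1)).comp hcm hmap
  have cQ := (continuousOn_fderivWithin_prism hQ (0, 1, 0)).comp hcm hmap
  -- Closedness of the pulled back form turns the derivative of the area density in the homotopy
  -- direction into a divergence on the slice, which the fundamental theorem of calculus then
  -- integrates to the three sides.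
  have e : ∫ p in stdTriangle,
        fderivWithin ℝ (fun q => prismForm B U q (0, 1, 0) (0, 0, 1)) prism (s, p) (1, 0) =
      ∫ p in stdTriangle,
        (fderivWithin ℝ (fun q => prismForm B U q (1, 0, 0) (0, 0, 1)) prism (s, p) (0, 1, 0) -
         fderivWithin ℝ (fun q => prismForm B U q (1, 0, 0) (0, 1, 0)) prism (s, p) (0, 0, 1)) := by
    refine integral_congr_ae ?_
    filter_upwards [ae_mem_openTriangle] with p hp
    have hq := prism_mem_nhds hs hp
    have hcyc := prismForm_cyclic hB hO hU hUO hq (1, 0, 0) (0, 1, 0) (0, 0, 1)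
    have hneg : (fun q => prismForm B U q (0, 0, 1) (1, 0, 0)) =ᶠ[𝓝 (s, p)]
        fun q => -prismForm B U q (1, 0, 0) (0, 0, 1) := by
      filter_upwards [hq] with z hz
      exact hB.skew _ (hUO hz) _ _
    rw [hneg.fderiv_eq, fderiv_fun_neg, neg_apply] at hcyc
    rw [fderivWithin_of_mem_nhds hq, fderivWithin_of_mem_nhds hq, fderivWithin_of_mem_nhds hq]
    change fderiv ℝ (fun q => prismForm B U q (0, 1, 0) (0, 0, 1)) (s, p) (1, 0, 0) = _
    linarith
  have iP : IntervalIntegrable (fun a : ℝ => prismForm B U (s, (a, 1 - a)) (1, 0, 0) (0, 1, 0))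
      volume 0 1 := by
    refine ContinuousOn.intervalIntegrable ?_
    rw [uIcc_of_le zero_le_one]
    exact (hP.continuousOn.comp hcm hmap).comp (f := fun a : ℝ => (a, 1 - a)) (by fun_prop)
      fun a ha => ⟨ha.1, by simpa using ha.2, by simp⟩
  have iP0 : IntervalIntegrable (fun a : ℝ => prismForm B U (s, (a, 0)) (1, 0, 0) (0, 1, 0))
      volume 0 1 := by
    refine ContinuousOn.intervalIntegrable ?_
    rw [uIcc_of_le zero_le_one]
    exact (hP.continuousOn.comp hcm hmap).comp (f := fun a : ℝ => (a, 0)) (by fun_prop)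
      fun a ha => ⟨ha.1, le_rfl, by simpa using ha.2⟩
  have iQ : IntervalIntegrable (fun a : ℝ => prismForm B U (s, (1 - a, a)) (1, 0, 0) (0, 0, 1))
      volume 0 1 := by
    refine ContinuousOn.intervalIntegrable ?_
    rw [uIcc_of_le zero_le_one]
    exact (hQ.continuousOn.comp hcm hmap).comp (f := fun a : ℝ => (1 - a, a)) (by fun_prop)
      fun a ha => ⟨by simpa using ha.2, ha.1, by simp⟩
  have iQ0 : IntervalIntegrable (fun a : ℝ => prismForm B U (s, (0, a)) (1, 0, 0) (0, 0, 1))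
      volume 0 1 := by
    refine ContinuousOn.intervalIntegrable ?_
    rw [uIcc_of_le zero_le_one]
    exact (hQ.continuousOn.comp hcm hmap).comp (f := fun a : ℝ => (0, a)) (by fun_prop)
      fun a ha => ⟨le_rfl, ha.1, by simpa using ha.2⟩
  have iP1 : IntervalIntegrable (fun a : ℝ => prismForm B U (s, (1 - a, a)) (1, 0, 0) (0, 1, 0))
      volume 0 1 := by
    have := (iP.comp_sub_left 1).symm
    simpa using this
  simp only [Function.comp_def] at cP cQ
  rw [e, integral_sub (cQ.integrableOn_compact isCompact_stdTriangle)
    (cP.integrableOn_compact isCompact_stdTriangle)]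
  have sQ := setIntegral_stdTriangle_deriv_fst (hQ.continuousOn.comp hcm hmap) cQ fun p hp =>
    HasFDerivAt.comp_hasDerivAt (f := fun a : ℝ => (s, (a, p.2))) p.1
      (hasFDerivAt_fderivWithin_prism hQ (prism_mem_nhds hs hp))
      ((hasDerivAt_const _ s).prodMk ((hasDerivAt_id p.1).prodMk (hasDerivAt_const _ p.2)))
  have sP := setIntegral_stdTriangle_deriv_snd (hP.continuousOn.comp hcm hmap) cP fun p hp =>
    HasFDerivAt.comp_hasDerivAt (f := fun a : ℝ => (s, (p.1, a))) p.2
      (hasFDerivAt_fderivWithin_prism hP (prism_mem_nhds hs hp))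
      ((hasDerivAt_const _ s).prodMk ((hasDerivAt_const _ p.1).prodMk (hasDerivAt_id p.2)))
  simp only [Function.comp_def] at sQ sP
  rw [sQ, sP, intervalIntegral.integral_sub iQ iQ0, intervalIntegral.integral_sub iP iP0]
  -- The boundary orientation runs along the hypotenuse by `(1 - t, t)` and down the vertical side
  -- by `(0, 1 - t)`, hence the two reversals of parameter.
  have r1 : ∫ a in (0 : ℝ)..1, prismForm B U (s, (a, 1 - a)) (1, 0, 0) (0, 1, 0) =
      ∫ a in (0 : ℝ)..1, prismForm B U (s, (1 - a, a)) (1, 0, 0) (0, 1, 0) := by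
    have := intervalIntegral.integral_comp_sub_left (a := 0) (b := 1)
      (fun a : ℝ => prismForm B U (s, (1 - a, a)) (1, 0, 0) (0, 1, 0)) 1
    simpa using this
  have r2 : ∫ a in (0 : ℝ)..1, prismForm B U (s, (0, a)) (1, 0, 0) (0, 0, 1) =
      ∫ a in (0 : ℝ)..1, prismForm B U (s, (0, 1 - a)) (1, 0, 0) (0, 0, 1) := by
    have := intervalIntegral.integral_comp_sub_left (a := 0) (b := 1)
      (fun a : ℝ => prismForm B U (s, (0, a)) (1, 0, 0) (0, 0, 1)) 1
    simpa using this.symm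
  have v1 : ((0 : ℝ), ((-1 : ℝ), (1 : ℝ))) = (0, 0, 1) - (0, 1, 0) := by simp
  have v2 : ((0 : ℝ), ((0 : ℝ), (-1 : ℝ))) = -(0, 0, 1) := by simp
  have z0 : ((1 : ℝ), (0 : ℝ × ℝ)) = (1, 0, 0) := rfl
  rw [r1, r2, Fin.sum_univ_three]
  simp only [side, sideVel, Matrix.cons_val_zero, Matrix.cons_val_one, Matrix.cons_val, z0, v1, v2]
  have l1 : ∀ q, prismForm B U q (1, 0, 0) ((0, 0, 1) - (0, 1, 0)) =
      prismForm B U q (1, 0, 0) (0, 0, 1) - prismForm B U q (1, 0, 0) (0, 1, 0) := fun q => by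
    simp only [prismForm, map_sub]
  have l2 : ∀ q, prismForm B U q (1, 0, 0) (-(0, 0, 1)) =
      -prismForm B U q (1, 0, 0) (0, 0, 1) := fun q => by
    simp only [prismForm, map_neg]
  simp only [l1, l2]
  rw [intervalIntegral.integral_sub iQ iP1, intervalIntegral.integral_neg]
  ring

/-- Stokes' theorem on the prism. -/
theorem setIntegral_prismForm_sub (hB : IsClosedForm B O) (hO : IsOpen O)
    (hU : ContDiffOn ℝ ∞ U prism) (hUO : MapsTo U prism O) :
    ∫ p in stdTriangle, (prismForm B U (1, p) (0, 1, 0) (0, 0, 1) -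
        prismForm B U (0, p) (0, 1, 0) (0, 0, 1)) =
      ∑ j, ∫ s in (0 : ℝ)..1, ∫ t in (0 : ℝ)..1,
        prismForm B U (s, side j t) (1, 0) (0, sideVel j) := by
  have hA := contDiffOn_prismForm hB.contDiffOn hU hUO (0, 1, 0) (0, 0, 1)
  rw [← integral_fderivWithin_prism hA, ← intervalIntegral.integral_finsetSum]
  · rw [intervalIntegral.integral_of_le zero_le_one, intervalIntegral.integral_of_le zero_le_one,
      integral_Ioc_eq_integral_Ioo, integral_Ioc_eq_integral_Ioo]
    exact setIntegral_congr_fun measurableSet_Ioo fun s hs =>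
      setIntegral_fderivWithin_prismForm hB hO hU hUO hs
  · intro j _
    have hc := (contDiffOn_prismForm hB.contDiffOn hU hUO (1, 0) (0, sideVel j)).continuousOn
    have hside : Continuous (side j) :=
      continuous_iff_continuousAt.2 fun t => (hasDerivAt_side j t).continuousAt
    have h2 : ContinuousOn (fun r : ℝ × ℝ => prismForm B U (r.1, side j r.2) (1, 0) (0, sideVel j))
        (Icc 0 1 ×ˢ Icc 0 1) :=
      hc.comp (f := fun r : ℝ × ℝ => (r.1, side j r.2))
        (continuous_fst.prodMk (hside.comp continuous_snd)).continuousOn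
        fun r hr => ⟨hr.1, side_mem j hr.2⟩
    have h3 := h2.integrableOn_compact (μ := volume) (isCompact_Icc.prod isCompact_Icc)
    rw [IntegrableOn, Measure.volume_eq_prod, ← Measure.prod_restrict] at h3
    rw [intervalIntegrable_iff_integrableOn_Icc_of_le zero_le_one]
    have h4 := h3.integral_prod_left
    refine h4.congr (Eventually.of_forall fun s => ?_)
    simp only
    rw [intervalIntegral.integral_of_le zero_le_one, integral_Icc_eq_integral_Ioc]

end Triangle

end SymplecticClosing

namespace SymplecticClosing

/-! ### Areas of nearby cappings -/

section HomotopyArea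

variable {V : Type*} [NormedAddCommGroup V] [NormedSpace ℝ V] {B : V → V →L[ℝ] V →L[ℝ] ℝ}
  {O : Set V}

/-- The area of a map of the standard triangle. -/
noncomputable def triangleArea (B : V → V →L[ℝ] V →L[ℝ] ℝ) (u : ℝ × ℝ → V) : ℝ :=
  ∫ p in stdTriangle, B (u p) (fderivWithin ℝ u stdTriangle p (1, 0))
    (fderivWithin ℝ u stdTriangle p (0, 1))

/-- The area of the linear homotopy between two paths. -/
noncomputable def homotopyArea (B : V → V →L[ℝ] V →L[ℝ] ℝ) (a b : ℝ → V) : ℝ :=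
  ∫ s in (0 : ℝ)..1, ∫ t in (0 : ℝ)..1, B ((1 - s) • a t + s • b t) (b t - a t)
    ((1 - s) • derivWithin a (Icc 0 1) t + s • derivWithin b (Icc 0 1) t)

theorem homotopyArea_congr {a b a' b' : ℝ → V} (ha : EqOn a a' (Icc 0 1))
    (hb : EqOn b b' (Icc 0 1)) : homotopyArea B a b = homotopyArea B a' b' := by
  refine intervalIntegral.integral_congr fun s _ => intervalIntegral.integral_congr fun t ht => ?_
  rw [uIcc_of_le zero_le_one] at ht
  simp only [ha ht, hb ht, derivWithin_congr ha (ha ht), derivWithin_congr hb (hb ht)]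

theorem derivWithin_reverse (a : ℝ → V) (t : ℝ) :
    derivWithin (fun t => a (1 - t)) (Icc 0 1) t = -derivWithin a (Icc 0 1) (1 - t) := by
  rw [derivWithin_comp_const_sub]
  congr 2
  ext r
  simp

/-- Reversing the parameter changes the sign of the velocities. Since glued sides run in opposite
directions, their contributions cancel. -/
theorem homotopyArea_reverse (a b : ℝ → V) :
    homotopyArea B (fun t => a (1 - t)) (fun t => b (1 - t)) = -homotopyArea B a b := by
  rw [homotopyArea, homotopyArea, ← intervalIntegral.integral_neg]
  refine intervalIntegral.integral_congr fun s _ => ?_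
  simp only [derivWithin_reverse]
  rw [← intervalIntegral.integral_neg]
  have := intervalIntegral.integral_comp_sub_left (a := 0) (b := 1)
    (fun t => -B ((1 - s) • a t + s • b t) (b t - a t)
      ((1 - s) • derivWithin a (Icc 0 1) t + s • derivWithin b (Icc 0 1) t)) 1
  simp only [sub_self, sub_zero] at this
  rw [← this]
  refine intervalIntegral.integral_congr fun t _ => ?_
  rw [← map_neg]
  congr 1
  module

/-- The linear homotopy between two maps of the triangle. -/
noncomputable def lineHomotopy (u₀ u₁ : ℝ × ℝ → V) (q : ℝ × (ℝ × ℝ)) : V :=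
  (1 - q.1) • u₀ q.2 + q.1 • u₁ q.2

variable {u₀ u₁ : ℝ × ℝ → V}

theorem contDiffOn_lineHomotopy (h₀ : ContDiffOn ℝ ∞ u₀ stdTriangle)
    (h₁ : ContDiffOn ℝ ∞ u₁ stdTriangle) : ContDiffOn ℝ ∞ (lineHomotopy u₀ u₁) prism := by
  have e : MapsTo (Prod.snd : ℝ × (ℝ × ℝ) → ℝ × ℝ) prism stdTriangle := fun q hq => hq.2
  exact ((contDiffOn_const.sub contDiff_fst.contDiffOn).smul
    (h₀.comp contDiff_snd.contDiffOn e)).add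
    (contDiff_fst.contDiffOn.smul (h₁.comp contDiff_snd.contDiffOn e))

theorem fderivWithin_lineHomotopy (h₀ : ContDiffOn ℝ ∞ u₀ stdTriangle)
    (h₁ : ContDiffOn ℝ ∞ u₁ stdTriangle) {q : ℝ × (ℝ × ℝ)} (hq : q ∈ prism)
    (a : ℝ × (ℝ × ℝ)) :
    fderivWithin ℝ (lineHomotopy u₀ u₁) prism q a = a.1 • (u₁ q.2 - u₀ q.2) +
      ((1 - q.1) • fderivWithin ℝ u₀ stdTriangle q.2 a.2 +
        q.1 • fderivWithin ℝ u₁ stdTriangle q.2 a.2) := by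
  have e : MapsTo (Prod.snd : ℝ × (ℝ × ℝ) → ℝ × ℝ) prism stdTriangle := fun q hq => hq.2
  have f : ∀ {u : ℝ × ℝ → V}, ContDiffOn ℝ ∞ u stdTriangle →
      HasFDerivWithinAt (fun q : ℝ × (ℝ × ℝ) => u q.2)
        ((fderivWithin ℝ u stdTriangle q.2).comp (ContinuousLinearMap.snd ℝ ℝ (ℝ × ℝ))) prism q :=
    fun {u} hu => HasFDerivWithinAt.comp (g := u) (f := Prod.snd) q
      ((hu.differentiableOn (by simp)) q.2 hq.2).hasFDerivWithinAt hasFDerivWithinAt_snd e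
  have h := (((hasFDerivWithinAt_fst (𝕜 := ℝ) (p := q) (s := prism)).const_sub 1).smul (f h₀)).add
    ((hasFDerivWithinAt_fst (𝕜 := ℝ) (p := q) (s := prism)).smul (f h₁))
  have h' : HasFDerivWithinAt (lineHomotopy u₀ u₁) _ prism q := h
  rw [h'.fderivWithin (uniqueDiffOn_prism q hq)]
  simp
  module

theorem derivWithin_comp_side {u : ℝ × ℝ → V} (hu : ContDiffOn ℝ ∞ u stdTriangle) (j : Fin 3)
    {t : ℝ} (ht : t ∈ Icc (0 : ℝ) 1) :
    derivWithin (fun t => u (side j t)) (Icc 0 1) t =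
      fderivWithin ℝ u stdTriangle (side j t) (sideVel j) := by
  have h := HasFDerivWithinAt.comp_hasDerivWithinAt (f := side j) (l := u) t
    ((hu.differentiableOn (by simp)) _ (side_mem j ht)).hasFDerivWithinAt
    (hasDerivAt_side j t).hasDerivWithinAt (fun t ht => side_mem j ht)
  exact h.derivWithin (uniqueDiffOn_Icc zero_lt_one t ht)

/-- Stokes' theorem on the prism for the linear homotopy. The form is closed only on `O`, so the
segments between the two maps have to stay there. -/
theorem triangleArea_sub (hB : IsClosedForm B O) (hO : IsOpen O)
    (h₀ : ContDiffOn ℝ ∞ u₀ stdTriangle) (h₁ : ContDiffOn ℝ ∞ u₁ stdTriangle)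
    (hUO : ∀ p ∈ stdTriangle, ∀ s ∈ Icc (0 : ℝ) 1, (1 - s) • u₀ p + s • u₁ p ∈ O) :
    triangleArea B u₁ - triangleArea B u₀ =
      ∑ j, homotopyArea B (fun t => u₀ (side j t)) fun t => u₁ (side j t) := by
  have hU := contDiffOn_lineHomotopy h₀ h₁
  have hm : MapsTo (lineHomotopy u₀ u₁) prism O := fun q hq => hUO q.2 hq.2 q.1 hq.1
  have key := setIntegral_prismForm_sub hB hO hU hm
  have hA := (contDiffOn_prismForm hB.contDiffOn hU hm (0, 1, 0) (0, 0, 1)).continuousOn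
  have hi : ∀ s ∈ Icc (0 : ℝ) 1, IntegrableOn
      (fun p => prismForm B (lineHomotopy u₀ u₁) (s, p) (0, 1, 0) (0, 0, 1)) stdTriangle :=
    fun s hs => (hA.comp (f := fun p : ℝ × ℝ => (s, p))
      (continuous_const.prodMk continuous_id).continuousOn
      fun p hp => ⟨hs, hp⟩).integrableOn_compact isCompact_stdTriangle
  rw [integral_sub (hi 1 (by simp)) (hi 0 (by simp))] at key
  have e1 : ∫ p in stdTriangle, prismForm B (lineHomotopy u₀ u₁) (1, p) (0, 1, 0) (0, 0, 1) =
      triangleArea B u₁ :=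
    setIntegral_congr_fun isCompact_stdTriangle.measurableSet fun p hp => by
      have hq : ((1 : ℝ), p) ∈ prism := ⟨by simp, hp⟩
      simp only [prismForm, fderivWithin_lineHomotopy h₀ h₁ hq]
      simp [lineHomotopy]
  have e0 : ∫ p in stdTriangle, prismForm B (lineHomotopy u₀ u₁) (0, p) (0, 1, 0) (0, 0, 1) =
      triangleArea B u₀ :=
    setIntegral_congr_fun isCompact_stdTriangle.measurableSet fun p hp => by
      have hq : ((0 : ℝ), p) ∈ prism := ⟨by simp, hp⟩
      simp only [prismForm, fderivWithin_lineHomotopy h₀ h₁ hq]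
      simp [lineHomotopy]
  rw [← e1, ← e0, key]
  refine Finset.sum_congr rfl fun j _ => intervalIntegral.integral_congr fun s hs =>
    intervalIntegral.integral_congr fun t ht => ?_
  rw [uIcc_of_le zero_le_one] at hs ht
  have hq : (s, side j t) ∈ prism := ⟨hs, side_mem j ht⟩
  simp only [prismForm, fderivWithin_lineHomotopy h₀ h₁ hq, derivWithin_comp_side h₀ j ht,
    derivWithin_comp_side h₁ j ht]
  simp [lineHomotopy]

/-- The difference of the areas of two nearby surfaces glued from triangles in the same way. -/
theorem sum_triangleArea_sub (hB : IsClosedForm B O) (hO : IsOpen O) {N : ℕ}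
    {pair : Fin N × Fin 3 → Fin N × Fin 3} {free : Fin N × Fin 3}
    (hpair : ∀ d, pair (pair d) = d) (hfree : ∀ d, pair d = d ↔ d = free)
    {u w : Fin N → ℝ × ℝ → V} (hu : ∀ i, ContDiffOn ℝ ∞ (u i) stdTriangle)
    (hw : ∀ i, ContDiffOn ℝ ∞ (w i) stdTriangle)
    (hu' : ∀ d, d ≠ free → ∀ t ∈ Icc (0 : ℝ) 1,
      u (pair d).1 (side (pair d).2 (1 - t)) = u d.1 (side d.2 t))
    (hw' : ∀ d, d ≠ free → ∀ t ∈ Icc (0 : ℝ) 1,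
      w (pair d).1 (side (pair d).2 (1 - t)) = w d.1 (side d.2 t))
    (hO' : ∀ i, ∀ p ∈ stdTriangle, ∀ s ∈ Icc (0 : ℝ) 1, (1 - s) • u i p + s • w i p ∈ O) :
    ∑ i, triangleArea B (w i) - ∑ i, triangleArea B (u i) =
      homotopyArea B (fun t => u free.1 (side free.2 t)) fun t => w free.1 (side free.2 t) := by
  let J : Fin N × Fin 3 → ℝ := fun d =>
    homotopyArea B (fun t => u d.1 (side d.2 t)) fun t => w d.1 (side d.2 t)
  have hJ : ∀ d, d ≠ free → J d + J (pair d) = 0 := by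
    intro d hd
    have h1 : J d = homotopyArea B (fun t => u (pair d).1 (side (pair d).2 (1 - t)))
        fun t => w (pair d).1 (side (pair d).2 (1 - t)) :=
      homotopyArea_congr (fun t ht => (hu' d hd t ht).symm) fun t ht => (hw' d hd t ht).symm
    rw [h1, homotopyArea_reverse (fun t => u (pair d).1 (side (pair d).2 t))
      (fun t => w (pair d).1 (side (pair d).2 t))]
    exact neg_add_cancel _
  rw [← Finset.sum_sub_distrib]
  simp only [fun i => triangleArea_sub hB hO (hu i) (hw i) (hO' i)]
  change ∑ i, ∑ j, J (i, j) = J free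
  rw [← Fintype.sum_prod_type (f := J), ← Finset.add_sum_erase _ _ (Finset.mem_univ free),
    add_eq_left]
  -- On the sides other than the free one the gluing is an involution without fixed points, and the
  -- two sides of each pair cancel.
  refine Finset.sum_involution (fun d _ => pair d) (fun d hd => hJ d (Finset.ne_of_mem_erase hd))
    (fun d hd _ h => Finset.ne_of_mem_erase hd ((hfree d).1 h)) (fun d hd => ?_)
    (fun d _ => hpair d)
  refine Finset.mem_erase.2 ⟨fun h => Finset.ne_of_mem_erase hd ?_, Finset.mem_univ _⟩
  rw [← hpair d, h]
  exact (hfree free).2 rfl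

end HomotopyArea

/-! ### Symplectic area computed in the ambient space. -/

section Capping

variable {n : ℕ} {M : Type*} [TopologicalSpace M] [ChartedSpace (EuclideanSpace ℝ (Fin (2 * n))) M]
  {V : Type} [NormedAddCommGroup V] [InnerProductSpace ℝ V]
  (R : SmoothRetract (2 * n) M V)

theorem Capping.contDiffOn_incl {x : ℝ → M} (v : Capping (n := n) x) (i : Fin v.size) :
    ContDiffOn ℝ ∞ (fun p => R.incl (v.map i p)) stdTriangle := by
  rw [← contMDiffOn_iff_contDiffOn]
  exact R.contMDiff_incl.comp_contMDiffOn (v.smooth i)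

theorem Capping.area_eq_sum (Ω : SymplecticForm n M) {x : ℝ → M} (v : Capping (n := n) x) :
    v.area Ω = ∑ i, triangleArea (formV R Ω) fun p => R.incl (v.map i p) := by
  refine Finset.sum_congr rfl fun i _ =>
    setIntegral_congr_fun isCompact_stdTriangle.measurableSet fun p hp => ?_
  let D : ℝ × ℝ →L[ℝ] EuclideanSpace ℝ (Fin (2 * n)) :=
    mfderivWithin 𝓘(ℝ, ℝ × ℝ) (𝓡 (2 * n)) (v.map i) stdTriangle p
  have hD : HasMFDerivWithinAt 𝓘(ℝ, ℝ × ℝ) (𝓡 (2 * n)) (v.map i) stdTriangle p D :=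
    ((v.smooth i).mdifferentiableOn (by simp) p hp).hasMFDerivWithinAt
  have h : HasFDerivWithinAt (fun p => R.incl (v.map i p)) ((R.inclD (v.map i p)).comp D)
      stdTriangle p := by
    have h0 := (R.hasMFDerivAt_incl (v.map i p)).comp_hasMFDerivWithinAt p hD
    exact hasMFDerivWithinAt_iff_hasFDerivWithinAt.1 h0
  simp only
  rw [h.fderivWithin (uniqueDiffOn_stdTriangle p hp)]
  exact (formV_inclD R Ω (v.map i p) (D (1, 0)) (D (0, 1))).symm

end Capping

end SymplecticClosing

namespace SymplecticClosing

/-! ### Integrals that depend on a parameter -/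

section Parametric

variable {Y X : Type} [NormedAddCommGroup Y] [NormedSpace ℝ Y] [NormedAddCommGroup X]
  [NormedSpace ℝ X] {𝒰 : Set (Y × X)} {K : Set X}

omit [NormedSpace ℝ Y] [NormedSpace ℝ X] in
theorem isOpen_forall_prod_mem (h𝒰 : IsOpen 𝒰) (hK : IsCompact K) :
    IsOpen {y | ∀ x ∈ K, (y, x) ∈ 𝒰} := by
  rw [isOpen_iff_mem_nhds]
  intro y hy
  obtain ⟨u, v, hu, _, hyu, hKv, huv⟩ := generalized_tube_lemma (isCompact_singleton (x := y)) hK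
    h𝒰 (by rintro ⟨a, x⟩ ⟨ha, hx⟩; rw [show a = y from ha]; exact hy x hx)
  exact mem_of_superset (hu.mem_nhds (hyu rfl)) fun z hz x hx => huv ⟨hz, hKv hx⟩

omit [NormedSpace ℝ Y] [NormedSpace ℝ X] in
theorem continuousOn_prodMk_of_forall_mem {F : Type} [NormedAddCommGroup F]
    {f : Y × X → F} (hf : ContinuousOn f 𝒰) {y : Y} (hy : ∀ x ∈ K, (y, x) ∈ 𝒰) :
    ContinuousOn (fun x => f (y, x)) K :=
  hf.comp (f := fun x => (y, x)) (continuous_const.prodMk continuous_id).continuousOn hy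

variable [MeasurableSpace X] [BorelSpace X] {μ : Measure X} [IsFiniteMeasureOnCompacts μ]

/-- Differentiation under the integral sign. The derivative is bounded by some `C` on the compact
slice over `y`, and the tube lemma gives the bound `C + 1` on nearby slices. -/
theorem hasFDerivAt_setIntegral {F : Type} [NormedAddCommGroup F] [NormedSpace ℝ F]
    (h𝒰 : IsOpen 𝒰) (hK : IsCompact K) {f : Y × X → F}
    (hf : ContDiffOn ℝ 1 f 𝒰) {y : Y} (hy : ∀ x ∈ K, (y, x) ∈ 𝒰) :
    HasFDerivAt (fun y => ∫ x in K, f (y, x) ∂μ)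
      (∫ x in K, (fderiv ℝ f (y, x)).comp (ContinuousLinearMap.inl ℝ Y X) ∂μ) y := by
  let f' : Y × X → Y →L[ℝ] F := fun q => (fderiv ℝ f q).comp (ContinuousLinearMap.inl ℝ Y X)
  have hf' : ContinuousOn f' 𝒰 :=
    (hf.continuousOn_fderiv_of_isOpen h𝒰 le_rfl).clm_comp continuousOn_const
  obtain ⟨C, hC⟩ := hK.exists_bound_of_continuousOn (continuousOn_prodMk_of_forall_mem hf' hy)
  have hO := hf'.norm.isOpen_inter_preimage h𝒰 (isOpen_Iio (a := C + 1))
  obtain ⟨u, v, hu, _, hyu, hKv, huv⟩ := generalized_tube_lemma (isCompact_singleton (x := y)) hK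
    hO (by
      rintro ⟨a, x⟩ ⟨ha, hx⟩
      rw [show a = y from ha]
      exact ⟨hy x hx, (hC x hx).trans_lt (lt_add_one C)⟩)
  have hu' : u ∈ 𝓝 y := hu.mem_nhds (hyu rfl)
  have hm : ∀ z ∈ u, ∀ x ∈ K, (z, x) ∈ 𝒰 := fun z hz x hx => (huv ⟨hz, hKv hx⟩).1
  refine hasFDerivAt_integral_of_dominated_of_fderiv_le (F := fun y x => f (y, x))
    (F' := fun y x => f' (y, x)) (bound := fun _ => C + 1) hu' ?_ ?_ ?_ ?_ ?_ ?_
  · filter_upwards [hu'] with z hz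
    exact ((continuousOn_prodMk_of_forall_mem hf.continuousOn (hm z hz)).integrableOn_compact
      hK).aestronglyMeasurable
  · exact (continuousOn_prodMk_of_forall_mem hf.continuousOn hy).integrableOn_compact hK
  · exact ((continuousOn_prodMk_of_forall_mem hf' hy).integrableOn_compact hK).aestronglyMeasurable
  · exact ae_restrict_of_forall_mem hK.measurableSet fun x hx z hz => (huv ⟨hz, hKv hx⟩).2.le
  · exact continuousOn_const.integrableOn_compact hK
  · refine ae_restrict_of_forall_mem hK.measurableSet fun x hx z hz => ?_
    have h1 : HasFDerivAt f (fderiv ℝ f (z, x)) (z, x) :=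
      ((hf.contDiffAt (h𝒰.mem_nhds (hm z hz x hx))).differentiableAt (by simp)).hasFDerivAt
    exact HasFDerivAt.comp (g := f) (f := fun z => (z, x)) z h1 (hasFDerivAt_prodMk_left z x)

theorem contDiffOn_setIntegral_nat (h𝒰 : IsOpen 𝒰) (hK : IsCompact K) (m : ℕ) :
    ∀ {F : Type} [NormedAddCommGroup F] [NormedSpace ℝ F] {f : Y × X → F},
      ContDiffOn ℝ ∞ f 𝒰 →
      ContDiffOn ℝ m (fun y => ∫ x in K, f (y, x) ∂μ) {y | ∀ x ∈ K, (y, x) ∈ 𝒰} := by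
  induction m with
  | zero =>
    intro F _ _ f hf
    exact contDiffOn_zero.2 fun y hy => (hasFDerivAt_setIntegral h𝒰 hK (hf.of_le (by simp))
      hy).continuousAt.continuousWithinAt
  | succ m ih =>
    intro F _ _ f hf
    have hd : ∀ y ∈ {y | ∀ x ∈ K, (y, x) ∈ 𝒰}, HasFDerivAt (fun y => ∫ x in K, f (y, x) ∂μ)
      (∫ x in K, (fderiv ℝ f (y, x)).comp (ContinuousLinearMap.inl ℝ Y X) ∂μ) y := fun y hy =>
        hasFDerivAt_setIntegral h𝒰 hK (hf.of_le (by simp)) hy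
    have hO := isOpen_forall_prod_mem h𝒰 hK
    have hf' : ContDiffOn ℝ ∞ (fun q => (fderiv ℝ f q).comp (ContinuousLinearMap.inl ℝ Y X)) 𝒰 :=
      (hf.fderiv_of_isOpen h𝒰 (m := ∞) (by simp)).clm_comp contDiffOn_const
    push_cast
    rw [contDiffOn_succ_iff_fderiv_of_isOpen hO]
    refine ⟨fun y hy => (hd y hy).differentiableAt.differentiableWithinAt, by simp, ?_⟩
    exact (ih hf').congr fun y hy => (hd y hy).fderiv

theorem contDiffOn_setIntegral (h𝒰 : IsOpen 𝒰) (hK : IsCompact K) {F : Type}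
    [NormedAddCommGroup F] [NormedSpace ℝ F] {f : Y × X → F} (hf : ContDiffOn ℝ ∞ f 𝒰) :
    ContDiffOn ℝ ∞ (fun y => ∫ x in K, f (y, x) ∂μ) {y | ∀ x ∈ K, (y, x) ∈ 𝒰} :=
  contDiffOn_infty.2 fun m => contDiffOn_setIntegral_nat h𝒰 hK m hf

theorem fderiv_setIntegral (h𝒰 : IsOpen 𝒰) (hK : IsCompact K) {F : Type}
    [NormedAddCommGroup F] [NormedSpace ℝ F] {f : Y × X → F} (hf : ContDiffOn ℝ ∞ f 𝒰) {y : Y}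
    (hy : ∀ x ∈ K, (y, x) ∈ 𝒰) (w : Y) :
    fderiv ℝ (fun y => ∫ x in K, f (y, x) ∂μ) y w = ∫ x in K, fderiv ℝ f (y, x) (w, 0) ∂μ := by
  rw [(hasFDerivAt_setIntegral h𝒰 hK (hf.of_le (by simp)) hy).fderiv,
    ContinuousLinearMap.integral_apply]
  · simp
  · have hf' : ContinuousOn (fun q => (fderiv ℝ f q).comp (ContinuousLinearMap.inl ℝ Y X)) 𝒰 :=
      (hf.continuousOn_fderiv_of_isOpen h𝒰 (by simp)).clm_comp continuousOn_const
    exact (continuousOn_prodMk_of_forall_mem hf' hy).integrableOn_compact hK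

end Parametric

/-! ### The variation of the area of a homotopy -/

/-- The unit square. -/
def unitSquare : Set (ℝ × ℝ) := Icc 0 1 ×ˢ Icc 0 1

theorem isCompact_unitSquare : IsCompact unitSquare := isCompact_Icc.prod isCompact_Icc

theorem setIntegral_unitSquare {f : ℝ × ℝ → ℝ} (hf : IntegrableOn f unitSquare) :
    ∫ x in unitSquare, f x = ∫ s in (0 : ℝ)..1, ∫ t in (0 : ℝ)..1, f (s, t) := by
  rw [intervalIntegral.integral_of_le zero_le_one, ← integral_Icc_eq_integral_Ioc]
  simp only [intervalIntegral.integral_of_le zero_le_one, ← integral_Icc_eq_integral_Ioc]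
  exact setIntegral_prod f hf

section Variation

variable {V Y : Type} [NormedAddCommGroup V] [NormedSpace ℝ V] [NormedAddCommGroup Y]
  [NormedSpace ℝ Y] {B : V → V →L[ℝ] V →L[ℝ] ℝ} {O : Set V}

/-- Closedness makes the derivative of the area density along `w` a divergence on the square, and
the divergence theorem leaves one integral over each side. -/
theorem setIntegral_fderiv_pullbackForm (hB : IsClosedForm B O) (hO : IsOpen O)
    {U : Y × (ℝ × ℝ) → V} {𝒰 : Set (Y × (ℝ × ℝ))} (h𝒰 : IsOpen 𝒰) (hU : ContDiffOn ℝ ∞ U 𝒰)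
    (hUO : MapsTo U 𝒰 O) {y : Y} (hy : ∀ x ∈ unitSquare, (y, x) ∈ 𝒰) (w : Y) :
    ∫ x in unitSquare, fderiv ℝ (fun q => pullbackForm B U q (0, 1, 0) (0, 0, 1)) (y, x) (w, 0) =
      (∫ t in (0 : ℝ)..1, pullbackForm B U (y, 1, t) (w, 0) (0, 0, 1)) -
      (∫ t in (0 : ℝ)..1, pullbackForm B U (y, 0, t) (w, 0) (0, 0, 1)) -
      ((∫ s in (0 : ℝ)..1, pullbackForm B U (y, s, 1) (w, 0) (0, 1, 0)) -
        ∫ s in (0 : ℝ)..1, pullbackForm B U (y, s, 0) (w, 0) (0, 1, 0)) := by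
  have hα := contDiffOn_pullbackForm_apply hB.contDiffOn h𝒰 hU hUO (w, 0) (0, 0, 1)
  have hβ := contDiffOn_pullbackForm_apply hB.contDiffOn h𝒰 hU hUO (w, 0) (0, 1, 0)
  let ι : ℝ × ℝ → Y × (ℝ × ℝ) := fun x => (y, x)
  have cι : ContinuousOn ι unitSquare := (continuous_const.prodMk continuous_id).continuousOn
  let a' : ℝ × ℝ → ℝ × ℝ →L[ℝ] ℝ := fun x =>
    (fderiv ℝ (fun q => pullbackForm B U q (w, 0) (0, 0, 1)) (y, x)).comp
      (ContinuousLinearMap.inr ℝ Y (ℝ × ℝ))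
  let b' : ℝ × ℝ → ℝ × ℝ →L[ℝ] ℝ := fun x =>
    -(fderiv ℝ (fun q => pullbackForm B U q (w, 0) (0, 1, 0)) (y, x)).comp
      (ContinuousLinearMap.inr ℝ Y (ℝ × ℝ))
  have ha' : ContinuousOn a' unitSquare :=
    ((hα.continuousOn_fderiv_of_isOpen h𝒰 (by simp)).comp cι hy).clm_comp continuousOn_const
  have hb' : ContinuousOn b' unitSquare :=
    (((hβ.continuousOn_fderiv_of_isOpen h𝒰 (by simp)).comp cι hy).clm_comp continuousOn_const).neg
  have hi : IntegrableOn (fun x => a' x (1, 0) + b' x (0, 1)) unitSquare :=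
    ((ha'.clm_apply continuousOn_const).add
      (hb'.clm_apply continuousOn_const)).integrableOn_compact isCompact_unitSquare
  have e : ∫ x in unitSquare,
      fderiv ℝ (fun q => pullbackForm B U q (0, 1, 0) (0, 0, 1)) (y, x) (w, 0) =
      ∫ x in unitSquare, (a' x (1, 0) + b' x (0, 1)) := by
    refine setIntegral_congr_fun isCompact_unitSquare.measurableSet fun x hx => ?_
    have hcyc := hB.cyclic_sum_fderiv_pullbackForm hO (hU.contDiffAt (h𝒰.mem_nhds (hy x hx)))
      (hUO (hy x hx)) (w, 0) (0, 1, 0) (0, 0, 1)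
    have hneg : (fun q => pullbackForm B U q (0, 0, 1) (w, 0)) =ᶠ[𝓝 (y, x)]
        fun q => -pullbackForm B U q (w, 0) (0, 0, 1) := by
      filter_upwards [h𝒰.mem_nhds (hy x hx)] with z hz
      exact hB.skew _ (hUO hz) _ _
    rw [hneg.fderiv_eq, fderiv_fun_neg, neg_apply] at hcyc
    change _ = fderiv ℝ (fun q => pullbackForm B U q (w, 0) (0, 0, 1)) (y, x) (0, 1, 0) +
      -fderiv ℝ (fun q => pullbackForm B U q (w, 0) (0, 1, 0)) (y, x) (0, 0, 1)
    linarith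
  have hι : ∀ x, HasFDerivAt ι (ContinuousLinearMap.inr ℝ Y (ℝ × ℝ)) x := fun x =>
    hasFDerivAt_prodMk_right y x
  have hsub : ∀ x ∈ Ioo (min (0 : ℝ) 1) (max 0 1) ×ˢ Ioo (min (0 : ℝ) 1) (max 0 1),
      x ∈ unitSquare := by
    simp only [zero_le_one, min_eq_left, max_eq_right]
    exact fun x hx => ⟨Ioo_subset_Icc_self hx.1, Ioo_subset_Icc_self hx.2⟩
  rw [e, setIntegral_unitSquare hi, integral2_divergence_prod_of_hasFDerivAt
    (fun x => pullbackForm B U (ι x) (w, 0) (0, 0, 1))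
    (fun x => -pullbackForm B U (ι x) (w, 0) (0, 1, 0)) a' b' 0 0 1 1]
  · simp only [intervalIntegral.integral_neg, ι]
    ring
  · rw [uIcc_of_le zero_le_one]
    exact hα.continuousOn.comp cι hy
  · rw [uIcc_of_le zero_le_one]
    exact (hβ.continuousOn.comp cι hy).neg
  · intro x hx
    have h1 := ((hα.contDiffAt (h𝒰.mem_nhds (hy x (hsub x hx)))).differentiableAt
      (by simp)).hasFDerivAt
    exact HasFDerivAt.comp (g := fun q => pullbackForm B U q (w, 0) (0, 0, 1)) (f := ι) x h1 (hι x)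
  · intro x hx
    have h1 := ((hβ.contDiffAt (h𝒰.mem_nhds (hy x (hsub x hx)))).differentiableAt
      (by simp)).hasFDerivAt
    exact (HasFDerivAt.comp (g := fun q => pullbackForm B U q (w, 0) (0, 1, 0)) (f := ι) x h1
      (hι x)).neg
  · rw [uIcc_of_le zero_le_one]
    exact hi

variable {x₀ : ℝ → V} {c : Y × ℝ → V} {D : Set Y}

/-- The linear homotopy from a path to the paths of a family. -/
noncomputable def familyHomotopy (x₀ : ℝ → V) (c : Y × ℝ → V) (q : Y × (ℝ × ℝ)) : V :=
  (1 - q.2.1) • x₀ q.2.2 + q.2.1 • c (q.1, q.2.2)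

/-- The domain of the pullback of a form under a linear homotopy. -/
def homotopyDom (O : Set V) (D : Set Y) (x₀ : ℝ → V) (c : Y × ℝ → V) : Set (Y × (ℝ × ℝ)) :=
  (D ×ˢ univ) ∩ familyHomotopy x₀ c ⁻¹' O

theorem contDiffOn_familyHomotopy (hx₀ : ContDiff ℝ ∞ x₀) (hc : ContDiffOn ℝ ∞ c (D ×ˢ univ)) :
    ContDiffOn ℝ ∞ (familyHomotopy x₀ c) (D ×ˢ univ) := by
  have h1 : ContDiff ℝ ∞ fun q : Y × (ℝ × ℝ) => q.2.1 := contDiff_fst.comp contDiff_snd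
  have h2 : ContDiff ℝ ∞ fun q : Y × (ℝ × ℝ) => q.2.2 := contDiff_snd.comp contDiff_snd
  have h3 : ContDiff ℝ ∞ fun q : Y × (ℝ × ℝ) => (q.1, q.2.2) := contDiff_fst.prodMk h2
  exact ((contDiffOn_const.sub h1.contDiffOn).smul (hx₀.comp h2).contDiffOn).add
    (h1.contDiffOn.smul (hc.comp h3.contDiffOn fun q hq => ⟨hq.1, mem_univ _⟩))

theorem isOpen_homotopyDom (hO : IsOpen O) (hD : IsOpen D) (hx₀ : ContDiff ℝ ∞ x₀)
    (hc : ContDiffOn ℝ ∞ c (D ×ˢ univ)) : IsOpen (homotopyDom O D x₀ c) :=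
  (contDiffOn_familyHomotopy hx₀ hc).continuousOn.isOpen_inter_preimage (hD.prod isOpen_univ) hO

theorem fderiv_familyHomotopy (hD : IsOpen D) (hx₀ : ContDiff ℝ ∞ x₀)
    (hc : ContDiffOn ℝ ∞ c (D ×ˢ univ)) {q : Y × (ℝ × ℝ)} (hq : q.1 ∈ D) (a : Y × (ℝ × ℝ)) :
    fderiv ℝ (familyHomotopy x₀ c) q a = a.2.1 • (c (q.1, q.2.2) - x₀ q.2.2) +
      (((1 - q.2.1) * a.2.2) • deriv x₀ q.2.2 +
        q.2.1 • fderiv ℝ c (q.1, q.2.2) (a.1, a.2.2)) := by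
  have k1 : HasFDerivAt (fun q : Y × (ℝ × ℝ) => q.2.1)
      ((ContinuousLinearMap.fst ℝ ℝ ℝ).comp (ContinuousLinearMap.snd ℝ Y (ℝ × ℝ))) q :=
    hasFDerivAt_fst.comp q hasFDerivAt_snd
  have k2 : HasFDerivAt (fun q : Y × (ℝ × ℝ) => q.2.2)
      ((ContinuousLinearMap.snd ℝ ℝ ℝ).comp (ContinuousLinearMap.snd ℝ Y (ℝ × ℝ))) q :=
    hasFDerivAt_snd.comp q hasFDerivAt_snd
  have k3 := (hasFDerivAt_fst (𝕜 := ℝ) (p := q)).prodMk k2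
  have h0 : HasFDerivAt x₀ _ q.2.2 :=
    ((hx₀.differentiable (by simp)) q.2.2).hasDerivAt.hasFDerivAt
  have h1 : HasFDerivAt c (fderiv ℝ c (q.1, q.2.2)) (q.1, q.2.2) :=
    ((hc.contDiffAt ((hD.prod isOpen_univ).mem_nhds ⟨hq, mem_univ _⟩)).differentiableAt
      (by simp)).hasFDerivAt
  have h0' := HasFDerivAt.comp (g := x₀) (f := fun q : Y × (ℝ × ℝ) => q.2.2) q h0 k2
  have h1' := HasFDerivAt.comp (g := c) (f := fun q : Y × (ℝ × ℝ) => (q.1, q.2.2)) q h1 k3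
  have h : HasFDerivAt (familyHomotopy x₀ c) _ q := ((k1.const_sub 1).smul h0').add (k1.smul h1')
  rw [h.fderiv]
  simp
  module

/-- The area of the linear homotopy to a path of the family. -/
noncomputable def familyArea (B : V → V →L[ℝ] V →L[ℝ] ℝ) (x₀ : ℝ → V) (c : Y × ℝ → V) (y : Y) : ℝ :=
  ∫ x in unitSquare, pullbackForm B (familyHomotopy x₀ c) (y, x) (0, 1, 0) (0, 0, 1)

theorem contDiffOn_pullbackForm_familyHomotopy (hB : IsClosedForm B O) (hO : IsOpen O)
    (hD : IsOpen D) (hx₀ : ContDiff ℝ ∞ x₀) (hc : ContDiffOn ℝ ∞ c (D ×ˢ univ))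
    (a b : Y × (ℝ × ℝ)) :
    ContDiffOn ℝ ∞ (fun q => pullbackForm B (familyHomotopy x₀ c) q a b)
      (homotopyDom O D x₀ c) :=
  contDiffOn_pullbackForm_apply hB.contDiffOn (isOpen_homotopyDom hO hD hx₀ hc)
    ((contDiffOn_familyHomotopy hx₀ hc).mono inter_subset_left) (fun _ hq => hq.2) a b

theorem familyArea_eq (hB : IsClosedForm B O) (hO : IsOpen O)
    (hD : IsOpen D) (hx₀ : ContDiff ℝ ∞ x₀) (hc : ContDiffOn ℝ ∞ c (D ×ˢ univ)) {y : Y}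
    (hy : ∀ x ∈ unitSquare, (y, x) ∈ homotopyDom O D x₀ c) :
    familyArea B x₀ c y = homotopyArea B x₀ fun t => c (y, t) := by
  have hyD : y ∈ D := (hy (0, 0) ⟨by simp, by simp⟩).1.1
  have hcont := continuousOn_prodMk_of_forall_mem
    (contDiffOn_pullbackForm_familyHomotopy hB hO hD hx₀ hc (0, 1, 0) (0, 0, 1)).continuousOn hy
  rw [familyArea, setIntegral_unitSquare (hcont.integrableOn_compact isCompact_unitSquare)]
  refine intervalIntegral.integral_congr fun s _ => intervalIntegral.integral_congr fun t ht => ?_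
  rw [uIcc_of_le zero_le_one] at ht
  have h1 : HasFDerivAt c (fderiv ℝ c (y, t)) (y, t) :=
    ((hc.contDiffAt ((hD.prod isOpen_univ).mem_nhds ⟨hyD, mem_univ _⟩)).differentiableAt
      (by simp)).hasFDerivAt
  have h2 : HasDerivAt (fun t => c (y, t)) (fderiv ℝ c (y, t) (0, 1)) t :=
    HasFDerivAt.comp_hasDerivAt (f := fun t : ℝ => (y, t)) (l := c) t h1
      ((hasDerivAt_const t y).prodMk (hasDerivAt_id t))
  have hu := uniqueDiffOn_Icc (zero_lt_one (α := ℝ)) t ht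
  have h3 : HasDerivAt x₀ (deriv x₀ t) t := ((hx₀.differentiable (by simp)) t).hasDerivAt
  simp only [pullbackForm_apply]
  rw [fderiv_familyHomotopy hD hx₀ hc (by exact hyD), fderiv_familyHomotopy hD hx₀ hc (by exact hyD),
    h2.hasDerivWithinAt.derivWithin hu, h3.hasDerivWithinAt.derivWithin hu]
  have z0 : fderiv ℝ c (y, t) (0, 0) = 0 := map_zero _
  simp [familyHomotopy, z0]

/-- Of the four sides only `s = 1` contributes: on `s = 0` the reference path does not vary, and the
sides `t = 0` and `t = 1` cancel because all paths involved are loops. This is the first variation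
of area. -/
theorem fderiv_familyArea (hB : IsClosedForm B O) (hO : IsOpen O)
    (hD : IsOpen D) (hx₀ : ContDiff ℝ ∞ x₀) (hc : ContDiffOn ℝ ∞ c (D ×ˢ univ))
    (h01 : x₀ 0 = x₀ 1) (hc01 : ∀ y ∈ D, c (y, 0) = c (y, 1)) {y : Y}
    (hy : ∀ x ∈ unitSquare, (y, x) ∈ homotopyDom O D x₀ c) (w : Y) :
    fderiv ℝ (familyArea B x₀ c) y w =
      ∫ t in (0 : ℝ)..1, B (c (y, t)) (fderiv ℝ c (y, t) (w, 0)) (fderiv ℝ c (y, t) (0, 1)) := by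
  have hyD : y ∈ D := (hy (0, 0) ⟨by simp, by simp⟩).1.1
  have h𝒰 := isOpen_homotopyDom hO hD hx₀ hc
  have hU := (contDiffOn_familyHomotopy hx₀ hc).mono
    (inter_subset_left (t := familyHomotopy x₀ c ⁻¹' O))
  have e := fderiv_setIntegral (μ := volume) h𝒰 isCompact_unitSquare
    (contDiffOn_pullbackForm_familyHomotopy hB hO hD hx₀ hc (0, 1, 0) (0, 0, 1)) hy w
  have e' := setIntegral_fderiv_pullbackForm hB hO h𝒰 hU (fun _ hq => hq.2) hy w
  have hdc : fderiv ℝ c (y, 0) (w, 0) = fderiv ℝ c (y, 1) (w, 0) := by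
    have h1 : ∀ t, HasFDerivAt (fun y => c (y, t))
        ((fderiv ℝ c (y, t)).comp (ContinuousLinearMap.inl ℝ Y ℝ)) y := fun t =>
      HasFDerivAt.comp (g := c) (f := fun y => (y, t)) y
        ((hc.contDiffAt ((hD.prod isOpen_univ).mem_nhds ⟨hyD, mem_univ _⟩)).differentiableAt
          (by simp)).hasFDerivAt (hasFDerivAt_prodMk_left y t)
    have h2 : (fun y => c (y, 0)) =ᶠ[𝓝 y] fun y => c (y, 1) := by
      filter_upwards [hD.mem_nhds hyD] with z hz using hc01 z hz
    have h3 := (h1 0).unique ((h1 1).congr_of_eventuallyEq h2)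
    exact congrArg (fun A => A w) h3
  have b0 : ∀ t, pullbackForm B (familyHomotopy x₀ c) (y, 0, t) (w, 0) (0, 0, 1) = 0 := fun t => by
    rw [pullbackForm_apply, fderiv_familyHomotopy hD hx₀ hc (by exact hyD)]
    simp
  have b1 : ∀ s, pullbackForm B (familyHomotopy x₀ c) (y, s, 1) (w, 0) (0, 1, 0) =
      pullbackForm B (familyHomotopy x₀ c) (y, s, 0) (w, 0) (0, 1, 0) := fun s => by
    simp only [pullbackForm_apply]
    rw [fderiv_familyHomotopy hD hx₀ hc (by exact hyD),
      fderiv_familyHomotopy hD hx₀ hc (by exact hyD), fderiv_familyHomotopy hD hx₀ hc (by exact hyD),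
      fderiv_familyHomotopy hD hx₀ hc (by exact hyD)]
    have z0 : ∀ t, fderiv ℝ c (y, t) (0, 0) = 0 := fun t => map_zero _
    simp [familyHomotopy, h01, hc01 y hyD, hdc, z0]
  refine e.trans (e'.trans ?_)
  simp only [b0, b1, intervalIntegral.integral_zero, sub_self, sub_zero]
  refine intervalIntegral.integral_congr fun t _ => ?_
  simp only [pullbackForm_apply]
  rw [fderiv_familyHomotopy hD hx₀ hc (by exact hyD), fderiv_familyHomotopy hD hx₀ hc (by exact hyD)]
  simp [familyHomotopy]

end Variation

end SymplecticClosing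

namespace SymplecticClosing

/-! ### The local action functional -/

section LocalAction

variable {n : ℕ} {M : Type*} [TopologicalSpace M] [ChartedSpace (EuclideanSpace ℝ (Fin (2 * n))) M]
variable {V : Type} [NormedAddCommGroup V] [InnerProductSpace ℝ V]

/-- The flow lines, closed up to loops. -/
noncomputable def loopV (R : SmoothRetract (2 * n) M V)
    (ψ : ℝ → (M ≃ₘ⟮𝓡 (2 * n), 𝓡 (2 * n)⟯ M)) (q : V × ℝ) : V :=
  flowV R ψ (q.2, q.1) - lateStep q.2 • (flowV R ψ (1, q.1) - flowV R ψ (0, q.1))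

/-- The Hamiltonian along the flow lines. -/
noncomputable def hamV (R : SmoothRetract (2 * n) M V) (K : ℝ × M → ℝ)
    (ψ : ℝ → (M ≃ₘ⟮𝓡 (2 * n), 𝓡 (2 * n)⟯ M)) (q : V × ℝ) : ℝ :=
  K (q.2, ψ q.2 (R.retr q.1))

/-- The action of the loop through a point, capped by a surface of area `C` with boundary `x₀` and
the linear homotopy from `x₀`. -/
noncomputable def localAction (R : SmoothRetract (2 * n) M V) (Ω : SymplecticForm n M)
    (K : ℝ × M → ℝ) (ψ : ℝ → (M ≃ₘ⟮𝓡 (2 * n), 𝓡 (2 * n)⟯ M)) (C : ℝ) (x₀ : ℝ → V) (y : V) : ℝ :=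
  (∫ t in Icc (0 : ℝ) 1, hamV R K ψ (y, t)) - C - familyArea (formV R Ω) x₀ (loopV R ψ) y

/-- The domain of the local action functional. -/
def localDom (R : SmoothRetract (2 * n) M V)
    (ψ : ℝ → (M ≃ₘ⟮𝓡 (2 * n), 𝓡 (2 * n)⟯ M)) (x₀ : ℝ → V) : Set V :=
  {y | ∀ x ∈ unitSquare, (y, x) ∈ homotopyDom R.dom R.dom x₀ (loopV R ψ)}

variable [IsManifold (𝓡 (2 * n)) ∞ M] [CompactSpace M] [FiniteDimensional ℝ V]
variable {R : SmoothRetract (2 * n) M V} {Ω : SymplecticForm n M} {K : ℝ × M → ℝ}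
  {ψ : ℝ → (M ≃ₘ⟮𝓡 (2 * n), 𝓡 (2 * n)⟯ M)}

theorem IsSmoothFlow.contDiffOn_loopV (h : IsSmoothFlow R Ω K ψ) :
    ContDiffOn ℝ ∞ (loopV R ψ) (R.dom ×ˢ univ) := by
  have key : ∀ τ : V × ℝ → ℝ, ContDiff ℝ ∞ τ →
      ContDiffOn ℝ ∞ (fun q : V × ℝ => flowV R ψ (τ q, q.1)) (R.dom ×ˢ univ) := fun τ hτ =>
    h.contDiffOn_flowV.comp (f := fun q : V × ℝ => (τ q, q.1)) (hτ.prodMk contDiff_fst).contDiffOn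
      fun q hq => ⟨mem_univ _, hq.1⟩
  exact (key _ contDiff_snd).sub ((contDiff_lateStep.comp contDiff_snd).contDiffOn.smul
    ((key _ contDiff_const).sub (key _ contDiff_const)))

omit [IsManifold (𝓡 (2 * n)) ∞ M] [CompactSpace M] [FiniteDimensional ℝ V] in
theorem loopV_zero_eq_loopV_one (y : V) : loopV R ψ (y, 0) = loopV R ψ (y, 1) := by
  simp [loopV, lateStep_one, lateStep_eq_zero (show (0 : ℝ) ≤ 2 / 3 by norm_num)]

omit [CompactSpace M] [FiniteDimensional ℝ V] [IsManifold (𝓡 (2 * n)) ∞ M] in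
theorem IsSmoothFlow.flowV_sub_flowV (h : IsSmoothFlow R Ω K ψ) {p : M} (hp : ψ 1 p = p) :
    flowV R ψ (1, R.incl p) - flowV R ψ (0, R.incl p) = 0 := by
  simp [flowV, R.retr_incl, hp, h.zero]

omit [CompactSpace M] [FiniteDimensional ℝ V] [IsManifold (𝓡 (2 * n)) ∞ M] in
theorem IsSmoothFlow.loopV_incl (h : IsSmoothFlow R Ω K ψ) {p : M} (hp : ψ 1 p = p) (t : ℝ) :
    loopV R ψ (R.incl p, t) = R.incl (ψ t p) := by
  rw [loopV, h.flowV_sub_flowV hp, smul_zero, sub_zero, flowV, R.retr_incl]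

theorem IsSmoothFlow.fderiv_loopV (h : IsSmoothFlow R Ω K ψ) {q : V × ℝ} (hq : q.1 ∈ R.dom)
    (a : V × ℝ) : fderiv ℝ (loopV R ψ) q a = fderiv ℝ (flowV R ψ) (q.2, q.1) (a.2, a.1) -
      ((a.2 * deriv lateStep q.2) • (flowV R ψ (1, q.1) - flowV R ψ (0, q.1)) +
      lateStep q.2 • (fderiv ℝ (flowV R ψ) (1, q.1) (0, a.1) -
        fderiv ℝ (flowV R ψ) (0, q.1) (0, a.1))) := by
  have k0 : HasFDerivAt (fun q : V × ℝ => flowV R ψ (q.2, q.1)) _ q :=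
    HasFDerivAt.comp (g := flowV R ψ) (f := fun q : V × ℝ => (q.2, q.1)) q
      (h.hasFDerivAt_flowV (p := (q.2, q.1)) hq) (hasFDerivAt_snd.prodMk hasFDerivAt_fst)
  have k1 : ∀ s : ℝ, HasFDerivAt (fun q : V × ℝ => flowV R ψ (s, q.1)) _ q := fun s =>
    HasFDerivAt.comp (g := flowV R ψ) (f := fun q : V × ℝ => (s, q.1)) q
      (h.hasFDerivAt_flowV (p := (s, q.1)) hq) ((hasFDerivAt_const s q).prodMk hasFDerivAt_fst)
  have k2 : HasFDerivAt (fun q : V × ℝ => lateStep q.2) _ q :=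
    HasFDerivAt.comp (g := lateStep) (f := fun q : V × ℝ => q.2) q
      ((contDiff_lateStep.differentiable (by simp)) q.2).hasDerivAt.hasFDerivAt hasFDerivAt_snd
  have k : HasFDerivAt (loopV R ψ) _ q := k0.sub (k2.smul ((k1 1).sub (k1 0)))
  rw [k.fderiv]
  simp
  module

theorem IsSmoothFlow.contDiffOn_hamV (h : IsSmoothFlow R Ω K ψ) :
    ContDiffOn ℝ ∞ (hamV R K ψ) (R.dom ×ˢ univ) := by
  rw [← contMDiffOn_iff_contDiffOn]
  have h1 : ContMDiffOn 𝓘(ℝ, V × ℝ) (𝓘(ℝ, ℝ).prod (𝓡 (2 * n))) ∞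
      (fun q : V × ℝ => (q.2, R.retr q.1)) (R.dom ×ˢ univ) :=
    contDiff_snd.contMDiff.contMDiffOn.prodMk
      (R.contMDiffOn_retr.comp contDiff_fst.contMDiff.contMDiffOn fun p hp => hp.1)
  exact (h.smooth.comp (contMDiff_fst.prodMk h.contMDiff)).comp_contMDiffOn h1

theorem IsSmoothFlow.fderiv_hamV (h : IsSmoothFlow R Ω K ψ) {q : V × ℝ} (hq : q.1 ∈ R.dom)
    (w : V) : fderiv ℝ (hamV R K ψ) q (w, 0) =
      -formV R Ω (R.incl (ψ q.2 (R.retr q.1)))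
        (gradV R Ω (fun z => K (q.2, z)) (ψ q.2 (R.retr q.1)))
        (fderiv ℝ (flowV R ψ) (q.2, q.1) (0, w)) := by
  rw [formV_gradV, neg_neg]
  have h1 : HasFDerivAt (hamV R K ψ) (fderiv ℝ (hamV R K ψ) q) q :=
    ((h.contDiffOn_hamV.contDiffAt ((R.isOpen_dom.prod isOpen_univ).mem_nhds
      ⟨hq, mem_univ _⟩)).differentiableAt (by simp)).hasFDerivAt
  have h2 := HasFDerivAt.comp (g := hamV R K ψ) (f := fun y : V => (y, q.2)) q.1 h1
    (hasFDerivAt_prodMk_left q.1 q.2)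
  let f : M → ℝ := fun z => K (q.2, z)
  have hf : ContMDiff (𝓡 (2 * n)) 𝓘(ℝ, ℝ) ∞ f := contMDiff_slice h.smooth q.2
  have h3 : HasFDerivAt (fun y => f (R.retr y)) (fderiv ℝ (fun y => f (R.retr y))
      (flowV R ψ (q.2, q.1))) (flowV R ψ (q.2, q.1)) := by
    have h4 : ContDiffOn ℝ ∞ (fun y => f (R.retr y)) R.dom := by
      rw [← contMDiffOn_iff_contDiffOn]
      exact hf.comp_contMDiffOn R.contMDiffOn_retr
    exact ((h4.contDiffAt (R.isOpen_dom.mem_nhds (R.incl_mem _))).differentiableAt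
      (by simp)).hasFDerivAt
  have h5 := HasFDerivAt.comp (g := flowV R ψ) (f := fun y : V => (q.2, y)) q.1
    (h.hasFDerivAt_flowV (p := (q.2, q.1)) hq) (hasFDerivAt_prodMk_right q.2 q.1)
  have h6 := HasFDerivAt.comp (g := fun y => f (R.retr y)) q.1 h3 h5
  have h7 : hamV R K ψ ∘ (fun y : V => (y, q.2)) =
      (fun y => f (R.retr y)) ∘ flowV R ψ ∘ fun y : V => (q.2, y) := by
    funext y
    simp only [Function.comp_def, hamV, flowV, R.retr_incl, f]
  rw [h7] at h2
  have h8 := congrArg (fun A => A w) (h2.unique h6)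
  have h9 : fderiv ℝ (hamV R K ψ) q (w, 0) = fderiv ℝ (fun y => f (R.retr y))
      (flowV R ψ (q.2, q.1)) (fderiv ℝ (flowV R ψ) (q.2, q.1) (0, w)) := h8
  rw [h9, fderiv_comp_retr R (y := flowV R ψ (q.2, q.1)) (R.incl_mem _)
    ((hf.contMDiffAt).mdifferentiableAt (by simp))]
  simp only [flowV, R.retr_incl, f]

theorem IsSmoothFlow.isOpen_localDom (h : IsSmoothFlow R Ω K ψ) {x₀ : ℝ → V}
    (hx₀ : ContDiff ℝ ∞ x₀) : IsOpen (localDom R ψ x₀) :=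
  isOpen_forall_prod_mem (isOpen_homotopyDom R.isOpen_dom R.isOpen_dom hx₀ h.contDiffOn_loopV)
    isCompact_unitSquare

omit [IsManifold (𝓡 (2 * n)) ∞ M] [CompactSpace M] [FiniteDimensional ℝ V] in
theorem localDom_subset {x₀ : ℝ → V} : localDom R ψ x₀ ⊆ R.dom := fun _ hy =>
  (hy (0, 0) ⟨by simp, by simp⟩).1.1

theorem IsSmoothFlow.contDiffOn_integral_hamV (h : IsSmoothFlow R Ω K ψ) :
    ContDiffOn ℝ ∞ (fun y => ∫ t in Icc (0 : ℝ) 1, hamV R K ψ (y, t)) R.dom :=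
  (contDiffOn_setIntegral (R.isOpen_dom.prod isOpen_univ) isCompact_Icc h.contDiffOn_hamV).mono
    fun _ hy _ _ => ⟨hy, mem_univ _⟩

theorem IsSmoothFlow.contDiffOn_familyArea (h : IsSmoothFlow R Ω K ψ) {x₀ : ℝ → V}
    (hx₀ : ContDiff ℝ ∞ x₀) :
    ContDiffOn ℝ ∞ (familyArea (formV R Ω) x₀ (loopV R ψ)) (localDom R ψ x₀) :=
  contDiffOn_setIntegral (isOpen_homotopyDom R.isOpen_dom R.isOpen_dom hx₀ h.contDiffOn_loopV)
    isCompact_unitSquare (contDiffOn_pullbackForm_familyHomotopy (isClosedForm_formV R Ω)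
      R.isOpen_dom R.isOpen_dom hx₀ h.contDiffOn_loopV _ _)

theorem IsSmoothFlow.contDiffOn_localAction (h : IsSmoothFlow R Ω K ψ) (C : ℝ) {x₀ : ℝ → V}
    (hx₀ : ContDiff ℝ ∞ x₀) :
    ContDiffOn ℝ ∞ (localAction R Ω K ψ C x₀) (localDom R ψ x₀) :=
  ((h.contDiffOn_integral_hamV.mono localDom_subset).sub contDiffOn_const).sub
    (h.contDiffOn_familyArea hx₀)

/-- Fixed points are critical points of the local action functional. -/
theorem IsSmoothFlow.fderiv_localAction (h : IsSmoothFlow R Ω K ψ)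
    (hK : ∀ t, 1 / 3 < t → ∀ x, K (t, x) = 0) (C : ℝ) {x₀ : ℝ → V}
    (hx₀ : ContDiff ℝ ∞ x₀) (h01 : x₀ 0 = x₀ 1) {p : M} (hp : ψ 1 p = p)
    (hpW : R.incl p ∈ localDom R ψ x₀) :
    fderiv ℝ (localAction R Ω K ψ C x₀) (R.incl p) = 0 := by
  ext w
  have d1 := (h.contDiffOn_integral_hamV.contDiffAt
    (R.isOpen_dom.mem_nhds (R.incl_mem p))).differentiableAt (by simp)
  have d2 := ((h.contDiffOn_familyArea hx₀).contDiffAt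
    ((h.isOpen_localDom hx₀).mem_nhds hpW)).differentiableAt (by simp)
  have d3 : HasFDerivAt (localAction R Ω K ψ C x₀) _ (R.incl p) :=
    (d1.hasFDerivAt.sub_const C).sub d2.hasFDerivAt
  rw [d3.fderiv, sub_apply, fderiv_familyArea (isClosedForm_formV R Ω) R.isOpen_dom R.isOpen_dom hx₀
    h.contDiffOn_loopV h01 (fun y _ => loopV_zero_eq_loopV_one y) hpW w,
    fderiv_setIntegral (R.isOpen_dom.prod isOpen_univ) isCompact_Icc h.contDiffOn_hamV
      (fun _ _ => ⟨R.incl_mem p, mem_univ _⟩) w, integral_Icc_eq_integral_Ioc,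
    ← intervalIntegral.integral_of_le zero_le_one, zero_apply, sub_eq_zero]
  refine intervalIntegral.integral_congr fun t _ => ?_
  -- At a fixed point the flow line is already closed, so the closing correction has no time
  -- derivative there, and the loop moves with the Hamiltonian velocity.
  have e1 : fderiv ℝ (loopV R ψ) (R.incl p, t) (0, 1) = gradV R Ω (fun z => K (t, z)) (ψ t p) := by
    rw [h.fderiv_loopV (R.incl_mem p), h.flowV_sub_flowV hp,
      h.fderiv_flowV_time (p := (t, R.incl p)) (R.incl_mem p)]
    have z0 : ∀ s : ℝ, fderiv ℝ (flowV R ψ) (s, R.incl p) (0, 0) = 0 := fun s => map_zero _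
    simp [R.retr_incl, z0]
  rw [h.fderiv_hamV (R.incl_mem p), e1, h.loopV_incl hp]
  simp only [R.retr_incl]
  -- Up to `1/3` the correction is not yet switched on, and the two integrands agree by the
  -- definition of the Hamiltonian field. Later the Hamiltonian and its field vanish, so both
  -- integrands are zero whatever the correction does.
  rcases le_or_gt t (1 / 3) with ht | ht
  · have e2 : fderiv ℝ (loopV R ψ) (R.incl p, t) (w, 0) =
        fderiv ℝ (flowV R ψ) (t, R.incl p) (0, w) := by
      rw [h.fderiv_loopV (R.incl_mem p), lateStep_eq_zero (by simp only; linarith)]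
      simp
    rw [e2, (isClosedForm_formV R Ω).skew _ (R.incl_mem _), neg_neg]
  · have e3 : gradV R Ω (fun z => K (t, z)) (ψ t p) = 0 :=
      gradV_eq_zero_of_eventuallyEq R Ω (c := 0) (Eventually.of_forall fun z => hK t ht z)
    simp [e3]

/-- The action of a capped orbit as a value of the local action functional. -/
theorem IsSmoothFlow.action_eq_localAction (h : IsSmoothFlow R Ω K ψ) {x : ℝ → M}
    (v : Capping (n := n) x) (hx : IsHamOrbit Ω (toHam K h.smooth) x) (hx1 : x 0 = x 1) {C : ℝ}
    {x₀ : ℝ → V} (hx₀ : ContDiff ℝ ∞ x₀)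
    (hv : v.area Ω - C = homotopyArea (formV R Ω) x₀ fun t => R.incl (x t))
    (hdom : ∀ s ∈ Icc (0 : ℝ) 1, ∀ t ∈ Icc (0 : ℝ) 1, (1 - s) • x₀ t + s • R.incl (x t) ∈ R.dom) :
    ψ 1 (x 0) = x 0 ∧ R.incl (x 0) ∈ localDom R ψ x₀ ∧
      action Ω (toHam K h.smooth) x v = localAction R Ω K ψ C x₀ (R.incl (x 0)) := by
  have ho := h.orbit_eq hx
  have hp : ψ 1 (x 0) = x 0 := by rw [← ho 1 (by simp), hx1]
  have hW : R.incl (x 0) ∈ localDom R ψ x₀ := by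
    refine fun q hq => ⟨⟨R.incl_mem _, mem_univ _⟩, ?_⟩
    simp only [mem_preimage, familyHomotopy]
    rw [h.loopV_incl hp, ← ho _ hq.2]
    exact hdom _ hq.1 _ hq.2
  refine ⟨hp, hW, ?_⟩
  have e1 : ∫ t : unitInterval, toHam K h.smooth (t, x t) =
      ∫ t in Icc (0 : ℝ) 1, hamV R K ψ (R.incl (x 0), t) := by
    rw [← integral_subtype measurableSet_Icc]
    refine integral_congr_ae (Eventually.of_forall fun t => ?_)
    simp only [hamV, R.retr_incl, toHam_apply]
    rw [← ho t t.2]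
  have e2 : familyArea (formV R Ω) x₀ (loopV R ψ) (R.incl (x 0)) =
      homotopyArea (formV R Ω) x₀ fun t => R.incl (x t) := by
    rw [familyArea_eq (isClosedForm_formV R Ω) R.isOpen_dom R.isOpen_dom hx₀ h.contDiffOn_loopV hW]
    refine homotopyArea_congr (fun _ _ => rfl) fun t ht => ?_
    rw [h.loopV_incl hp, ← ho t ht]
  rw [action, localAction, e1, e2, ← hv]
  ring

end LocalAction

end SymplecticClosing

namespace SymplecticClosing

/-! ### Action spectra have measure zero -/

section CriticalValues

variable {V : Type} [NormedAddCommGroup V] [NormedSpace ℝ V]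

/-- `S` consists of critical values of countably many smooth functions on open sets. -/
def IsCriticalValueSet (V : Type) [NormedAddCommGroup V] [NormedSpace ℝ V] (S : Set ℝ) : Prop :=
  ∃ (ι : Type) (_ : Countable ι) (F : ι → V → ℝ) (W : ι → Set V),
    (∀ j, IsOpen (W j) ∧ ContDiffOn ℝ ∞ (F j) (W j)) ∧
    S ⊆ ⋃ j, F j '' {y ∈ W j | fderiv ℝ (F j) y = 0}

theorem isCriticalValueSet_iUnion {κ : Type} [Countable κ] {S : κ → Set ℝ}
    (h : ∀ k, IsCriticalValueSet V (S k)) : IsCriticalValueSet V (⋃ k, S k) := by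
  choose ι hι F W hFW hS using h
  refine ⟨Σ k, ι k, inferInstance, fun j => F j.1 j.2, fun j => W j.1 j.2, fun j => hFW j.1 j.2, ?_⟩
  refine iUnion_subset fun k a ha => ?_
  obtain ⟨j, hj⟩ := mem_iUnion.1 (hS k ha)
  exact mem_iUnion.2 ⟨⟨k, j⟩, hj⟩

/-- Finite sums of critical values of smooth functions form a null set. -/
theorem IsCriticalValueSet.volume_finiteSums [FiniteDimensional ℝ V] {S : Set ℝ}
    (hS : IsCriticalValueSet V S) : volume (finiteSums S) = 0 := by
  obtain ⟨ι, _, F, W, hFW, hS⟩ := hS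
  -- A choice of `l` of the functions gives one function on `V^l`, the sum of their values at the
  -- separate coordinates. A point with critical coordinates is critical for it, and there are only
  -- countably many choices.
  let G : (Σ l : ℕ, Fin l → ι) → Set ℝ := fun i =>
    (fun y : Fin i.1 → V => ∑ k, F (i.2 k) (y k)) ''
      {y ∈ univ.pi fun k => W (i.2 k) |
        fderiv ℝ (fun y : Fin i.1 → V => ∑ k, F (i.2 k) (y k)) y = 0}
  have hG : ∀ i, volume (G i) = 0 := by
    rintro ⟨l, i⟩
    refine volume_criticalValues_eq_zero _ rfl
      (isOpen_set_pi finite_univ fun k _ => (hFW (i k)).1) ?_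
    refine ContDiffOn.sum fun k _ => ?_
    have hp : ContDiff ℝ ∞ fun y : Fin l → V => y k := contDiff_apply ℝ V k
    exact (hFW (i k)).2.comp hp.contDiffOn fun y hy => hy k (mem_univ k)
  refine measure_mono_null ?_ (measure_iUnion_null hG)
  rintro a ⟨l, b, hb, rfl⟩
  choose i hi using fun k => mem_iUnion.1 (hS (hb k))
  choose y hy hyb using hi
  refine mem_iUnion.2 ⟨⟨l, i⟩, y, ⟨fun k _ => (hy k).1, ?_⟩, by simp only [hyb]⟩
  have h1 : ∀ k, HasFDerivAt (fun y : Fin l → V => F (i k) (y k)) (0 : (Fin l → V) →L[ℝ] ℝ) y := by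
    intro k
    have h2 : HasFDerivAt (F (i k)) (0 : V →L[ℝ] ℝ) (y k) := by
      rw [← (hy k).2]
      exact (((hFW (i k)).2.contDiffAt ((hFW (i k)).1.mem_nhds (hy k).1)).differentiableAt
        (by simp)).hasFDerivAt
    have h3 := HasFDerivAt.comp (g := F (i k)) (f := fun y : Fin l → V => y k) y h2
      (hasFDerivAt_apply k y)
    rwa [ContinuousLinearMap.zero_comp] at h3
  have h4 := HasFDerivAt.fun_sum (u := Finset.univ) fun k _ => h1 k
  simp only [Finset.sum_const_zero] at h4
  exact h4.fderiv

end CriticalValues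

/-! ### Countably many reference cappings and the nullness of the spectra. -/

section Countability

variable {n : ℕ} {M : Type*} [TopologicalSpace M] [ChartedSpace (EuclideanSpace ℝ (Fin (2 * n))) M]
variable {V : Type} [NormedAddCommGroup V] [InnerProductSpace ℝ V]

/-- The combinatorial types of cappings, together with maps of the triangles. -/
abbrev CappingData (V : Type) [TopologicalSpace V] : Type :=
  Σ N : ℕ, (Fin N × Fin 3 → Fin N × Fin 3) × ((Fin N × Fin 3) × (Fin N → C(stdTriangle, V)))

/-- The data of a capping. -/
noncomputable def cappingData (R : SmoothRetract (2 * n) M V)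
    (c : Σ x : ℝ → M, Capping (n := n) x) : CappingData V :=
  ⟨c.2.size, c.2.pair, c.2.free, fun i => ⟨fun p => R.incl (c.2.map i p),
    (c.2.contDiffOn_incl R i).continuousOn.domRestrict⟩⟩

variable [IsManifold (𝓡 (2 * n)) ∞ M] [CompactSpace M] [FiniteDimensional ℝ V]

-- A compact set has a uniform thickening inside an open neighbourhood, and a segment between two
-- points of the manifold at distance less than `η` stays within distance `η` of one of them.
omit [IsManifold (𝓡 (2 * n)) ∞ M] [FiniteDimensional ℝ V] in
theorem SmoothRetract.exists_segment_mem (R : SmoothRetract (2 * n) M V) :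
    ∃ η > 0, ∀ x y, dist (R.incl x) (R.incl y) < η → ∀ s ∈ Icc (0 : ℝ) 1,
      (1 - s) • R.incl y + s • R.incl x ∈ R.dom := by
  obtain ⟨η, hη, h⟩ := (isCompact_range R.contMDiff_incl.continuous).exists_thickening_subset_open
    R.isOpen_dom (range_subset_iff.2 R.incl_mem)
  refine ⟨η, hη, fun x y hxy s hs => h (Metric.mem_thickening_iff.2 ⟨_, mem_range_self y, ?_⟩)⟩
  have e : (1 - s) • R.incl y + s • R.incl x - R.incl y = s • (R.incl x - R.incl y) := by module
  rw [dist_eq_norm, e, norm_smul, Real.norm_of_nonneg hs.1, ← dist_eq_norm]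
  calc s * dist (R.incl x) (R.incl y) ≤ 1 * dist (R.incl x) (R.incl y) := by
        gcongr
        exact hs.2
    _ < η := by rwa [one_mul]

instance : CompactSpace stdTriangle := isCompact_iff_compactSpace.1 isCompact_stdTriangle

-- The neighbourhood in the hypothesis fixes the combinatorial data and allows the maps to move by
-- less than `η`. So corresponding points are joined by segments on which the form is closed, and
-- the formula for surfaces glued in the same way applies.
omit [CompactSpace M] in
theorem area_sub_area_of_dist_lt (R : SmoothRetract (2 * n) M V) (Ω : SymplecticForm n M) {η : ℝ}
    (hη : ∀ x y, dist (R.incl x) (R.incl y) < η → ∀ s ∈ Icc (0 : ℝ) 1,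
      (1 - s) • R.incl y + s • R.incl x ∈ R.dom) {c₀ c : Σ x : ℝ → M, Capping (n := n) x}
    (h : cappingData R c ∈ Sigma.mk (cappingData R c₀).1 ''
      ({(cappingData R c₀).2.1} ×ˢ ({(cappingData R c₀).2.2.1} ×ˢ
        Metric.ball (cappingData R c₀).2.2.2 η))) :
    (c.2.area Ω - c₀.2.area Ω = homotopyArea (formV R Ω) (fun t => R.incl (c₀.1 t))
      fun t => R.incl (c.1 t)) ∧
    ∀ s ∈ Icc (0 : ℝ) 1, ∀ t ∈ Icc (0 : ℝ) 1,
      (1 - s) • R.incl (c₀.1 t) + s • R.incl (c.1 t) ∈ R.dom := by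
  obtain ⟨x, N, pair, free, hpp, hpf, w, hws, hwp, hwf⟩ := c
  obtain ⟨x₀, N₀, pair₀, free₀, hpp₀, hpf₀, u, hus, hup, huf⟩ := c₀
  obtain ⟨⟨pair', free', w'⟩, ⟨h1, h2, h3⟩, h4⟩ := h
  obtain ⟨h5, h6⟩ := Sigma.mk.inj_iff.1 h4
  have h5 : N₀ = N := h5
  subst h5
  have h6 := eq_of_heq h6
  obtain ⟨rfl, h7⟩ := Prod.mk_inj.1 h6
  obtain ⟨rfl, rfl⟩ := Prod.mk_inj.1 h7
  have h1 : pair₀ = pair' := h1.symm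
  have h2 : free₀ = free' := h2.symm
  simp only [h1, h2] at hup huf
  have hd : ∀ i, ∀ p ∈ stdTriangle, dist (R.incl (w i p)) (R.incl (u i p)) < η := by
    intro i p hp
    have h9 := (dist_le_pi_dist _ _ i).trans_lt (Metric.mem_ball.1 h3)
    exact (ContinuousMap.dist_apply_le_dist (⟨p, hp⟩ : stdTriangle)).trans_lt h9
  refine ⟨?_, fun s hs t ht => ?_⟩
  · rw [Capping.area_eq_sum R, Capping.area_eq_sum R]
    simp only
    rw [sum_triangleArea_sub (isClosedForm_formV R Ω) R.isOpen_dom hpp hpf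
      (u := fun i p => R.incl (u i p)) (w := fun i p => R.incl (w i p))
      (fun i => contMDiffOn_iff_contDiffOn.1 (R.contMDiff_incl.comp_contMDiffOn (hus i)))
      (fun i => contMDiffOn_iff_contDiffOn.1 (R.contMDiff_incl.comp_contMDiffOn (hws i)))
      (fun d hd t ht => congrArg R.incl (hup d hd t ht))
      (fun d hd t ht => congrArg R.incl (hwp d hd t ht))
      (fun i p hp s hs => hη _ _ (hd i p hp) s hs)]
    exact homotopyArea_congr (fun t ht => congrArg R.incl (huf t ht))
      fun t ht => congrArg R.incl (hwf t ht)
  · simp only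
    rw [← hwf t ht, ← huf t ht]
    exact hη _ _ (hd _ _ (side_mem _ ht)) s hs

/-- The space of capping data is second countable, so countably many of the chosen neighbourhoods
cover the data of `T`. The reference cappings are taken from `T` itself, so their boundaries are
again closed orbits. -/
theorem exists_countable_cappings (R : SmoothRetract (2 * n) M V) (Ω : SymplecticForm n M)
    (T : Set (Σ x : ℝ → M, Capping (n := n) x)) :
    ∃ (ι : Type) (_ : Countable ι) (f : ι → Σ x : ℝ → M, Capping (n := n) x), (∀ j, f j ∈ T) ∧
      ∀ c ∈ T, ∃ j,
        (c.2.area Ω - (f j).2.area Ω = homotopyArea (formV R Ω) (fun t => R.incl ((f j).1 t))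
          fun t => R.incl (c.1 t)) ∧
        ∀ s ∈ Icc (0 : ℝ) 1, ∀ t ∈ Icc (0 : ℝ) 1,
          (1 - s) • R.incl ((f j).1 t) + s • R.incl (c.1 t) ∈ R.dom := by
  obtain ⟨η, hη0, hη⟩ := R.exists_segment_mem
  let nhd : CappingData V → Set (CappingData V) := fun d =>
    Sigma.mk d.1 '' ({d.2.1} ×ˢ ({d.2.2.1} ×ˢ Metric.ball d.2.2.2 η))
  have hnhd : ∀ d, nhd d ∈ 𝓝 d := fun d =>
    (isOpenMap_sigmaMk _ ((isOpen_discrete _).prod ((isOpen_discrete _).prod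
      Metric.isOpen_ball))).mem_nhds ⟨d.2, ⟨rfl, rfl, Metric.mem_ball_self hη0⟩, rfl⟩
  obtain ⟨t, htT, htc, hT⟩ := TopologicalSpace.countable_cover_nhdsWithin
    (s := cappingData R '' T) (f := nhd) fun d _ => mem_nhdsWithin_of_mem_nhds (hnhd d)
  choose g hgT hg using fun d : t => htT d.2
  refine ⟨t, htc.to_subtype, g, hgT, fun c hc => ?_⟩
  obtain ⟨d, hd, hcd⟩ := mem_iUnion₂.1 (hT (mem_image_of_mem _ hc))
  refine ⟨⟨d, hd⟩, area_sub_area_of_dist_lt R Ω hη ?_⟩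
  rw [hg ⟨d, hd⟩]
  exact hcd

variable {R : SmoothRetract (2 * n) M V} {Ω : SymplecticForm n M} {K : ℝ × M → ℝ}
  {φ ψ : ℝ → (M ≃ₘ⟮𝓡 (2 * n), 𝓡 (2 * n)⟯ M)}

/-- Each reference capping determines one local action functional, with its area and its boundary
orbit as data. Every capped closed orbit is close to a reference capping, and its action is the
value of that functional at the starting point, which is critical. -/
theorem IsSmoothFlow.isCriticalValueSet_spec (h : IsSmoothFlow R Ω K ψ)
    (hK : ∀ t, 1 / 3 < t → ∀ x, K (t, x) = 0) :
    IsCriticalValueSet V (Spec Ω (toHam K h.smooth)) := by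
  obtain ⟨ι, hι, f, hfT, hf⟩ := exists_countable_cappings R Ω
    {c | IsHamOrbit Ω (toHam K h.smooth) c.1 ∧ c.1 0 = c.1 1}
  -- The reference orbit is continued by the flow to a path that is smooth on the whole line; only
  -- its values on `[0, 1]` enter the areas.
  let x₀ : ι → ℝ → V := fun j t => flowV R ψ (t, R.incl ((f j).1 0))
  have hx₀ : ∀ j, ContDiff ℝ ∞ (x₀ j) := fun j => contDiffOn_univ.1
    (h.contDiffOn_flowV.comp (f := fun t : ℝ => (t, R.incl ((f j).1 0)))
      (contDiff_id.prodMk contDiff_const).contDiffOn fun _ _ => ⟨mem_univ _, R.incl_mem _⟩)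
  have e : ∀ j, ∀ t ∈ Icc (0 : ℝ) 1, x₀ j t = R.incl ((f j).1 t) := fun j t ht => by
    rw [h.orbit_eq (hfT j).1 t ht]
    simp only [x₀, flowV, R.retr_incl]
  refine ⟨ι, hι, fun j => localAction R Ω K ψ ((f j).2.area Ω) (x₀ j),
    fun j => localDom R ψ (x₀ j), fun j => ⟨h.isOpen_localDom (hx₀ j),
      h.contDiffOn_localAction _ (hx₀ j)⟩, ?_⟩
  rintro a ⟨x, v, hx, hx1, rfl⟩
  obtain ⟨j, hj1, hj2⟩ := hf ⟨x, v⟩ ⟨hx, hx1⟩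
  have hj1' : v.area Ω - (f j).2.area Ω = homotopyArea (formV R Ω) (x₀ j)
      fun t => R.incl (x t) :=
    hj1.trans (homotopyArea_congr (fun t ht => (e j t ht).symm) fun _ _ => rfl)
  obtain ⟨hp, hW, ha⟩ := h.action_eq_localAction v hx hx1 (hx₀ j) hj1' fun s hs t ht => by
    rw [e j t ht]
    exact hj2 s hs t ht
  refine mem_iUnion.2 ⟨j, R.incl (x 0), ⟨hW, ?_⟩, ha.symm⟩
  refine h.fderiv_localAction hK _ (hx₀ j) ?_ hp hW
  rw [e j 0 (by simp), e j 1 (by simp), (hfT j).2]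

omit [IsManifold (𝓡 (2 * n)) ∞ M] [CompactSpace M] in
theorem hamPow_eq_zero (hK : ∀ t, 1 / 3 < t → ∀ x, K (t, x) = 0) (m : ℕ) {t : ℝ}
    (ht : 1 / 3 < t) (x : M) : hamPow K φ m (t, x) = 0 := by
  induction m generalizing x with
  | zero => rfl
  | succ m ih =>
    change K (t, x) + hamPow K φ m (t, (φ t).symm x) = 0
    rw [ih, hK t ht, add_zero]

/-- The spectra of the iterates of a Hamiltonian and their finite sums form a null set. -/
theorem IsSmoothFlow.volume_finiteSums_spec (h : IsSmoothFlow R Ω K φ)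
    (hK : ∀ t, 1 / 3 < t → ∀ x, K (t, x) = 0) :
    volume (finiteSums (⋃ m, Spec Ω (toHam (hamPow K φ m) (h.pow m).smooth))) = 0 :=
  (isCriticalValueSet_iUnion fun m => (h.pow m).isCriticalValueSet_spec
    fun _ ht => hamPow_eq_zero hK m ht).volume_finiteSums

end Countability

end SymplecticClosing

namespace SymplecticClosing

/-! ### Families of perturbations -/

/-- A continuous function on an interval with values in a null set is constant. -/
theorem eq_of_continuous_of_forall_mem_null {f : ℝ → ℝ} (hf : Continuous f) {Z : Set ℝ}
    (hZ : volume Z = 0) {a b : ℝ} (h : ∀ s ∈ uIcc a b, f s ∈ Z) : f a = f b := by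
  by_contra hne
  have h1 : uIcc (f a) (f b) ⊆ Z := (intermediate_value_uIcc hf.continuousOn).trans
    (image_subset_iff.2 h)
  have h2 := measure_mono_null h1 hZ
  rw [uIcc, Real.volume_Icc, ENNReal.ofReal_eq_zero, max_sub_min_eq_abs] at h2
  exact hne (sub_eq_zero.1 (abs_eq_zero.1 (le_antisymm h2 (abs_nonneg _)))).symm

section Families

variable {n : ℕ} {M : Type*} [TopologicalSpace M] [ChartedSpace (EuclideanSpace ℝ (Fin (2 * n))) M]
  [IsManifold (𝓡 (2 * n)) ∞ M] [CompactSpace M]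
  {V : Type} [NormedAddCommGroup V] [InnerProductSpace ℝ V] [FiniteDimensional ℝ V]
  {R : SmoothRetract (2 * n) M V} {Ω : SymplecticForm n M} {K : ℝ × M → ℝ} {G : M → ℝ}
  {φ Φ : ℝ → (M ≃ₘ⟮𝓡 (2 * n), 𝓡 (2 * n)⟯ M)} {δ : ℝ} {σ : ℝ → ℝ}

/-- Smoothness in the perturbation parameter jointly with time and space, by induction on the power;
it makes the family of powers continuous in the smooth topology. -/
theorem contMDiff_hamPow_pert (h : IsSmoothFlow R Ω K φ) (hG : ContMDiff (𝓡 (2 * n)) 𝓘(ℝ, ℝ) ∞ G)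
    (hΦ : ContMDiffOn (𝓘(ℝ, ℝ).prod (𝓡 (2 * n))) (𝓡 (2 * n)) ∞
      (fun p : ℝ × M => (Φ p.1).symm p.2) (Ioo (-δ) δ ×ˢ univ))
    (hσ : ContDiff ℝ ∞ σ) (hσδ : ∀ s, |σ s| < δ) (m : ℕ) :
    ContMDiff (𝓘(ℝ, ℝ).prod (𝓘(ℝ, ℝ).prod (𝓡 (2 * n)))) 𝓘(ℝ, ℝ) ∞
      fun q : ℝ × (ℝ × M) => hamPow (pertHam K G (σ q.1)) (pertFlow φ Φ (σ q.1)) m q.2 := by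
  have hσ1 : ContMDiff (𝓘(ℝ, ℝ).prod (𝓘(ℝ, ℝ).prod (𝓡 (2 * n)))) 𝓘(ℝ, ℝ) ∞
      fun q : ℝ × (ℝ × M) => σ q.1 := hσ.contMDiff.comp contMDiff_fst
  have ht : ContMDiff (𝓘(ℝ, ℝ).prod (𝓘(ℝ, ℝ).prod (𝓡 (2 * n)))) 𝓘(ℝ, ℝ) ∞
      fun q : ℝ × (ℝ × M) => q.2.1 := contMDiff_fst.comp contMDiff_snd
  have hx : ContMDiff (𝓘(ℝ, ℝ).prod (𝓘(ℝ, ℝ).prod (𝓡 (2 * n)))) (𝓡 (2 * n)) ∞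
      fun q : ℝ × (ℝ × M) => q.2.2 := contMDiff_snd.comp contMDiff_snd
  have hd : ContDiff ℝ ∞ (deriv lateStep) := (contDiff_infty_iff_deriv.1 contDiff_lateStep).2
  induction m with
  | zero => exact contMDiff_const
  | succ m ih =>
    have h1 : ContMDiff (𝓘(ℝ, ℝ).prod (𝓘(ℝ, ℝ).prod (𝓡 (2 * n)))) (𝓡 (2 * n)) ∞
        fun q : ℝ × (ℝ × M) => (Φ (σ q.1 * lateStep q.2.1)).symm q.2.2 :=
      hΦ.comp_contMDiff
        (f := fun q : ℝ × (ℝ × M) => (σ q.1 * lateStep q.2.1, q.2.2))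
        ((hσ1.mul (contDiff_lateStep.contMDiff.comp ht)).prodMk hx)
        fun q => ⟨mul_lateStep_mem (hσδ q.1) _, mem_univ _⟩
    have h2 : ContMDiff (𝓘(ℝ, ℝ).prod (𝓘(ℝ, ℝ).prod (𝓡 (2 * n)))) (𝓡 (2 * n)) ∞
        fun q : ℝ × (ℝ × M) => (pertFlow φ Φ (σ q.1) q.2.1).symm q.2.2 :=
      h.contMDiff_symm.comp (f := fun q : ℝ × (ℝ × M) =>
        (q.2.1, (Φ (σ q.1 * lateStep q.2.1)).symm q.2.2)) (ht.prodMk h1)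
    have h3 : ContMDiff (𝓘(ℝ, ℝ).prod (𝓘(ℝ, ℝ).prod (𝓡 (2 * n)))) 𝓘(ℝ, ℝ) ∞
        fun q : ℝ × (ℝ × M) => pertHam K G (σ q.1) q.2 :=
      (h.smooth.comp contMDiff_snd).add (hσ1.mul ((hd.contMDiff.comp ht).mul (hG.comp hx)))
    exact h3.add (ih.comp (f := fun q : ℝ × (ℝ × M) =>
      (q.1, (q.2.1, (pertFlow φ Φ (σ q.1) q.2.1).symm q.2.2)))
      (contMDiff_fst.prodMk (ht.prodMk h2)))

theorem continuous_toHam_hamPow_pert [T2Space M] (h : IsSmoothFlow R Ω K φ)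
    (hG : ContMDiff (𝓡 (2 * n)) 𝓘(ℝ, ℝ) ∞ G)
    (hΦ : ContMDiffOn (𝓘(ℝ, ℝ).prod (𝓡 (2 * n))) (𝓡 (2 * n)) ∞
      (fun p : ℝ × M => (Φ p.1).symm p.2) (Ioo (-δ) δ ×ˢ univ))
    (hσ : ContDiff ℝ ∞ σ) (hσδ : ∀ s, |σ s| < δ) (m : ℕ)
    (hp : ∀ s, IsSmoothFlow R Ω (pertHam K G (σ s)) (pertFlow φ Φ (σ s))) :
    Continuous[inferInstance, hamiltonianTopology n M] fun s =>
      toHam (hamPow (pertHam K G (σ s)) (pertFlow φ Φ (σ s)) m) ((hp s).pow m).smooth := by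
  have h1 := contMDiff_hamPow_pert h hG hΦ hσ hσδ m
  have h2 : ContMDiff (𝓘(ℝ, ℝ).prod ((𝓡∂ 1).prod (𝓡 (2 * n))))
      (𝓘(ℝ, ℝ).prod (𝓘(ℝ, ℝ).prod (𝓡 (2 * n)))) ∞
      fun q : ℝ × (unitInterval × M) => (q.1, ((q.2.1 : ℝ), q.2.2)) :=
    contMDiff_fst.prodMk ((contMDiff_subtypeVal_Icc.comp (contMDiff_fst.comp contMDiff_snd)).prodMk
      (contMDiff_snd.comp contMDiff_snd))
  exact continuous_smoothTopology (h1.comp h2) fun _ _ => rfl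

omit [CompactSpace M] in
theorem continuous_pertFlow_one [T2Space M] {ψ : M ≃ₘ⟮𝓡 (2 * n), 𝓡 (2 * n)⟯ M}
    (hΦ : ContMDiffOn (𝓘(ℝ, ℝ).prod (𝓡 (2 * n))) (𝓡 (2 * n)) ∞
      (fun p : ℝ × M => Φ p.1 p.2) (Ioo (-δ) δ ×ˢ univ))
    (hσ : ContDiff ℝ ∞ σ) (hσδ : ∀ s, |σ s| < δ) :
    Continuous[inferInstance, diffeoTopology n M] fun s => ψ.trans (Φ (σ s)) := by
  refine continuous_induced_rng.2 (continuous_smoothTopology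
    (F := fun p : ℝ × M => Φ (σ p.1) (ψ p.2)) ?_ fun _ _ => rfl)
  exact hΦ.comp_contMDiff (f := fun p : ℝ × M => (σ p.1, ψ p.2))
    ((hσ.contMDiff.comp contMDiff_fst).prodMk (ψ.contMDiff.comp contMDiff_snd))
    fun p => ⟨abs_lt.1 (hσδ p.1), mem_univ _⟩

theorem exists_contMDiff_bump [T2Space M] {U : Set M} (hU : IsOpen U) {x : M} (hx : x ∈ U) :
    ∃ G : M → ℝ, ContMDiff (𝓡 (2 * n)) 𝓘(ℝ, ℝ) ∞ G ∧ tsupport G ⊆ U ∧ (∀ z, 0 ≤ G z) ∧ G x ≠ 0 := by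
  obtain ⟨t, ht, htc, htU⟩ := exists_mem_nhds_isClosed_subset (hU.mem_nhds hx)
  obtain ⟨f, hf1, hf0, hf⟩ := exists_contMDiffMap_one_nhds_of_subset_interior (n := ⊤)
    (𝓡 (2 * n)) (isClosed_singleton (x := x)) (t := t) (singleton_subset_iff.2
      (mem_interior_iff_mem_nhds.2 ht))
  refine ⟨f, f.contMDiff, ?_, fun z => (hf z).1, ?_⟩
  · refine (closure_minimal ?_ htc).trans htU
    intro z hz
    by_contra hzt
    exact hz (hf0 z hzt)
  · rw [hf1.self_of_nhdsSet x rfl]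
    exact one_ne_zero

/-- A spectral function is constant along perturbations that create no periodic points in `U`. -/
theorem IsSpectral.eq_of_forall_notMem_periodicPts [T2Space M] {c : Hamiltonian n M → ℝ}
    (hc : IsSpectral Ω c) {U : Set M} (h : IsSmoothFlow R Ω K φ)
    (hK : ∀ t, 1 / 3 < t → ∀ x, K (t, x) = 0) (hφ : ∀ t, 1 / 3 ≤ t → φ t = φ 1)
    (hG : ContMDiff (𝓡 (2 * n)) 𝓘(ℝ, ℝ) ∞ G) (hGU : ∀ x, x ∉ U → G x = 0) (hΦ0 : ∀ x, Φ 0 x = x)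
    (hΦ : ContMDiffOn (𝓘(ℝ, ℝ).prod (𝓡 (2 * n))) (𝓡 (2 * n)) ∞
      (fun p : ℝ × M => (Φ p.1).symm p.2) (Ioo (-δ) δ ×ˢ univ))
    (hΦU : ∀ t ∈ Ioo (-δ) δ, ∀ x, x ∉ U → Φ t x = x)
    (hσ : ContDiff ℝ ∞ σ) (hσδ : ∀ s, |σ s| < δ)
    (hp : ∀ s, IsSmoothFlow R Ω (pertHam K G (σ s)) (pertFlow φ Φ (σ s))) {a b : ℝ}
    (hU : ∀ s ∈ uIcc a b, ∀ x ∈ U, x ∉ Function.periodicPts (pertFlow φ Φ (σ s) 1)) (m : ℕ) :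
    c (toHam (hamPow (pertHam K G (σ a)) (pertFlow φ Φ (σ a)) m) ((hp a).pow m).smooth) =
      c (toHam (hamPow (pertHam K G (σ b)) (pertFlow φ Φ (σ b)) m) ((hp b).pow m).smooth) := by
  have hcont := @Continuous.comp _ _ _ _ (hamiltonianTopology n M) _ _ _ hc.1
    (continuous_toHam_hamPow_pert h hG hΦ hσ hσδ m hp)
  -- The null set consists of the finite sums of actions of all powers of the unperturbed
  -- Hamiltonian, so it does not depend on `s`.
  refine eq_of_continuous_of_forall_mem_null hcont (h.volume_finiteSums_spec hK) fun s hs => ?_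
  obtain ⟨k, _, hk⟩ := hc.2
    (toHam (hamPow (pertHam K G (σ s)) (pertFlow φ Φ (σ s)) m) ((hp s).pow m).smooth)
  obtain ⟨l, b, hb, hab⟩ := specK_hamPow_subset (hp s) k m hk
  refine ⟨l, b, fun i => ?_, hab⟩
  obtain ⟨j, hj⟩ := mem_iUnion.1 (hb i)
  exact mem_iUnion.2 ⟨j, spec_hamPow_pert_subset h (hp s) hφ hΦ0 hGU hΦU (hσδ s) (hU s hs) j hj⟩

end Families

end SymplecticClosing

/-! ### The closing lemma. -/

theorem lemma2p1 {n : ℕ} {M : Type*} [TopologicalSpace M] [T2Space M] [CompactSpace M]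
    [ChartedSpace (EuclideanSpace ℝ (Fin (2 * n))) M] [IsManifold (𝓡 (2 * n)) ∞ M]
    [MeasurableSpace M] [BorelSpace M] (Ω : SymplecticForm n M)
    (h : (∃ c : ℕ → Hamiltonian n M → ℝ,
        (∀ k, 1 ≤ k → IsSpectral Ω (c k)) ∧ SatisfiesWeylLaw Ω c) ∨
      (∃ c ζ : ℕ → Hamiltonian n M → ℝ,
        (∀ k, 1 ≤ k → IsSpectral Ω (c k) ∧ IsSubadditive Ω (c k) ∧
          IsHomogenization Ω (c k) (ζ k)) ∧ SatisfiesWeylLaw Ω ζ)) :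
    ClosingLemmaHolds Ω := by
  rintro _ ⟨H, φH, hφH, rfl⟩ U hU ⟨x₁, hx₁⟩ V hV hφV
  by_contra hcon
  push Not at hcon
  have : Nonempty M := ⟨x₁⟩
  obtain ⟨N, ⟨R⟩⟩ := exists_smoothRetract (d := 2 * n) (M := M)
  have h0 : IsSmoothFlow R Ω (earlyHam H) fun t => φH (earlyTime t) := hφH.isSmoothFlow
  have hK : ∀ t, 1 / 3 < t → ∀ x, earlyHam H (t, x) = 0 := fun t ht x => earlyHam_eq_zero H ht x
  have hφ : ∀ t, 1 / 3 ≤ t → φH (earlyTime t) = φH (earlyTime 1) := fun t ht => by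
    rw [earlyTime_eq_one ht, earlyTime_eq_one (by norm_num)]
  obtain ⟨G, hG, hGU, hG0, hGx⟩ := exists_contMDiff_bump (n := n) hU hx₁
  obtain ⟨δ, hδ, Φ, hΦ0, hΦ, hΦs, hΦd, hΦt⟩ := exists_autonomous_flow R Ω hG
  -- A smooth parameter that starts at zero and stays in `(-δ, δ)` for all real `s`, so that the
  -- family of perturbations is defined on the whole line.
  let σ : ℝ → ℝ := fun s => δ / 2 * Real.sin s
  have hσ : ContDiff ℝ ∞ σ := contDiff_const.mul Real.contDiff_sin
  have hσδ : ∀ s, |σ s| < δ := fun s => by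
    have h1 := Real.abs_sin_le_one s
    rw [abs_mul, abs_of_pos (by positivity)]
    nlinarith
  have hp : ∀ s, IsSmoothFlow R Ω (pertHam (earlyHam H) G (σ s))
      (pertFlow (fun t => φH (earlyTime t)) Φ (σ s)) := fun s =>
    h0.pert hK hφ hG hΦ0 hΦd (hσδ s)
  have hone : ∀ s, pertFlow (fun t => φH (earlyTime t)) Φ (σ s) 1 = (φH 1).trans (Φ (σ s)) := by
    intro s
    rw [pertFlow, earlyTime_eq_one (by norm_num), lateStep_one, mul_one]
  have hGU' : ∀ x, x ∉ U → G x = 0 := fun x hx => image_eq_zero_of_notMem_tsupport fun h => hx (hGU h)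
  have hΦU : ∀ t ∈ Ioo (-δ) δ, ∀ x, x ∉ U → Φ t x = x := fun t ht x hx =>
    hΦt t ht x fun h => hx (hGU h)
  have hopen : IsOpen {s | (φH 1).trans (Φ (σ s)) ∈ V} :=
    (@continuous_def _ _ _ (diffeoTopology n M) _).1 (continuous_pertFlow_one hΦ hσ hσδ) V hV
  have hmem : (0 : ℝ) ∈ {s | (φH 1).trans (Φ (σ s)) ∈ V} := by
    have e : (φH 1).trans (Φ (σ 0)) = φH 1 := by
      ext x
      have : σ 0 = 0 := by simp [σ]
      rw [this]
      exact hΦ0 _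
    rw [mem_ofPred_eq, e]
    exact hφV
  obtain ⟨ε, hε, hεV⟩ := Metric.isOpen_iff.1 hopen 0 hmem
  -- Below `ε`, to remain in `V`; at most one, so that `sin s₁` is positive.
  let s₁ : ℝ := min (ε / 2) 1
  have hs₁ : 0 < s₁ := lt_min (by positivity) one_pos
  have hper : ∀ s ∈ uIcc 0 s₁, ∀ x ∈ U,
      x ∉ Function.periodicPts (pertFlow (fun t => φH (earlyTime t)) Φ (σ s) 1) := by
    intro s hs x hx
    rw [uIcc_of_le hs₁.le] at hs
    have hsV : (φH 1).trans (Φ (σ s)) ∈ V := hεV (by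
      rw [Metric.mem_ball, Real.dist_eq, sub_zero, abs_of_nonneg hs.1]
      exact hs.2.trans_lt ((min_le_left _ _).trans_lt (by linarith)))
    refine hcon _ ⟨⟨_, _, (hp s).isHamFlow, rfl⟩, ?_⟩ x hx
    rw [← hone] at hsV
    exact hsV
  have hconst : ∀ {c : Hamiltonian n M → ℝ}, IsSpectral Ω c → ∀ m,
      c (toHam _ ((hp 0).pow m).smooth) = c (toHam _ ((hp s₁).pow m).smooth) := fun hc m =>
    hc.eq_of_forall_notMem_periodicPts h0 hK hφ hG hGU' hΦ0 hΦs hΦU hσ hσδ hp hper m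
  have hpow1 : ∀ s, toHam _ ((hp s).pow 1).smooth = toHam _ (hp s).smooth := fun s => by
    ext ⟨t, x⟩
    exact add_zero _
  -- Constancy on first powers handles the first alternative, and constancy on all powers gives
  -- equal homogenizations in the second; in both, two sequences that agree for `k ≥ 1` have the
  -- same Weyl limit.
  have havg : average Ω (toHam _ (hp 0).smooth) = average Ω (toHam _ (hp s₁).smooth) := by
    rcases h with ⟨c, hc, hW⟩ | ⟨c, ζ, hc, hW⟩
    · refine tendsto_nhds_unique (hW _) ((hW _).congr' ?_)
      filter_upwards [eventually_ge_atTop 1] with k hk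
      have := hconst (hc k hk) 1
      rw [hpow1, hpow1] at this
      rw [this]
    · refine tendsto_nhds_unique (hW _) ((hW _).congr' ?_)
      filter_upwards [eventually_ge_atTop 1] with k hk
      have e : ζ k (toHam _ (hp 0).smooth) = ζ k (toHam _ (hp s₁).smooth) := by
        obtain ⟨hs, -, hh⟩ := hc k hk
        refine tendsto_nhds_unique (hh _ _ fun m => ((hp 0).isPower_iff m).2 rfl) ?_
        refine (hh _ _ fun m => ((hp s₁).isPower_iff m).2 rfl).congr fun m => ?_
        rw [hconst hs m]
      rw [e]
  -- The averages differ by `σ s₁` times the average of `G`, which is positive.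
  rw [average_pertHam Ω h0.smooth hG.continuous, average_pertHam Ω h0.smooth hG.continuous] at havg
  have hpos := integral_volume_pos Ω hG.continuous hG0 hGx
  have hσ0 : σ 0 = 0 := by simp [σ]
  have hσ1 : 0 < σ s₁ := mul_pos (by positivity) (Real.sin_pos_of_pos_of_le_one hs₁ (min_le_right _ _))
  have := mul_pos hσ1 hpos
  rw [hσ0] at havg
  linarith
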